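/- **Notation.** $\mathcal K$ is the algebra of compact operators on $\ell^2(\mathbb N)$; all homomorphisms are $*$-homomorphisms between (complex, not necessarily unital) C*-algebras. Two homomorphisms $X\to Y$ are homotopic if they are joined by a family $f_t$, $t\in[0,1]$, of homomorphisms such that $t\mapsto f_t(x)$ is norm continuous for every $x\in X$; $[X,Y]$ is the set of homotopy classes. For $f,g:X\to Y$ let $f\oplus g:X\to M_2(Y)$, $x\mapsto \mathrm{diag}(f(x),g(x))$. For $f,g:X\to\mathcal K\otimes Y$ we also write $f\oplus g$ for the composition with the isomorphism $M_2(\mathcal K\otimes Y)\cong\mathcal K\otimes Y$ given by $\ell^2(\mathbb N)\oplus\ell^2(\mathbb N)\cong\ell^2(\mathbb N)$, and $\mathcal K\otimes\mathcal K\cong\mathcal K$ is given by $\ell^2(\mathbb N)\otimes\ell^2(\mathbb N)\cong\ell^2(\mathbb N)$. Homomorphisms are tacitly extended to $2\times2$ matrices entrywise. For a C*-algebra $A$ let $QA=A\star A$ be the free product with its two inclusions $\iota,\bar\iota:A\to QA$, let $qA$ be the kernel of the map $QA\to A$ that identifies the two copies of $A$, and let $\pi_A:qA\to A$ be the restriction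 of $\mathrm{id}\star 0:QA\to A$. $Q$ and $q$ are functors. Put $KK(A,B)=[qA,\mathcal K\otimes B]$. The pair $(\mathrm{id}_{\mathcal K}\otimes\iota,\mathrm{id}_{\mathcal K}\otimes\bar\iota)$ induces a map $Q(\mathcal K\otimes B)\to\mathcal K\otimes QB$ that restricts to $\mu:q(\mathcal K\otimes B)\to\mathcal K\otimes qB$. Regard $qA$ as the $(1,1)$-corner of $\mathcal K\otimes qA$. **Universal maps.** Let $\varepsilon,\bar\varepsilon:A\to QA$ and $\eta,\bar\eta:QA\to Q^2A=Q(QA)$ be the inclusions and $q^2A=q(qA)\subset Q(qA)\subset Q^2A$. Let $R\subset M_2(Q(qA))\subset M_2(Q^2A)$ be the C*-algebra generated by the matrices $\begin{pmatrix}R_1&R_1R_2\\R_2R_1&R_2\end{pmatrix}$, $R_1=\eta(qA)$, $R_2=\bar\eta(qA)$, and let $J=R\cap M_2(q^2A)$, so that $R/J\cong M_2(qA)$. The diagonal maps $h_1=\eta\varepsilon\oplus\bar\eta\bar\varepsilon$, $h_2=\eta\bar\varepsilon\oplus\bar\eta\varepsilon$ and $d=\eta\varepsilon\oplus\bar\eta\varepsilon$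 send $A$ to multipliers of $R$. A *universal map* for $A$ is a homomorphism $\varphi_A:qA\to M_2(q^2A)$ of the form $q(h_1,\sigma h_2)$, i.e. the restriction to $qA$ of the map on $QA$ given by the pair $(h_1,\sigma h_2)$, where $\sigma=\mathrm{Ad}\,e^{\frac{\pi i}{2}S}$ for some self-adjoint multiplier $S$ of $R$ that lifts the multiplier $\begin{pmatrix}0&1\\1&0\end{pmatrix}$ of $R/J$ and satisfies $[S,d(x)]\in J$ for all $x\in A$. For $\alpha:qA\to\mathcal K\otimes B$ and $\beta:qB\to\mathcal K\otimes C$, let $\beta\,\sharp\,\alpha:qA\to\mathcal K\otimes C$ be the composition $$qA\xrightarrow{\varphi_A}M_2(q^2A)\xrightarrow{q(\alpha)}M_2(q(\mathcal K\otimes B))\xrightarrow{\mu}M_2(\mathcal K\otimes qB)\cong\mathcal K\otimes qB\xrightarrow{\mathrm{id}_{\mathcal K}\otimes\beta}\mathcal K\otimes\mathcal K\otimes C\cong\mathcal K\otimes C .$$ **Theorem.** Let $A,B,C,D$ be C*-algebras with $A$ separable. Then a universal map for $A$ exists, and any two universal maps for $A$ are homotopic. For every universal map $\varphi_A$ for $A$: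 1. $\mathrm{id}_{q^2A}\oplus 0$ is homotopic to $\varphi_A\pi_{qA}$ as maps $q^2A\to M_2(q^2A)$, and $\mathrm{id}_{qA}\oplus0$ is homotopic to $\pi_{qA}\varphi_A$ as maps $qA\to M_2(qA)$. The second homotopy can be lifted: there is a continuous family of homomorphisms $\lambda_t:qA\to R\subset M_2(Q(qA))$, $t\in[0,1]$, with $\pi_{qA}\lambda_0=\mathrm{id}_{qA}\oplus0$ and $\pi_{qA}\lambda_1=\pi_{qA}\varphi_A$, where $\pi_{qA}$ also denotes $\mathrm{id}\star0:Q(qA)\to qA$. 2. $[\alpha]\mapsto[\bar\alpha]$, $\bar\alpha=(\mathrm{id}_{\mathcal K}\otimes\pi_B)\,\alpha|_{qA}$, is a well-defined bijection from $[\mathcal K\otimes qA,\mathcal K\otimes qB]$ onto $KK(A,B)=[qA,\mathcal K\otimes B]$, additive for $\oplus$. Its inverse is $[\beta]\mapsto[\beta']$, where $\beta'=\mu(\mathrm{id}_{\mathcal K}\otimes q(\beta)\varphi_A):\mathcal K\otimes qA\to\mathcal K\otimes qB$ (with $M_2(\mathcal K\otimes qB)\cong\mathcal K\otimes qB$ and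 $\mathcal K\otimes\mathcal K\cong\mathcal K$ as above). 3. $([\alpha],[\beta])\mapsto[\beta\,\sharp\,\alpha]$ is a well-defined map $KK(A,B)\times KK(B,C)\to KK(A,C)$. 4. $[\overline{\beta\alpha}]=[\bar\beta\,\sharp\,\bar\alpha]$ for all homomorphisms $\alpha:\mathcal K\otimes qA\to\mathcal K\otimes qB$ and $\beta:\mathcal K\otimes qB\to\mathcal K\otimes qC$. 5. The product is associative: if $B$ is separable too, then, for every universal map $\varphi_B$ for $B$, $[(\gamma\,\sharp\,\beta)\,\sharp\,\alpha]=[\gamma\,\sharp\,(\beta\,\sharp\,\alpha)]$ for all $\alpha:qA\to\mathcal K\otimes B$, $\beta:qB\to\mathcal K\otimes C$ and $\gamma:qC\to\mathcal K\otimes D$. -/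

import Mathlib

open scoped Topology

noncomputable section

/-! ### Completing a complex *-algebra in a C*-seminorm -/

theorem hom_continuous {X Y : Type*} [NonUnitalCStarAlgebra X] [NonUnitalCStarAlgebra Y]
    (f : Y →⋆ₙₐ[ℂ] X) : Continuous f :=
  AddMonoidHomClass.continuous_of_bound f 1 fun x => by
    simpa using NonUnitalStarAlgHom.norm_apply_le f x

/-- A C*-seminorm on a complex *-algebra. -/
structure CStarSeminorm (S : Type*) [NonUnitalRing S] [StarRing S] [Module ℂ S] extends
    Seminorm ℂ S where
  mul_le' : ∀ x y, toFun (x * y) ≤ toFun x * toFun y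
  star_mul_self_ge' : ∀ x, toFun x * toFun x ≤ toFun (star x * x)

namespace CStarSeminorm

variable {S : Type*} [NonUnitalRing S] [StarRing S] [Module ℂ S]

instance instCoeFun : CoeFun (CStarSeminorm S) (fun _ => S → ℝ) := ⟨fun p => p.toSeminorm⟩

theorem mul_le (p : CStarSeminorm S) (x y : S) : p (x * y) ≤ p x * p y := p.mul_le' x y

theorem star_mul_self_ge (p : CStarSeminorm S) (x : S) : p x * p x ≤ p (star x * x) :=
  p.star_mul_self_ge' x

theorem le_star (p : CStarSeminorm S) (x : S) : p x ≤ p (star x) := by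
  have h := (p.star_mul_self_ge x).trans (p.mul_le _ _)
  have h0 : 0 ≤ p x := apply_nonneg p.toSeminorm x
  have h1 : 0 ≤ p (star x) := apply_nonneg p.toSeminorm _
  rcases h0.eq_or_lt with h2 | h2
  · rw [← h2]; exact h1
  · exact le_of_mul_le_mul_right h h2

theorem star_eq (p : CStarSeminorm S) (x : S) : p (star x) = p x :=
  le_antisymm (by simpa using p.le_star (star x)) (p.le_star x)

/-- The pointwise supremum of a pointwise bounded set of C*-seminorms. -/
def sup (P : Set (CStarSeminorm S)) (hP : ∀ x, ∃ C, ∀ p ∈ P, p x ≤ C) : CStarSeminorm S :=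
  have hb : ∀ x, BddAbove (Set.range fun p : P => p.1 x) := fun x => by
    obtain ⟨C, hC⟩ := hP x
    exact ⟨C, by rintro _ ⟨p, rfl⟩; exact hC p.1 p.2⟩
  have hn : ∀ x, 0 ≤ ⨆ p : P, p.1 x := fun x =>
    Real.iSup_nonneg fun p => apply_nonneg p.1.toSeminorm x
  { toFun := fun x => ⨆ p : P, p.1 x
    map_zero' := by simp [map_zero]
    add_le' := fun x y => Real.iSup_le (fun p => (map_add_le_add p.1.toSeminorm x y).trans
      (add_le_add (le_ciSup (hb x) p) (le_ciSup (hb y) p))) (add_nonneg (hn x) (hn y))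
    neg' := fun x => by simp [map_neg_eq_map]
    smul' := fun c x => by
      simp only [map_smul_eq_mul]
      rw [Real.mul_iSup_of_nonneg (norm_nonneg c)]
    mul_le' := fun x y => Real.iSup_le (fun p => (p.1.mul_le x y).trans
      (mul_le_mul (le_ciSup (hb x) p) (le_ciSup (hb y) p)
        (apply_nonneg p.1.toSeminorm y) (hn x))) (mul_nonneg (hn x) (hn y))
    star_mul_self_ge' := fun x => by
      have h1 : ⨆ p : P, p.1 x ≤ √(⨆ p : P, p.1 (star x * x)) := by
        refine Real.iSup_le (fun p => ?_) (Real.sqrt_nonneg _)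
        refine Real.le_sqrt_of_sq_le ?_
        rw [sq]
        exact (p.1.star_mul_self_ge x).trans (le_ciSup (hb (star x * x)) p)
      calc _ ≤ √(⨆ p : P, p.1 (star x * x)) * √(⨆ p : P, p.1 (star x * x)) :=
            mul_le_mul h1 h1 (hn x) (Real.sqrt_nonneg _)
        _ = _ := Real.mul_self_sqrt (hn _) }

theorem sup_apply (P : Set (CStarSeminorm S)) (hP : ∀ x, ∃ C, ∀ p ∈ P, p x ≤ C) (x : S) :
    sup P hP x = ⨆ p : P, p.1 x := rfl

theorem le_sup (P : Set (CStarSeminorm S)) (hP : ∀ x, ∃ C, ∀ p ∈ P, p x ≤ C)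
    {p : CStarSeminorm S} (hp : p ∈ P) (x : S) : p x ≤ sup P hP x := by
  obtain ⟨C, hC⟩ := hP x
  exact le_ciSup (f := fun p : P => p.1 x) ⟨C, by rintro _ ⟨p, rfl⟩; exact hC p.1 p.2⟩ ⟨p, hp⟩

theorem sup_le (P : Set (CStarSeminorm S)) (hP : ∀ x, ∃ C, ∀ p ∈ P, p x ≤ C) {x : S} {C : ℝ}
    (hC : 0 ≤ C) (h : ∀ p ∈ P, p x ≤ C) : sup P hP x ≤ C :=
  Real.iSup_le (fun p => h p.1 p.2) hC

/-- The C*-seminorm induced by a *-homomorphism into a C*-algebra. -/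
def ofHom {X : Type*} [NonUnitalCStarAlgebra X] (f : S →⋆ₙₐ[ℂ] X) : CStarSeminorm S where
  toFun := fun s => ‖f s‖
  map_zero' := by simp
  add_le' := fun x y => by simpa using norm_add_le (f x) (f y)
  neg' := fun x => by simp
  smul' := fun c x => by simp [norm_smul]
  mul_le' := fun x y => by simpa using norm_mul_le (f x) (f y)
  star_mul_self_ge' := fun x => by simp [map_star, CStarRing.norm_star_mul_self]

/-- The algebra `S`, seen as a seminormed algebra by means of `p`. -/
@[nolint unusedArguments]
def Pre (_ : CStarSeminorm S) : Type _ := S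

variable (p : CStarSeminorm S)

instance preRing : NonUnitalSeminormedRing p.Pre where
  __ : NonUnitalRing p.Pre := inferInstanceAs (NonUnitalRing S)
  norm := fun x => p (show S from x)
  dist := fun x y => p (show S from -x + y)
  dist_self := fun x => by
    rw [show (-x + x : p.Pre) = (0 : S) from neg_add_cancel x]; exact map_zero p.toSeminorm
  dist_comm := fun x y => by
    rw [← map_neg_eq_map p.toSeminorm]; congr 1
    exact (neg_add_rev (-x : S) y).trans (by rw [neg_neg])
  dist_triangle := fun x y z => by
    refine le_trans (le_of_eq ?_) (map_add_le_add p.toSeminorm _ _)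
    congr 1
    exact (by intros; abel : ∀ x y z : S, -x + z = -x + y + (-y + z)) x y z
  dist_eq := fun x y => rfl
  norm_mul_le := fun x y => p.mul_le x y

instance preModule : Module ℂ p.Pre := inferInstanceAs (Module ℂ S)
instance preStarRing : StarRing p.Pre := inferInstanceAs (StarRing S)
instance preTower [h : IsScalarTower ℂ S S] : IsScalarTower ℂ p.Pre p.Pre := h
instance preSMulComm [h : SMulCommClass ℂ S S] : SMulCommClass ℂ p.Pre p.Pre := h
instance preStarModule [h : StarModule ℂ S] : StarModule ℂ p.Pre := h

instance preNormedSpace : NormedSpace ℂ p.Pre where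
  norm_smul_le c x := (map_smul_eq_mul p.toSeminorm c (show S from x)).le

instance preNormedStar : NormedStarGroup p.Pre where
  norm_star_le x := (p.star_eq (show S from x)).le

/-- The identity, as a map from `S` to its seminormed copy. -/
def toPre : S →⋆ₙₐ[ℂ] p.Pre where
  toFun := fun x => x
  map_smul' _ _ := rfl
  map_zero' := rfl
  map_add' _ _ := rfl
  map_mul' _ _ := rfl
  map_star' _ := rfl

theorem norm_toPre (x : S) : ‖p.toPre x‖ = p x := rfl

end CStarSeminorm

namespace CStarCompletion

open UniformSpace UniformSpace.Completion

variable {S : Type*} [NonUnitalRing S] [StarRing S] [Module ℂ S] {p : CStarSeminorm S}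

instance instMul : Mul (Completion p.Pre) :=
  ⟨Function.curry <| ((isDenseInducing_coe (α := p.Pre)).prodMap
    (isDenseInducing_coe (α := p.Pre))).extend
      ((fun x : p.Pre => (x : Completion p.Pre)) ∘ Function.uncurry (· * ·))⟩

theorem coe_mul (x y : p.Pre) : ((x * y : p.Pre) : Completion p.Pre) = x * y :=
  (((isDenseInducing_coe (α := p.Pre)).prodMap (isDenseInducing_coe (α := p.Pre))).extend_eq
    ((Completion.continuous_coe p.Pre).comp (continuous_mul (M := p.Pre))) (x, y)).symm

instance instContinuousMul : ContinuousMul (Completion p.Pre) where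
  continuous_mul := by
    let m := (AddMonoidHom.mul : p.Pre →+ p.Pre →+ p.Pre).compr₂ toCompl
    have : Continuous fun x : p.Pre × p.Pre => m x.1 x.2 :=
      (continuous_coe p.Pre).comp continuous_mul
    have di : IsDenseInducing (toCompl : p.Pre → Completion p.Pre) := isDenseInducing_coe
    exact (di.extend_Z_bilin di this :)

instance instRing : NonUnitalNormedRing (Completion p.Pre) where
  __ : NormedAddCommGroup (Completion p.Pre) := inferInstance
  __ : Mul (Completion p.Pre) := inferInstance
  zero_mul a := Completion.induction_on a (isClosed_eq (by fun_prop) (by fun_prop)) fun a => by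
    rw [← coe_zero, ← coe_mul, zero_mul]
  mul_zero a := Completion.induction_on a (isClosed_eq (by fun_prop) (by fun_prop)) fun a => by
    rw [← coe_zero, ← coe_mul, mul_zero]
  mul_assoc a b c := Completion.induction_on₃ a b c
    (isClosed_eq (by fun_prop) (by fun_prop)) fun a b c => by
      simp only [← coe_mul, mul_assoc]
  left_distrib a b c := Completion.induction_on₃ a b c
    (isClosed_eq (by fun_prop) (by fun_prop)) fun a b c => by
      simp only [← coe_mul, ← coe_add, mul_add]
  right_distrib a b c := Completion.induction_on₃ a b c
    (isClosed_eq (by fun_prop) (by fun_prop)) fun a b c => by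
      simp only [← coe_mul, ← coe_add, add_mul]
  norm_mul_le a b := Completion.induction_on₂ a b
    (isClosed_le (by fun_prop) (by fun_prop)) fun a b => by
      simp only [← coe_mul, norm_coe]; exact norm_mul_le a b

instance instStar : Star (Completion p.Pre) := ⟨Completion.map (star : p.Pre → p.Pre)⟩

theorem coe_star (x : p.Pre) : ((star x : p.Pre) : Completion p.Pre) = star (x : Completion p.Pre) :=
  (Completion.map_coe (f := (star : p.Pre → p.Pre)) star_isometry.uniformContinuous x).symm

instance instContinuousStar : ContinuousStar (Completion p.Pre) := ⟨Completion.continuous_map⟩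

instance instStarRing : StarRing (Completion p.Pre) where
  star_involutive a := Completion.induction_on a
    (isClosed_eq (by fun_prop) (by fun_prop)) fun a => by
      simp only [← coe_star, star_star]
  star_mul a b := Completion.induction_on₂ a b
    (isClosed_eq (by fun_prop) (by fun_prop)) fun a b => by
      simp only [← coe_star, ← coe_mul, star_mul]
  star_add a b := Completion.induction_on₂ a b
    (isClosed_eq (by fun_prop) (by fun_prop)) fun a b => by
      simp only [← coe_star, ← coe_add, star_add]

instance cstarRing : CStarRing (Completion p.Pre) where
  norm_mul_self_le a := Completion.induction_on a
    (isClosed_le (by fun_prop) (by fun_prop)) fun a => by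
      simp only [← coe_star, ← coe_mul, norm_coe]; exact p.star_mul_self_ge a

instance instTower [IsScalarTower ℂ S S] : IsScalarTower ℂ (Completion p.Pre) (Completion p.Pre) where
  smul_assoc c a b := Completion.induction_on₂ a b
    (isClosed_eq ((continuous_fst.const_smul c).mul continuous_snd)
      ((continuous_fst.mul continuous_snd).const_smul c)) fun a b => by
      simp only [smul_eq_mul, ← coe_smul, ← coe_mul, smul_mul_assoc]

instance instSMulComm [SMulCommClass ℂ S S] : SMulCommClass ℂ (Completion p.Pre) (Completion p.Pre) where
  smul_comm c a b := Completion.induction_on₂ a b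
    (isClosed_eq ((continuous_fst.mul continuous_snd).const_smul c)
      (continuous_fst.mul (continuous_snd.const_smul c))) fun a b => by
      simp only [smul_eq_mul, ← coe_smul, ← coe_mul, mul_smul_comm]

instance instStarModule [StarModule ℂ S] : StarModule ℂ (Completion p.Pre) where
  star_smul c a := Completion.induction_on a
    (isClosed_eq (continuous_star.comp (continuous_const_smul c))
      (continuous_star.const_smul (star c))) fun a => by
      simp only [← coe_smul, ← coe_star, star_smul]

variable [IsScalarTower ℂ S S] [SMulCommClass ℂ S S] [StarModule ℂ S]

instance cstarAlgebra : NonUnitalCStarAlgebra (Completion p.Pre) where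

end CStarCompletion

namespace CStarSeminorm

open UniformSpace

variable {S : Type*} [NonUnitalRing S] [StarRing S] [Module ℂ S]
  [IsScalarTower ℂ S S] [SMulCommClass ℂ S S] [StarModule ℂ S] (p : CStarSeminorm S)

/-- The C*-algebra obtained from a *-algebra and a C*-seminorm by separation and completion. -/
@[nolint unusedArguments]
def Compl : Type _ := UniformSpace.Completion p.Pre

namespace Compl

instance instCStarAlgebra : NonUnitalCStarAlgebra p.Compl :=
  inferInstanceAs (NonUnitalCStarAlgebra (UniformSpace.Completion p.Pre))

/-- The canonical *-homomorphism into the completion. -/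
def of : S →⋆ₙₐ[ℂ] p.Compl where
  toFun := fun x => (p.toPre x : Completion p.Pre)
  map_smul' c x := Completion.coe_smul c (p.toPre x)
  map_zero' := rfl
  map_add' x y := Completion.coe_add (p.toPre x) (p.toPre y)
  map_mul' x y := CStarCompletion.coe_mul (p.toPre x) (p.toPre y)
  map_star' x := CStarCompletion.coe_star (p.toPre x)

variable {p}

theorem norm_of (x : S) : ‖of p x‖ = p x := Completion.norm_coe (p.toPre x)

theorem denseRange_of : DenseRange (of p) := Completion.denseRange_coe (α := p.Pre)

@[elab_as_elim]
theorem ind {P : p.Compl → Prop} (x : p.Compl) (hc : IsClosed {x | P x})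
    (h : ∀ s, P (of p s)) : P x := Completion.induction_on (α := p.Pre) x hc h

@[elab_as_elim]
theorem ind₂ {P : p.Compl → p.Compl → Prop} (x y : p.Compl)
    (hc : IsClosed {x : p.Compl × p.Compl | P x.1 x.2}) (h : ∀ s t, P (of p s) (of p t)) :
    P x y := Completion.induction_on₂ (α := p.Pre) (β := p.Pre) x y hc h

variable {X : Type*}

/-- Bounded linear maps extend to the completion. -/
def extendL [NormedAddCommGroup X] [NormedSpace ℂ X] [CompleteSpace X] (f : S →ₗ[ℂ] X) (C : ℝ)
    (hf : ∀ s, ‖f s‖ ≤ C * p s) : p.Compl →L[ℂ] X :=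
  have hc : UniformContinuous fun x : p.Pre => f x :=
    (AddMonoidHomClass.lipschitz_of_bound (E := p.Pre)
      (AddMonoidHom.mk' (fun x : p.Pre => f x) (map_add f)) C hf).uniformContinuous
  let e : p.Compl → X := Completion.extension (fun x : p.Pre => f x)
  have he : Continuous e := Completion.continuous_extension
  have hk : ∀ s : S, e (of p s) = f s := fun s => Completion.extension_coe hc _
  { toFun := e
    map_add' := fun a b => by
      refine ind₂ a b (isClosed_eq (he.comp (continuous_fst.add continuous_snd))
        ((he.comp continuous_fst).add (he.comp continuous_snd))) fun a b => ?_
      rw [← map_add, hk, hk, hk, map_add]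
    map_smul' := fun c a => by
      refine ind a (isClosed_eq (he.comp (continuous_const_smul c)) (he.const_smul c)) fun a => ?_
      rw [← map_smul, hk, hk, map_smul]; rfl
    cont := he }

theorem extendL_of [NormedAddCommGroup X] [NormedSpace ℂ X] [CompleteSpace X] (f : S →ₗ[ℂ] X)
    (C : ℝ) (hf : ∀ s, ‖f s‖ ≤ C * p s) (s : S) : extendL f C hf (of p s) = f s :=
  Completion.extension_coe (f := fun x : p.Pre => f x)
    (AddMonoidHomClass.lipschitz_of_bound (E := p.Pre)
      (AddMonoidHom.mk' (fun x : p.Pre => f x) (map_add f)) C hf).uniformContinuous _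

variable [NonUnitalCStarAlgebra X]

/-- A *-homomorphism that is bounded by the seminorm extends to the completion. -/
def lift (f : S →⋆ₙₐ[ℂ] X) (hf : ∀ s, ‖f s‖ ≤ p s) : p.Compl →⋆ₙₐ[ℂ] X :=
  let g := extendL (p := p) (f : S →ₗ[ℂ] X) 1 (by simpa using hf)
  have hg : ∀ s, g (of p s) = f s := extendL_of (p := p) (f : S →ₗ[ℂ] X) 1 _
  { toFun := g
    map_smul' := map_smul g
    map_zero' := map_zero g
    map_add' := map_add g
    map_mul' := fun a b => by
      refine ind₂ a b (isClosed_eq (by fun_prop) (by fun_prop)) fun a b => ?_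
      rw [← map_mul, hg, hg, hg, map_mul]
    map_star' := fun a => by
      refine ind a (isClosed_eq (by fun_prop) (by fun_prop)) fun a => ?_
      rw [← map_star, hg, hg, map_star] }

@[simp]
theorem lift_of (f : S →⋆ₙₐ[ℂ] X) (hf : ∀ s, ‖f s‖ ≤ p s) (s : S) : lift f hf (of p s) = f s :=
  extendL_of (p := p) (f : S →ₗ[ℂ] X) 1 (by simpa using hf) s

theorem hom_ext {f g : p.Compl →⋆ₙₐ[ℂ] X} (h : ∀ s, f (of p s) = g (of p s)) : f = g :=
  NonUnitalStarAlgHom.ext fun x =>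
    ind x (isClosed_eq (hom_continuous f) (hom_continuous g)) h

end Compl

end CStarSeminorm

/-! ### The free product of two C*-algebras -/

section FreeProd

open MulOpposite

/-- Noncommutative polynomials without constant term in the elements of `A` and of `B`: the
complex algebra of the free semigroup on `A ⊕ B`. -/
def WordAlg (A B : Type*) : Type _ := MonoidAlgebra ℂ (FreeSemigroup (A ⊕ B))

namespace WordAlg

variable {A B : Type*}

instance instRing : NonUnitalRing (WordAlg A B) :=
  inferInstanceAs (NonUnitalRing (MonoidAlgebra ℂ (FreeSemigroup (A ⊕ B))))
instance instModule : Module ℂ (WordAlg A B) :=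
  inferInstanceAs (Module ℂ (MonoidAlgebra ℂ (FreeSemigroup (A ⊕ B))))
instance instTower : IsScalarTower ℂ (WordAlg A B) (WordAlg A B) :=
  inferInstanceAs (IsScalarTower ℂ (MonoidAlgebra ℂ (FreeSemigroup (A ⊕ B)))
    (MonoidAlgebra ℂ (FreeSemigroup (A ⊕ B))))
instance instSMulComm : SMulCommClass ℂ (WordAlg A B) (WordAlg A B) :=
  inferInstanceAs (SMulCommClass ℂ (MonoidAlgebra ℂ (FreeSemigroup (A ⊕ B)))
    (MonoidAlgebra ℂ (FreeSemigroup (A ⊕ B))))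

/-- A scalar multiple of a word. -/
def mono (w : FreeSemigroup (A ⊕ B)) (c : ℂ) : WordAlg A B := MonoidAlgebra.single w c

/-- A letter. -/
def letter (x : A ⊕ B) : WordAlg A B := mono (FreeSemigroup.of x) 1

theorem mono_add (w : FreeSemigroup (A ⊕ B)) (c d : ℂ) : mono w (c + d) = mono w c + mono w d :=
  MonoidAlgebra.single_add w c d

theorem mono_zero (w : FreeSemigroup (A ⊕ B)) : mono w 0 = 0 := MonoidAlgebra.single_zero w

theorem smul_mono (c d : ℂ) (w : FreeSemigroup (A ⊕ B)) : c • mono w d = mono w (c * d) :=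
  MonoidAlgebra.smul_single c w d

theorem mono_mul (v w : FreeSemigroup (A ⊕ B)) (c d : ℂ) :
    mono v c * mono w d = mono (v * w) (c * d) :=
  MonoidAlgebra.single_mul_single v w c d

@[elab_as_elim]
theorem ind_linear {P : WordAlg A B → Prop} (x : WordAlg A B) (h0 : P 0)
    (ha : ∀ x y, P x → P y → P (x + y)) (hm : ∀ w c, P (mono w c)) : P x :=
  MonoidAlgebra.induction_linear x h0 ha hm

@[elab_as_elim]
theorem ind_letter {P : WordAlg A B → Prop} (x : WordAlg A B) (h0 : P 0)
    (ha : ∀ x y, P x → P y → P (x + y)) (hs : ∀ (c : ℂ) x, P x → P (c • x))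
    (hm : ∀ x y, P x → P y → P (x * y)) (hl : ∀ x, P (letter x)) : P x := by
  refine ind_linear x h0 ha fun w c => ?_
  have hw : P (mono w 1) := by
    induction w using FreeSemigroup.recOnMul with
    | ih1 x => exact hl x
    | ih2 x y hx hy => simpa [mono_mul] using hm _ _ hx hy
  simpa [smul_mono] using hs c _ hw

variable [InvolutiveStar A] [InvolutiveStar B]

/-- Reversal of a word, with the adjoint taken in each letter. -/
def rev : FreeSemigroup (A ⊕ B) →ₙ* (FreeSemigroup (A ⊕ B))ᵐᵒᵖ :=
  FreeSemigroup.lift fun x => op (FreeSemigroup.of (Sum.map star star x))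

theorem rev_rev (w : FreeSemigroup (A ⊕ B)) : unop (rev (unop (rev w))) = w := by
  induction w using FreeSemigroup.recOnMul with
  | ih1 x => rcases x with x | x <;> simp [rev]
  | ih2 x y hx hy => simp [hx, hy]

/-- The conjugate linear involution as an additive map. -/
def starHom : WordAlg A B →+ WordAlg A B :=
  (Finsupp.liftAddHom fun w => (MonoidAlgebra.singleAddHom (unop (rev w))).comp
    (starAddEquiv : ℂ ≃+ ℂ).toAddMonoidHom).comp
      (MonoidAlgebra.coeffAddEquiv (R := ℂ) (M := FreeSemigroup (A ⊕ B))).toAddMonoidHom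

theorem starHom_mono (w : FreeSemigroup (A ⊕ B)) (c : ℂ) :
    starHom (mono w c) = mono (unop (rev w)) (star c) := by
  exact Finsupp.liftAddHom_apply_single (fun w : FreeSemigroup (A ⊕ B) =>
    (MonoidAlgebra.singleAddHom (R := ℂ) (unop (rev w))).comp
      (starAddEquiv : ℂ ≃+ ℂ).toAddMonoidHom) w c

instance instStarRing : StarRing (WordAlg A B) where
  star := starHom
  star_involutive x := by
    refine ind_linear x ?_ ?_ ?_
    · simp
    · intro x y hx hy; simp [hx, hy]
    · intro w c; simp [starHom_mono, rev_rev]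
  star_add := map_add starHom
  star_mul x y := by
    change starHom (x * y) = starHom y * starHom x
    refine ind_linear x ?_ ?_ ?_
    · simp
    · intro x x' hx hx'; simp only [add_mul, mul_add, map_add, hx, hx']
    intro v c
    refine ind_linear y ?_ ?_ ?_
    · simp
    · intro x x' hx hx'; simp only [add_mul, mul_add, map_add, hx, hx']
    intro w d
    simp [mono_mul, starHom_mono, mul_comm]

theorem star_mono (w : FreeSemigroup (A ⊕ B)) (c : ℂ) :
    star (mono w c) = mono (unop (rev w)) (star c) := starHom_mono w c

theorem star_letter (x : A ⊕ B) : star (letter x) = letter (Sum.map star star x) := by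
  simp [letter, star_mono, rev]

instance instStarModule : StarModule ℂ (WordAlg A B) where
  star_smul c x := by
    refine ind_linear x ?_ ?_ ?_
    · simp
    · intro x y hx hy; simp [hx, hy]
    · intro w d; simp [smul_mono, star_mono]

end WordAlg

variable (A B : Type*) [NonUnitalCStarAlgebra A] [NonUnitalCStarAlgebra B]

/-- The C*-seminorms on noncommutative polynomials for which the two families of letters
are, up to elements of seminorm zero, (automatically contractive) *-homomorphic images of `A`
and of `B`. -/
def freeProdSeminorms : Set (CStarSeminorm (WordAlg A B)) :=
  {p | (∀ a, p (.letter (.inl a)) ≤ ‖a‖) ∧ (∀ b, p (.letter (.inr b)) ≤ ‖b‖) ∧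
    (∀ a a', p (.letter (.inl (a + a')) - (.letter (.inl a) + .letter (.inl a'))) = 0) ∧
    (∀ b b', p (.letter (.inr (b + b')) - (.letter (.inr b) + .letter (.inr b'))) = 0) ∧
    (∀ (c : ℂ) a, p (.letter (.inl (c • a)) - c • .letter (.inl a)) = 0) ∧
    (∀ (c : ℂ) b, p (.letter (.inr (c • b)) - c • .letter (.inr b)) = 0) ∧
    (∀ a a', p (.letter (.inl (a * a')) - .letter (.inl a) * .letter (.inl a')) = 0) ∧
    (∀ b b', p (.letter (.inr (b * b')) - .letter (.inr b) * .letter (.inr b')) = 0)}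

theorem freeProdSeminorms_bdd (x : WordAlg A B) :
    ∃ C, ∀ p ∈ freeProdSeminorms A B, p x ≤ C := by
  suffices ∃ C : ℝ, 0 ≤ C ∧ ∀ p ∈ freeProdSeminorms A B, p x ≤ C from
    let ⟨C, _, h⟩ := this; ⟨C, h⟩
  refine WordAlg.ind_letter x ?_ ?_ ?_ ?_ ?_
  · exact ⟨0, le_rfl, fun p _ => (map_zero p.toSeminorm).le⟩
  · rintro x y ⟨C, hC, h⟩ ⟨D, hD, k⟩
    exact ⟨C + D, by positivity, fun p hp => (map_add_le_add p.toSeminorm x y).trans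
      (add_le_add (h p hp) (k p hp))⟩
  · rintro c x ⟨C, hC, h⟩
    exact ⟨‖c‖ * C, by positivity, fun p hp => (map_smul_eq_mul p.toSeminorm c x).le.trans
      (mul_le_mul_of_nonneg_left (h p hp) (norm_nonneg c))⟩
  · rintro x y ⟨C, hC, h⟩ ⟨D, hD, k⟩
    exact ⟨C * D, by positivity, fun p hp => (p.mul_le x y).trans
      (mul_le_mul (h p hp) (k p hp) (apply_nonneg p.toSeminorm y) hC)⟩
  · rintro (a | b)
    · exact ⟨‖a‖, norm_nonneg a, fun p hp => hp.1 a⟩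
    · exact ⟨‖b‖, norm_nonneg b, fun p hp => hp.2.1 b⟩

/-- The largest of these C*-seminorms. -/
def freeProdSeminorm : CStarSeminorm (WordAlg A B) :=
  CStarSeminorm.sup (freeProdSeminorms A B) (freeProdSeminorms_bdd A B)

theorem freeProdSeminorm_eq_zero {x : WordAlg A B}
    (h : ∀ p ∈ freeProdSeminorms A B, p x = 0) : freeProdSeminorm A B x = 0 :=
  le_antisymm (CStarSeminorm.sup_le _ _ le_rfl fun p hp => (h p hp).le)
    (apply_nonneg (freeProdSeminorm A B).toSeminorm x)

/-- The (full, non-unital) free product `A ⋆ B` of two C*-algebras. -/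
def FreeProd : Type _ := (freeProdSeminorm A B).Compl

namespace FreeProd

open CStarSeminorm

instance instCStarAlgebra : NonUnitalCStarAlgebra (FreeProd A B) :=
  Compl.instCStarAlgebra (freeProdSeminorm A B)

/-- The canonical map from noncommutative polynomials to the free product. -/
def ofWord : WordAlg A B →⋆ₙₐ[ℂ] FreeProd A B := Compl.of (freeProdSeminorm A B)

variable {A B}

theorem ofWord_eq {x y : WordAlg A B} (h : ∀ p ∈ freeProdSeminorms A B, p (x - y) = 0) :
    ofWord A B x = ofWord A B y := by
  rw [← sub_eq_zero, ← map_sub, ← norm_eq_zero]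
  exact (Compl.norm_of _).trans (freeProdSeminorm_eq_zero A B h)

/-- The first canonical *-homomorphism into the free product. -/
def inl : A →⋆ₙₐ[ℂ] FreeProd A B where
  toFun a := ofWord A B (.letter (.inl a))
  map_zero' := by
    have h := ofWord_eq (A := A) (B := B) fun p hp => hp.2.2.2.2.1 0 0
    simpa using h
  map_add' a a' := by rw [← map_add]; exact ofWord_eq fun p hp => hp.2.2.1 a a'
  map_smul' c a := by
    rw [MonoidHom.id_apply, ← map_smul]; exact ofWord_eq fun p hp => hp.2.2.2.2.1 c a
  map_mul' a a' := by rw [← map_mul]; exact ofWord_eq fun p hp => hp.2.2.2.2.2.2.1 a a'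
  map_star' a := by rw [← map_star, WordAlg.star_letter]; rfl

/-- The second canonical *-homomorphism into the free product. -/
def inr : B →⋆ₙₐ[ℂ] FreeProd A B where
  toFun b := ofWord A B (.letter (.inr b))
  map_zero' := by
    have h := ofWord_eq (A := A) (B := B) fun p hp => hp.2.2.2.2.2.1 0 0
    simpa using h
  map_add' b b' := by rw [← map_add]; exact ofWord_eq fun p hp => hp.2.2.2.1 b b'
  map_smul' c b := by
    rw [MonoidHom.id_apply, ← map_smul]; exact ofWord_eq fun p hp => hp.2.2.2.2.2.1 c b
  map_mul' b b' := by rw [← map_mul]; exact ofWord_eq fun p hp => hp.2.2.2.2.2.2.2 b b'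
  map_star' b := by rw [← map_star, WordAlg.star_letter]; rfl

variable {X : Type*} [NonUnitalCStarAlgebra X]

theorem liftMagma_mono (f : FreeSemigroup (A ⊕ B) →ₙ* X) (w : FreeSemigroup (A ⊕ B)) :
    MonoidAlgebra.liftMagma ℂ f (MonoidAlgebra.single w 1) = f w :=
  DFunLike.congr_fun ((MonoidAlgebra.liftMagma ℂ).symm_apply_apply f) w

/-- Evaluation of noncommutative polynomials at a pair of *-homomorphisms. -/
def evalWord (f : A →⋆ₙₐ[ℂ] X) (g : B →⋆ₙₐ[ℂ] X) : WordAlg A B →⋆ₙₐ[ℂ] X :=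
  let e : WordAlg A B →ₙₐ[ℂ] X :=
    MonoidAlgebra.liftMagma ℂ (FreeSemigroup.lift (Sum.elim f g))
  have he : ∀ w c, e (.mono w c) = c • FreeSemigroup.lift (Sum.elim f g) w := fun w c => by
    have h1 : e (.mono w 1) = FreeSemigroup.lift (Sum.elim f g) w := liftMagma_mono _ w
    rw [← h1, ← map_smul, WordAlg.smul_mono, mul_one]
  have hw : ∀ w : FreeSemigroup (A ⊕ B), FreeSemigroup.lift (Sum.elim f g) (unop (WordAlg.rev w)) =
      star (FreeSemigroup.lift (Sum.elim f g) w) := fun w => by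
    induction w using FreeSemigroup.recOnMul with
    | ih1 x => rcases x with x | x <;> simp [WordAlg.rev, map_star]
    | ih2 x y hx hy => simp [hx, hy]
  { e with
    map_star' := fun x => by
      change e (star x) = star (e x)
      refine WordAlg.ind_linear x ?_ ?_ ?_
      · simp
      · intro x y hx hy; simp [hx, hy]
      · intro w c; simp [WordAlg.star_mono, he, hw] }

theorem evalWord_letter (f : A →⋆ₙₐ[ℂ] X) (g : B →⋆ₙₐ[ℂ] X) (x : A ⊕ B) :
    evalWord f g (.letter x) = Sum.elim f g x := by
  change MonoidAlgebra.liftMagma ℂ (FreeSemigroup.lift (Sum.elim f g))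
    (MonoidAlgebra.single (FreeSemigroup.of x) 1) = _
  exact liftMagma_mono _ _

theorem evalWord_le (f : A →⋆ₙₐ[ℂ] X) (g : B →⋆ₙₐ[ℂ] X) (x : WordAlg A B) :
    ‖evalWord f g x‖ ≤ freeProdSeminorm A B x := by
  have h : CStarSeminorm.ofHom (evalWord f g) ∈ freeProdSeminorms A B := by
    have k : ∀ x, CStarSeminorm.ofHom (evalWord f g) x = ‖evalWord f g x‖ := fun _ => rfl
    refine ⟨?_, ?_, ?_, ?_, ?_, ?_, ?_, ?_⟩ <;> intros <;>
      simp only [k, map_sub, map_add, map_smul, map_mul, evalWord_letter, Sum.elim_inl,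
        Sum.elim_inr, sub_self, norm_zero, NonUnitalStarAlgHom.norm_apply_le]
  exact CStarSeminorm.le_sup _ _ h x

/-- The universal property of the free product: the *-homomorphism `f ⋆ g`. -/
def lift (f : A →⋆ₙₐ[ℂ] X) (g : B →⋆ₙₐ[ℂ] X) : FreeProd A B →⋆ₙₐ[ℂ] X :=
  Compl.lift (evalWord f g) (evalWord_le f g)

@[simp]
theorem lift_inl (f : A →⋆ₙₐ[ℂ] X) (g : B →⋆ₙₐ[ℂ] X) (a : A) : lift f g (inl a) = f a :=
  (Compl.lift_of (evalWord f g) (evalWord_le f g) _).trans (evalWord_letter f g _)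

@[simp]
theorem lift_inr (f : A →⋆ₙₐ[ℂ] X) (g : B →⋆ₙₐ[ℂ] X) (b : B) : lift f g (inr b) = g b :=
  (Compl.lift_of (evalWord f g) (evalWord_le f g) _).trans (evalWord_letter f g _)

theorem hom_ext {f g : FreeProd A B →⋆ₙₐ[ℂ] X} (hl : ∀ a, f (inl a) = g (inl a))
    (hr : ∀ b, f (inr b) = g (inr b)) : f = g := by
  refine Compl.hom_ext (p := freeProdSeminorm A B) fun x => ?_
  change f (ofWord A B x) = g (ofWord A B x)
  refine WordAlg.ind_letter x ?_ ?_ ?_ ?_ ?_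
  · simp
  · intro x y hx hy; simp [hx, hy]
  · intro c x hx; simp [hx]
  · intro x y hx hy; simp [hx, hy]
  · rintro (a | b)
    · exact hl a
    · exact hr b

end FreeProd

end FreeProd

/-! ### The algebras `QA` and `qA` -/

section QA

variable (A : Type*) [NonUnitalCStarAlgebra A]

/-- `QA = A ⋆ A`. -/
abbrev Q : Type _ := FreeProd A A

/-- The inclusion of the first copy of `A` in `QA`. -/
def iota : A →⋆ₙₐ[ℂ] Q A := FreeProd.inl

/-- The inclusion of the second copy of `A` in `QA`. -/
def iotaBar : A →⋆ₙₐ[ℂ] Q A := FreeProd.inr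

/-- The map `QA → A` that identifies the two copies of `A`. -/
def fold : Q A →⋆ₙₐ[ℂ] A := FreeProd.lift (NonUnitalStarAlgHom.id ℂ A) (NonUnitalStarAlgHom.id ℂ A)

/-- The map `id ⋆ 0 : QA → A`. -/
def evalQ : Q A →⋆ₙₐ[ℂ] A := FreeProd.lift (NonUnitalStarAlgHom.id ℂ A) 0

/-- The kernel of `fold`, as a *-subalgebra of `QA`. -/
def qIdeal : NonUnitalStarSubalgebra ℂ (Q A) where
  carrier := {x | fold A x = 0}
  zero_mem' := map_zero _
  add_mem' {x y} hx hy := by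
    have hx : fold A x = 0 := hx
    have hy : fold A y = 0 := hy
    change fold A (x + y) = 0
    rw [map_add, hx, hy, add_zero]
  smul_mem' c x hx := by
    have hx : fold A x = 0 := hx
    change fold A (c • x) = 0
    rw [map_smul, hx, smul_zero]
  mul_mem' {x y} hx _ := by
    have hx : fold A x = 0 := hx
    change fold A (x * y) = 0
    rw [map_mul, hx, zero_mul]
  star_mem' {x} hx := by
    have hx : fold A x = 0 := hx
    change fold A (star x) = 0
    rw [map_star, hx, star_zero]

variable {A} in
theorem mem_qIdeal {x : Q A} : x ∈ qIdeal A ↔ fold A x = 0 := Iff.rfl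

instance qIdeal_isClosed : IsClosed (qIdeal A : Set (Q A)) :=
  isClosed_eq (hom_continuous (fold A)) continuous_const

/-- `qA`, the kernel of the map `QA → A` that identifies the two copies of `A`. -/
def q : Type _ := qIdeal A

instance q_instCStarAlgebra : NonUnitalCStarAlgebra (q A) :=
  (inferInstance : NonUnitalCStarAlgebra (qIdeal A))

/-- The inclusion of `qA` in `QA`. -/
def qIncl : q A →⋆ₙₐ[ℂ] Q A := NonUnitalStarSubalgebraClass.subtype (qIdeal A)

variable {A}

theorem qIncl_injective : Function.Injective (qIncl A) := Subtype.val_injective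

theorem fold_qIncl (z : q A) : fold A (qIncl A z) = 0 := z.2

/-- Corestriction of a *-homomorphism `X → QA` with values in `qA`. -/
def qCod {X : Type*} [NonUnitalCStarAlgebra X] (f : X →⋆ₙₐ[ℂ] Q A) (hf : ∀ x, fold A (f x) = 0) :
    X →⋆ₙₐ[ℂ] q A := NonUnitalStarAlgHom.codRestrict f (qIdeal A) hf

theorem qIncl_qCod {X : Type*} [NonUnitalCStarAlgebra X] (f : X →⋆ₙₐ[ℂ] Q A)
    (hf : ∀ x, fold A (f x) = 0) (x : X) : qIncl A (qCod f hf x) = f x := rfl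

variable (A) in
/-- The evaluation map `π_A : qA → A`, the restriction of `id ⋆ 0`. -/
def piMap : q A →⋆ₙₐ[ℂ] A := (evalQ A).comp (qIncl A)

variable {B : Type*} [NonUnitalCStarAlgebra B]

/-- The functor `Q` on morphisms. -/
def QMap (f : A →⋆ₙₐ[ℂ] B) : Q A →⋆ₙₐ[ℂ] Q B :=
  FreeProd.lift ((iota B).comp f) ((iotaBar B).comp f)

theorem fold_QMap (f : A →⋆ₙₐ[ℂ] B) (x : Q A) : fold B (QMap f x) = f (fold A x) := by
  suffices (fold B).comp (QMap f) = f.comp (fold A) from DFunLike.congr_fun this x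
  refine FreeProd.hom_ext (fun a => ?_) fun a => ?_ <;>
    simp [fold, QMap, iota, iotaBar]

/-- The functor `q` on morphisms: `q(f)` is the restriction of `Q(f)`. -/
def qMap (f : A →⋆ₙₐ[ℂ] B) : q A →⋆ₙₐ[ℂ] q B :=
  qCod ((QMap f).comp (qIncl A)) fun z => by
    rw [NonUnitalStarAlgHom.comp_apply, fold_QMap, fold_qIncl, map_zero]

end QA

/-! ### Stabilization: the C*-algebra `K ⊗ A` -/

section Stab

set_option linter.unusedSectionVars false

/-- Matrices over `A` indexed by `I`, with only finitely many nonzero entries. -/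
structure FinMat (I A : Type*) [Zero A] where
  entry : I → I → A
  finite' : ∃ F : Finset I, ∀ i j, (i ∉ F ∨ j ∉ F) → entry i j = 0

namespace FinMat

variable {I J K A B : Type*}

/-- All nonzero entries of `M` have both indices in `F`. -/
def Supp [Zero A] (F : Finset I) (M : FinMat I A) : Prop :=
  ∀ i j, (i ∉ F ∨ j ∉ F) → M.entry i j = 0

@[ext]
theorem ext [Zero A] {M N : FinMat I A} (h : ∀ i j, M.entry i j = N.entry i j) : M = N := by
  cases M; cases N; congr; funext i j; exact h i j

theorem Supp.mono [Zero A] {F G : Finset I} (h : F ⊆ G) {M : FinMat I A} (hM : M.Supp F) :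
    M.Supp G := fun i j hij => hM i j (hij.imp (fun h1 h2 => h1 (h h2)) fun h1 h2 => h1 (h h2))

theorem exists_supp [Zero A] (M : FinMat I A) : ∃ F, M.Supp F := M.finite'

open Classical in
theorem exists_supp₂ [Zero A] (M N : FinMat I A) : ∃ F, M.Supp F ∧ N.Supp F := by
  obtain ⟨F, hF⟩ := M.finite'
  obtain ⟨G, hG⟩ := N.finite'
  exact ⟨F ∪ G, Supp.mono Finset.subset_union_left hF, Supp.mono Finset.subset_union_right hG⟩

open Classical in
theorem exists_supp₃ [Zero A] (M N L : FinMat I A) : ∃ F, M.Supp F ∧ N.Supp F ∧ L.Supp F := by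
  obtain ⟨F, hF, hF'⟩ := exists_supp₂ M N
  obtain ⟨G, hG⟩ := L.finite'
  exact ⟨F ∪ G, Supp.mono Finset.subset_union_left hF, Supp.mono Finset.subset_union_left hF',
    Supp.mono Finset.subset_union_right hG⟩

section Algebra

variable [NonUnitalRing A] [Module ℂ A]

instance instZero : Zero (FinMat I A) := ⟨⟨fun _ _ => 0, ∅, fun _ _ _ => rfl⟩⟩

instance instAdd : Add (FinMat I A) :=
  ⟨fun M N => ⟨fun i j => M.entry i j + N.entry i j, by
    obtain ⟨F, hM, hN⟩ := exists_supp₂ M N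
    exact ⟨F, fun i j h => by rw [hM i j h, hN i j h, add_zero]⟩⟩⟩

instance instNeg : Neg (FinMat I A) :=
  ⟨fun M => ⟨fun i j => -M.entry i j, by
    obtain ⟨F, hM⟩ := M.finite'
    exact ⟨F, fun i j h => by rw [hM i j h, neg_zero]⟩⟩⟩

instance instSMul : SMul ℂ (FinMat I A) :=
  ⟨fun c M => ⟨fun i j => c • M.entry i j, by
    obtain ⟨F, hM⟩ := M.finite'
    exact ⟨F, fun i j h => by rw [hM i j h, smul_zero]⟩⟩⟩

instance instMul : Mul (FinMat I A) :=
  ⟨fun M N => ⟨fun i k => ∑ᶠ j, M.entry i j * N.entry j k, by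
    obtain ⟨F, hM, hN⟩ := exists_supp₂ M N
    refine ⟨F, fun i k h => finsum_eq_zero_of_forall_eq_zero fun j => ?_⟩
    rcases h with h | h
    · rw [hM i j (Or.inl h), zero_mul]
    · rw [hN j k (Or.inr h), mul_zero]⟩⟩

@[simp] theorem zero_entry (i j : I) : (0 : FinMat I A).entry i j = 0 := rfl
@[simp] theorem add_entry (M N : FinMat I A) (i j : I) :
    (M + N).entry i j = M.entry i j + N.entry i j := rfl
@[simp] theorem neg_entry (M : FinMat I A) (i j : I) : (-M).entry i j = -M.entry i j := rfl
@[simp] theorem smul_entry (c : ℂ) (M : FinMat I A) (i j : I) :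
    (c • M).entry i j = c • M.entry i j := rfl

theorem mul_entry {F : Finset I} {M : FinMat I A} (hM : M.Supp F) (N : FinMat I A) (i k : I) :
    (M * N).entry i k = ∑ j ∈ F, M.entry i j * N.entry j k := by
  refine finsum_eq_sum_of_support_subset _ fun j hj => ?_
  by_contra h
  exact hj (by simp only [hM i j (Or.inr h), zero_mul])

theorem supp_mul {F : Finset I} {M N : FinMat I A} (hM : M.Supp F) (hN : N.Supp F) :
    (M * N).Supp F := fun i k h => by
  rw [mul_entry hM]
  refine Finset.sum_eq_zero fun j _ => ?_
  rcases h with h | h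
  · rw [hM i j (Or.inl h), zero_mul]
  · rw [hN j k (Or.inr h), mul_zero]

theorem supp_add {F : Finset I} {M N : FinMat I A} (hM : M.Supp F) (hN : N.Supp F) :
    (M + N).Supp F := fun i k h => by rw [add_entry, hM i k h, hN i k h, add_zero]

instance instAddCommGroup : AddCommGroup (FinMat I A) where
  add_assoc M N L := by ext; simp [add_assoc]
  zero_add M := by ext; simp
  add_zero M := by ext; simp
  nsmul := nsmulRec
  zsmul := zsmulRec
  neg_add_cancel M := by ext; simp
  add_comm M N := by ext; simp [add_comm]

instance instRing : NonUnitalRing (FinMat I A) where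
  __ := instAddCommGroup
  __ := instMul
  left_distrib M N L := by
    obtain ⟨F, hM⟩ := exists_supp M
    ext i j; simp only [mul_entry hM, add_entry, mul_add, Finset.sum_add_distrib]
  right_distrib M N L := by
    obtain ⟨F, hM, hN⟩ := exists_supp₂ M N
    ext i j
    simp only [mul_entry hM, mul_entry hN, mul_entry (supp_add hM hN), add_entry, add_mul,
      Finset.sum_add_distrib]
  zero_mul M := by
    ext i j; rw [mul_entry (F := ∅) (fun _ _ _ => rfl)]; simp
  mul_zero M := by
    obtain ⟨F, hM⟩ := exists_supp M
    ext i j; rw [mul_entry hM]; simp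
  mul_assoc M N L := by
    obtain ⟨F, hM, hN⟩ := exists_supp₂ M N
    ext i j
    simp only [mul_entry hM, mul_entry hN, mul_entry (supp_mul hM hN), Finset.sum_mul,
      Finset.mul_sum, mul_assoc]
    exact Finset.sum_comm

instance instModule : Module ℂ (FinMat I A) where
  one_smul M := by ext; simp
  mul_smul c d M := by ext; simp [mul_smul]
  smul_zero c := by ext; simp
  smul_add c M N := by ext; simp
  add_smul c d M := by ext; simp [add_smul]
  zero_smul M := by ext; simp

theorem supp_smul {F : Finset I} {M : FinMat I A} (c : ℂ) (hM : M.Supp F) :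
    (c • M).Supp F := fun i k h => by rw [smul_entry, hM i k h, smul_zero]

instance instTower [IsScalarTower ℂ A A] : IsScalarTower ℂ (FinMat I A) (FinMat I A) where
  smul_assoc c M N := by
    obtain ⟨F, hM⟩ := exists_supp M
    ext i j
    simp only [smul_eq_mul, mul_entry hM, mul_entry (supp_smul c hM), smul_entry, Finset.smul_sum,
      smul_mul_assoc]

instance instSMulComm [SMulCommClass ℂ A A] : SMulCommClass ℂ (FinMat I A) (FinMat I A) where
  smul_comm c M N := by
    obtain ⟨F, hM⟩ := exists_supp M
    ext i j
    simp only [smul_eq_mul, mul_entry hM, smul_entry, Finset.smul_sum, mul_smul_comm]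

variable [StarRing A]

instance instStar : Star (FinMat I A) :=
  ⟨fun M => ⟨fun i j => star (M.entry j i), by
    obtain ⟨F, hM⟩ := M.finite'
    exact ⟨F, fun i j h => by rw [hM j i h.symm, star_zero]⟩⟩⟩

@[simp] theorem star_entry (M : FinMat I A) (i j : I) :
    (star M).entry i j = star (M.entry j i) := rfl

theorem supp_star {F : Finset I} {M : FinMat I A} (hM : M.Supp F) : (star M).Supp F :=
  fun i k h => by rw [star_entry, hM k i h.symm, star_zero]

instance instStarRing : StarRing (FinMat I A) where
  star_involutive M := by ext; simp
  star_add M N := by ext; simp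
  star_mul M N := by
    obtain ⟨F, hM, hN⟩ := exists_supp₂ M N
    ext i j
    simp [mul_entry hM, mul_entry (supp_star hN)]

instance instStarModule [StarModule ℂ A] : StarModule ℂ (FinMat I A) where
  star_smul c M := by ext; simp

open Classical in
/-- The matrix with the single entry `a` at `(i, j)`. -/
def single (i j : I) (a : A) : FinMat I A :=
  ⟨fun i' j' => if i' = i ∧ j' = j then a else 0, {i, j}, fun i' j' h => by
    rw [if_neg]; rintro ⟨rfl, rfl⟩; simp at h⟩

/-- `a ↦ e_{ii} ⊗ a` as a *-homomorphism. -/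
def singleHom (i : I) : A →⋆ₙₐ[ℂ] FinMat I A where
  toFun := single i i
  map_smul' c a := by ext; simp [single]
  map_zero' := by ext; simp [single]
  map_add' a b := by ext i' j'; by_cases h : i' = i ∧ j' = i <;> simp [single, h]
  map_mul' a b := by
    ext i' j'
    rw [mul_entry (F := {i}) fun i' j' h => if_neg fun h' => by simp [h'] at h]
    by_cases h1 : i' = i <;> by_cases h2 : j' = i <;> simp [single, h1, h2]
  map_star' a := by
    ext i' j'
    by_cases h1 : i' = i <;> by_cases h2 : j' = i <;> simp [single, h1, h2]

theorem sum_entry {ι : Type*} (s : Finset ι) (f : ι → FinMat I A) (i j : I) :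
    (∑ x ∈ s, f x).entry i j = ∑ x ∈ s, (f x).entry i j := by
  classical
  induction s using Finset.induction_on with
  | empty => rfl
  | insert a s ha ih => rw [Finset.sum_insert ha, Finset.sum_insert ha, add_entry, ih]

theorem eq_sum_single {F : Finset I} {M : FinMat I A} (hM : M.Supp F) :
    M = ∑ i ∈ F, ∑ j ∈ F, single i j (M.entry i j) := by
  classical
  ext i j
  simp only [sum_entry, single]
  by_cases h : i ∈ F ∧ j ∈ F
  · rw [Finset.sum_eq_single_of_mem i h.1, Finset.sum_eq_single_of_mem j h.2]
    · simp
    · intro b _ hb; simp [hb.symm]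
    · intro b _ hb
      refine Finset.sum_eq_zero fun c _ => ?_
      simp [hb.symm]
  · rw [hM i j (by tauto)]
    symm
    refine Finset.sum_eq_zero fun a ha => Finset.sum_eq_zero fun b hb => ?_
    rw [if_neg]; rintro ⟨rfl, rfl⟩; exact h ⟨ha, hb⟩

@[elab_as_elim]
theorem ind {P : FinMat I A → Prop} (M : FinMat I A) (h0 : P 0)
    (ha : ∀ M N, P M → P N → P (M + N)) (hs : ∀ i j a, P (single i j a)) : P M := by
  obtain ⟨F, hM⟩ := exists_supp M
  rw [eq_sum_single hM]
  exact Finset.sum_induction _ P ha h0 fun i _ =>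
    Finset.sum_induction _ P ha h0 fun j _ => hs _ _ _

/-- Moving entries: the entry of `M` at `(m, n)` is placed at `(u m, v n)`. -/
def spread (u v : J ↪ K) : FinMat J A →ₗ[ℂ] FinMat K A where
  toFun M := ⟨fun r s => Function.extend u (fun m => Function.extend v (M.entry m) 0 s) 0 r, by
    classical
    obtain ⟨F, hM⟩ := M.finite'
    refine ⟨F.map u ∪ F.map v, fun r s h => ?_⟩
    by_cases hr : ∃ m, u m = r
    · obtain ⟨m, rfl⟩ := hr
      rw [u.injective.extend_apply]
      by_cases hs : ∃ n, v n = s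
      · obtain ⟨n, rfl⟩ := hs
        rw [v.injective.extend_apply]
        refine hM m n ?_
        rcases h with h | h
        · exact Or.inl fun hm => h (Finset.mem_union_left _ (Finset.mem_map_of_mem u hm))
        · exact Or.inr fun hm => h (Finset.mem_union_right _ (Finset.mem_map_of_mem v hm))
      · rw [Function.extend_apply' _ _ _ hs]; rfl
    · rw [Function.extend_apply' _ _ _ hr]; rfl⟩
  map_add' M N := by
    ext r s
    simp only [add_entry]
    by_cases hr : ∃ m, u m = r
    · obtain ⟨m, rfl⟩ := hr
      simp only [u.injective.extend_apply]
      by_cases hs : ∃ n, v n = s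
      · obtain ⟨n, rfl⟩ := hs
        simp [v.injective.extend_apply]
      · simp [Function.extend_apply' _ _ _ hs]
    · simp [Function.extend_apply' _ _ _ hr]
  map_smul' c M := by
    ext r s
    simp only [smul_entry, RingHom.id_apply]
    by_cases hr : ∃ m, u m = r
    · obtain ⟨m, rfl⟩ := hr
      simp only [u.injective.extend_apply]
      by_cases hs : ∃ n, v n = s
      · obtain ⟨n, rfl⟩ := hs
        simp [v.injective.extend_apply]
      · simp [Function.extend_apply' _ _ _ hs]
    · simp [Function.extend_apply' _ _ _ hr]

@[simp]
theorem spread_entry (u v : J ↪ K) (M : FinMat J A) (m n : J) :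
    (spread u v M).entry (u m) (v n) = M.entry m n := by
  simp [spread, u.injective.extend_apply, v.injective.extend_apply]

theorem spread_entry_left (u v : J ↪ K) (M : FinMat J A) (r s : K) (h : ¬ ∃ m, u m = r) :
    (spread u v M).entry r s = 0 := by
  simp [spread, Function.extend_apply' _ _ _ h]

theorem spread_entry_right (u v : J ↪ K) (M : FinMat J A) (r s : K) (h : ¬ ∃ n, v n = s) :
    (spread u v M).entry r s = 0 := by
  by_cases hr : ∃ m, u m = r
  · obtain ⟨m, rfl⟩ := hr
    simp [spread, u.injective.extend_apply, Function.extend_apply' _ _ _ h]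
  · exact spread_entry_left u v M r s hr

theorem spread_ext {u v : J ↪ K} {M : FinMat J A} {N : FinMat K A}
    (h : ∀ m n, N.entry (u m) (v n) = M.entry m n)
    (hl : ∀ r s, (¬ ∃ m, u m = r) → N.entry r s = 0)
    (hr : ∀ r s, (¬ ∃ n, v n = s) → N.entry r s = 0) : N = spread u v M := by
  ext r s
  by_cases hu : ∃ m, u m = r
  · by_cases hv : ∃ n, v n = s
    · obtain ⟨m, rfl⟩ := hu
      obtain ⟨n, rfl⟩ := hv
      rw [h, spread_entry]
    · rw [hr r s hv, spread_entry_right u v M r s hv]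
  · rw [hl r s hu, spread_entry_left u v M r s hu]

theorem spread_star (u v : J ↪ K) (M : FinMat J A) : star (spread u v M) = spread v u (star M) := by
  refine spread_ext (fun m n => ?_) (fun r s h => ?_) fun r s h => ?_
  · simp
  · rw [star_entry, spread_entry_right u v M s r h, star_zero]
  · rw [star_entry, spread_entry_left u v M s r h, star_zero]

theorem spread_mul (u v w : J ↪ K) (M N : FinMat J A) :
    spread u v M * spread v w N = spread u w (M * N) := by
  have key : ∀ r s, (spread u v M * spread v w N).entry r s =
      ∑ᶠ j, (spread u v M).entry r (v j) * (spread v w N).entry (v j) s := fun r s => by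
    change ∑ᶠ j, (spread u v M).entry r j * (spread v w N).entry j s = _
    rw [← finsum_mem_range v.injective
      (f := fun j => (spread u v M).entry r j * (spread v w N).entry j s)]
    rw [finsum_mem_def]
    refine finsum_congr fun j => ?_
    by_cases hj : j ∈ Set.range v
    · rw [Set.indicator_of_mem hj]
    · rw [Set.indicator_of_notMem hj, spread_entry_right u v M r j hj, zero_mul]
  refine spread_ext (fun m n => ?_) (fun r s h => ?_) fun r s h => ?_
  · rw [key]; simp only [spread_entry]; rfl
  · rw [key]
    exact finsum_eq_zero_of_forall_eq_zero fun j => by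
      rw [spread_entry_left u v M _ _ h, zero_mul]
  · rw [key]
    exact finsum_eq_zero_of_forall_eq_zero fun j => by
      rw [spread_entry_right v w N _ _ h, mul_zero]

theorem spread_mul_of_disjoint (u v v' w : J ↪ K) (h : ∀ m n, v m ≠ v' n) (M N : FinMat J A) :
    spread u v M * spread v' w N = 0 := by
  ext r s
  refine finsum_eq_zero_of_forall_eq_zero fun j => ?_
  by_cases hj : ∃ m, v m = j
  · obtain ⟨m, rfl⟩ := hj
    rw [spread_entry_left v' w N (v m) s (by rintro ⟨n, hn⟩; exact h m n hn.symm), mul_zero]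
  · rw [spread_entry_right u v M r j hj, zero_mul]

/-- Moving entries along one injection is a *-homomorphism. -/
def spreadHom (u : J ↪ K) : FinMat J A →⋆ₙₐ[ℂ] FinMat K A where
  toFun := spread u u
  map_smul' := map_smul _
  map_zero' := map_zero _
  map_add' := map_add _
  map_mul' M N := (spread_mul u u u M N).symm
  map_star' M := (spread_star u u M).symm

end Algebra

section Norm

variable [NonUnitalCStarAlgebra A] [NonUnitalCStarAlgebra B]

/-- Matrices over a C*-algebra form a C*-algebra (for the canonical order on `A`). -/
instance cstarMatrix (n : Type*) [Fintype n] : NonUnitalCStarAlgebra (CStarMatrix n n A) :=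
  letI := CStarAlgebra.spectralOrder A
  letI := CStarAlgebra.spectralOrderedRing A
  CStarMatrix.instNonUnitalCStarAlgebra

/-- A matrix over a finite index set as a finitely supported matrix. -/
def ofMat (n : Type*) [Fintype n] : CStarMatrix n n A →⋆ₙₐ[ℂ] FinMat n A where
  toFun M := ⟨fun i j => M i j, Finset.univ, fun i j h => by simp at h⟩
  map_smul' c M := by ext; rfl
  map_zero' := by ext; rfl
  map_add' M N := by ext; rfl
  map_mul' M N := by
    ext i j
    rw [mul_entry (F := Finset.univ) fun i j h => by simp at h]
    exact CStarMatrix.mul_apply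
  map_star' M := by ext; rfl

/-- The corner of `M` with indices in `F`. -/
def cut (F : Finset I) (M : FinMat I A) : CStarMatrix F F A :=
  CStarMatrix.ofMatrix fun i j => M.entry i j

theorem cut_mul {F : Finset I} {M : FinMat I A} (hM : M.Supp F) (N : FinMat I A) :
    cut F (M * N) = cut F M * cut F N := by
  ext i j
  rw [CStarMatrix.mul_apply]
  refine (mul_entry hM N i j).trans ?_
  exact (Finset.sum_coe_sort F fun k => M.entry i k * N.entry k j).symm

/-- The inclusion of the matrices over `F`. -/
def incl (F : Finset I) : CStarMatrix F F A →⋆ₙₐ[ℂ] FinMat I A :=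
  (spreadHom (Function.Embedding.subtype (· ∈ F))).comp (ofMat F)

theorem incl_entry (F : Finset I) (M : CStarMatrix F F A) (i j : F) :
    (incl F M).entry i j = M i j :=
  spread_entry (Function.Embedding.subtype (· ∈ F)) (Function.Embedding.subtype (· ∈ F)) _ i j

theorem supp_incl (F : Finset I) (M : CStarMatrix F F A) : (incl F M).Supp F := fun i j h => by
  rcases h with h | h
  · exact spread_entry_left _ _ _ _ _ (by rintro ⟨m, rfl⟩; exact h m.2)
  · exact spread_entry_right _ _ _ _ _ (by rintro ⟨m, rfl⟩; exact h m.2)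

theorem incl_cut {F : Finset I} {M : FinMat I A} (hM : M.Supp F) : incl F (cut F M) = M := by
  ext i j
  by_cases h : i ∈ F ∧ j ∈ F
  · exact incl_entry F (cut F M) ⟨i, h.1⟩ ⟨j, h.2⟩
  · rw [supp_incl F _ i j (by tauto), hM i j (by tauto)]

theorem norm_cut_eq {F G : Finset I} (h : F ⊆ G) {M : FinMat I A} (hM : M.Supp F) :
    ‖cut G M‖ = ‖cut F M‖ := by
  let f : CStarMatrix F F A →⋆ₙₐ[ℂ] CStarMatrix G G A :=
    { toFun := fun M => cut G (incl F M)
      map_smul' := fun c M => by rw [map_smul]; rfl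
      map_zero' := by rw [map_zero]; rfl
      map_add' := fun M N => by rw [map_add]; rfl
      map_mul' := fun M N => by rw [map_mul, cut_mul ((supp_incl F M).mono h)]
      map_star' := fun M => by rw [map_star]; rfl }
  have hf : Function.Injective f := fun M N hMN => by
    ext i j
    have := congrFun (congrFun hMN ⟨i, h i.2⟩) ⟨j, h j.2⟩
    rw [← incl_entry F M i j, ← incl_entry F N i j]
    exact this
  have := NonUnitalStarAlgHom.norm_map f hf (cut F M)
  rw [← this]
  change _ = ‖cut G (incl F (cut F M))‖
  rw [incl_cut hM]

/-- The norm of a finitely supported matrix `M` is the norm of a finite corner that contains all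
its nonzero entries; `matNorm_eq` shows that every such corner gives the same value. -/
def matNorm (M : FinMat I A) : ℝ := ‖cut M.finite'.choose M‖

theorem matNorm_eq {F : Finset I} {M : FinMat I A} (hM : M.Supp F) : matNorm M = ‖cut F M‖ := by
  classical
  have h0 : M.Supp M.finite'.choose := M.finite'.choose_spec
  rw [matNorm, ← norm_cut_eq (Finset.subset_union_left (s₂ := F)) h0,
    norm_cut_eq Finset.subset_union_right hM]

variable (I A) in
/-- The C*-norm on finitely supported matrices. -/
def matSeminorm : CStarSeminorm (FinMat I A) where
  toFun := matNorm
  map_zero' := by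
    rw [matNorm_eq (F := ∅) fun _ _ _ => rfl, show cut ∅ (0 : FinMat I A) = 0 from rfl, norm_zero]
  add_le' M N := by
    obtain ⟨F, hM, hN⟩ := exists_supp₂ M N
    rw [matNorm_eq hM, matNorm_eq hN, matNorm_eq (supp_add hM hN)]
    exact norm_add_le (cut F M) (cut F N)
  neg' M := by
    obtain ⟨F, hM⟩ := exists_supp M
    rw [matNorm_eq hM, matNorm_eq (F := F) fun i j h => by rw [neg_entry, hM i j h, neg_zero]]
    exact norm_neg (cut F M)
  smul' c M := by
    obtain ⟨F, hM⟩ := exists_supp M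
    rw [matNorm_eq hM, matNorm_eq (supp_smul c hM)]
    exact norm_smul c (cut F M)
  mul_le' M N := by
    obtain ⟨F, hM, hN⟩ := exists_supp₂ M N
    rw [matNorm_eq hM, matNorm_eq hN, matNorm_eq (supp_mul hM hN), cut_mul hM]
    exact norm_mul_le (cut F M) (cut F N)
  star_mul_self_ge' M := by
    obtain ⟨F, hM⟩ := exists_supp M
    rw [matNorm_eq hM, matNorm_eq (supp_mul (supp_star hM) hM), cut_mul (supp_star hM)]
    exact (CStarRing.norm_star_mul_self (x := cut F M)).ge

theorem matSeminorm_apply (M : FinMat I A) : matSeminorm I A M = matNorm M := rfl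

theorem norm_hom_le {X : Type*} [NonUnitalCStarAlgebra X] (f : FinMat I A →⋆ₙₐ[ℂ] X)
    (M : FinMat I A) : ‖f M‖ ≤ matSeminorm I A M := by
  obtain ⟨F, hM⟩ := exists_supp M
  rw [matSeminorm_apply, matNorm_eq hM]
  have := NonUnitalStarAlgHom.norm_apply_le (f.comp (incl F)) (cut F M)
  rwa [NonUnitalStarAlgHom.comp_apply, incl_cut hM] at this

/-- Applying a *-homomorphism to each entry. -/
def map (f : A →⋆ₙₐ[ℂ] B) : FinMat I A →⋆ₙₐ[ℂ] FinMat I B where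
  toFun M := ⟨fun i j => f (M.entry i j), by
    obtain ⟨F, hM⟩ := M.finite'
    exact ⟨F, fun i j h => by rw [hM i j h, map_zero]⟩⟩
  map_smul' c M := by ext; simp
  map_zero' := by ext; simp
  map_add' M N := by ext; simp
  map_mul' M N := by
    obtain ⟨F, hM⟩ := exists_supp M
    ext i j
    rw [mul_entry (F := F) fun i j h => ?_]
    · simp [mul_entry hM, map_sum]
    · simp [hM i j h]
  map_star' M := by ext; simp [map_star]

@[simp]
theorem map_entry (f : A →⋆ₙₐ[ℂ] B) (M : FinMat I A) (i j : I) :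
    (map f M).entry i j = f (M.entry i j) := rfl

theorem matNorm_map {f : A →⋆ₙₐ[ℂ] B} (hf : Function.Injective f) (M : FinMat I A) :
    matNorm (map f M) = matNorm M := by
  obtain ⟨F, hM⟩ := exists_supp M
  rw [matNorm_eq hM, matNorm_eq (F := F) fun i j h => by rw [map_entry, hM i j h, map_zero]]
  refine NonUnitalStarAlgHom.norm_map (CStarMatrix.mapₙₐ f) (fun M N h => ?_) (cut F M)
  ext i j
  exact hf (congrFun (congrFun h i) j)

theorem matSeminorm_spread_le (u v : J ↪ K) (M : FinMat J A) :
    matSeminorm K A (spread u v M) ≤ matSeminorm J A M := by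
  have h1 := (matSeminorm K A).star_mul_self_ge (spread u v M)
  rw [spread_star, spread_mul] at h1
  have h2 := norm_hom_le ((CStarSeminorm.Compl.of (matSeminorm K A)).comp (spreadHom v))
    (star M * M)
  rw [NonUnitalStarAlgHom.comp_apply, CStarSeminorm.Compl.norm_of] at h2
  have h3 := (matSeminorm J A).mul_le (star M) M
  rw [CStarSeminorm.star_eq] at h3
  exact abs_le_of_sq_le_sq' (by nlinarith [h1.trans (h2.trans h3)])
    (apply_nonneg (matSeminorm J A).toSeminorm M) |>.2

end Norm

end FinMat

open CStarSeminorm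

/-- The C*-algebra `K(ℓ²(I)) ⊗ A`: the completion of the *-algebra of finitely supported `I × I`
matrices over `A` in its C*-norm, that is, the C*-inductive limit of the matrix algebras
`M_F(A)`, `F ⊆ I` finite. -/
def Stab (I A : Type*) [NonUnitalCStarAlgebra A] : Type _ := (FinMat.matSeminorm I A).Compl

/-- `K ⊗ A`, where `K` is the algebra of compact operators on `ℓ²(ℕ)`. -/
abbrev KTensor (A : Type*) [NonUnitalCStarAlgebra A] : Type _ := Stab ℕ A

namespace Stab

variable {I J K A B C X : Type*} [NonUnitalCStarAlgebra A] [NonUnitalCStarAlgebra B]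
  [NonUnitalCStarAlgebra C] [NonUnitalCStarAlgebra X]

instance instCStarAlgebra : NonUnitalCStarAlgebra (Stab I A) :=
  Compl.instCStarAlgebra (FinMat.matSeminorm I A)

variable (I A) in
/-- Finitely supported matrices inside `K(ℓ²(I)) ⊗ A`. -/
def of : FinMat I A →⋆ₙₐ[ℂ] Stab I A := Compl.of (FinMat.matSeminorm I A)

theorem norm_of (M : FinMat I A) : ‖of I A M‖ = FinMat.matNorm M := Compl.norm_of M

@[elab_as_elim]
theorem ind {P : Stab I A → Prop} (x : Stab I A) (hc : IsClosed {x | P x})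
    (h : ∀ M, P (of I A M)) : P x := Compl.ind (p := FinMat.matSeminorm I A) x hc h

@[elab_as_elim]
theorem ind₂ {P : Stab I A → Stab I A → Prop} (x y : Stab I A)
    (hc : IsClosed {x : Stab I A × Stab I A | P x.1 x.2})
    (h : ∀ M N, P (of I A M) (of I A N)) : P x y :=
  Compl.ind₂ (p := FinMat.matSeminorm I A) x y hc h

/-- A *-homomorphism on finitely supported matrices extends to the completion. -/
def lift (f : FinMat I A →⋆ₙₐ[ℂ] X) : Stab I A →⋆ₙₐ[ℂ] X := Compl.lift f (FinMat.norm_hom_le f)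

@[simp]
theorem lift_of (f : FinMat I A →⋆ₙₐ[ℂ] X) (M : FinMat I A) : lift f (of I A M) = f M :=
  Compl.lift_of f (FinMat.norm_hom_le f) M

theorem hom_ext {f g : Stab I A →⋆ₙₐ[ℂ] X} (h : ∀ M, f (of I A M) = g (of I A M)) : f = g :=
  Compl.hom_ext h

variable (I) in
/-- `id_K ⊗ f : K ⊗ A → K ⊗ B`. -/
def map (f : A →⋆ₙₐ[ℂ] B) : Stab I A →⋆ₙₐ[ℂ] Stab I B := lift ((of I B).comp (FinMat.map f))

@[simp]
theorem map_of (f : A →⋆ₙₐ[ℂ] B) (M : FinMat I A) :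
    map I f (of I A M) = of I B (FinMat.map f M) := lift_of _ M

theorem map_map (g : B →⋆ₙₐ[ℂ] C) (f : A →⋆ₙₐ[ℂ] B) (x : Stab I A) :
    map I g (map I f x) = map I (g.comp f) x := by
  suffices (map I g).comp (map I f) = map I (g.comp f) from DFunLike.congr_fun this x
  refine hom_ext fun M => ?_
  simp only [NonUnitalStarAlgHom.comp_apply, map_of]
  rfl

theorem map_id (x : Stab I A) : map I (NonUnitalStarAlgHom.id ℂ A) x = x := by
  suffices map I (NonUnitalStarAlgHom.id ℂ A) = NonUnitalStarAlgHom.id ℂ (Stab I A) from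
    DFunLike.congr_fun this x
  refine hom_ext fun M => ?_
  simp only [map_of]
  rfl

theorem norm_map_eq {f : A →⋆ₙₐ[ℂ] B} (hf : Function.Injective f) (x : Stab I A) :
    ‖map I f x‖ = ‖x‖ := by
  refine ind x (isClosed_eq (hom_continuous (map I f)).norm continuous_norm) fun M => ?_
  rw [map_of, norm_of, norm_of, FinMat.matNorm_map hf]

theorem map_injective {f : A →⋆ₙₐ[ℂ] B} (hf : Function.Injective f) :
    Function.Injective (map I f) :=
  (AddMonoidHomClass.isometry_of_norm (map I f) (norm_map_eq hf)).injective

/-- The corner embedding `a ↦ e_{ii} ⊗ a`. -/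
def corner (i : I) : A →⋆ₙₐ[ℂ] Stab I A := (of I A).comp (FinMat.singleHom i)

/-- Moving entries along two injections, on the completion. -/
def spread (u v : J ↪ K) : Stab J A →L[ℂ] Stab K A :=
  Compl.extendL (p := FinMat.matSeminorm J A) ((of K A : FinMat K A →ₗ[ℂ] Stab K A) ∘ₗ
    FinMat.spread u v) 1 fun M => by
      rw [one_mul]
      exact (Compl.norm_of _).trans_le (FinMat.matSeminorm_spread_le u v M)

theorem spread_of (u v : J ↪ K) (M : FinMat J A) :
    spread u v (of J A M) = of K A (FinMat.spread u v M) := Compl.extendL_of _ _ _ M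

theorem spread_mul (u v w : J ↪ K) (x y : Stab J A) :
    spread u v x * spread v w y = spread u w (x * y) := by
  refine ind₂ x y (isClosed_eq
    (((spread u v).continuous.comp continuous_fst).mul ((spread v w).continuous.comp continuous_snd))
    ((spread u w).continuous.comp (continuous_fst.mul continuous_snd))) fun M N => ?_
  rw [spread_of, spread_of, ← map_mul, ← map_mul, spread_of, FinMat.spread_mul]

theorem spread_mul_of_disjoint (u v v' w : J ↪ K) (h : ∀ m n, v m ≠ v' n) (x y : Stab J A) :
    spread u v x * spread v' w y = 0 := by
  refine ind₂ x y (isClosed_eq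
    (((spread u v).continuous.comp continuous_fst).mul
      ((spread v' w).continuous.comp continuous_snd)) continuous_const) fun M N => ?_
  rw [spread_of, spread_of, ← map_mul, FinMat.spread_mul_of_disjoint u v v' w h, map_zero]

theorem spread_star (u v : J ↪ K) (x : Stab J A) : star (spread u v x) = spread v u (star x) := by
  refine ind x (isClosed_eq (spread u v).continuous.star
    ((spread v u).continuous.comp continuous_star)) fun M => ?_
  rw [spread_of, ← map_star, FinMat.spread_star, ← map_star (of J A), spread_of]

/-- The injection `j ↦ e (i, j)`. -/
def slice (e : I × J ≃ K) (i : I) : J ↪ K :=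
  ⟨fun j => e (i, j), fun j j' h => by simpa using e.injective h⟩

/-- Block matrices are matrices: the block at `(i, k)` is put at the places
`(e (i, m), e (k, n))`. -/
def unblock (e : I × J ≃ K) : FinMat I (Stab J A) →⋆ₙₐ[ℂ] Stab K A :=
  let T : FinMat I (Stab J A) → Stab K A := fun M =>
    ∑ᶠ i, ∑ᶠ k, spread (slice e i) (slice e k) (M.entry i k)
  have hT : ∀ {F : Finset I} {M : FinMat I (Stab J A)}, M.Supp F →
      T M = ∑ i ∈ F, ∑ k ∈ F, spread (slice e i) (slice e k) (M.entry i k) := fun {F M} hM => by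
    have h1 : ∀ i, ∑ᶠ k, spread (slice e i) (slice e k) (M.entry i k) =
        ∑ k ∈ F, spread (slice e i) (slice e k) (M.entry i k) := fun i => by
      refine finsum_eq_sum_of_support_subset _ fun k hk => ?_
      by_contra h
      exact hk (by simp only [hM i k (Or.inr h), map_zero])
    simp only [T, h1]
    refine finsum_eq_sum_of_support_subset _ fun i hi => ?_
    by_contra h
    exact hi (Finset.sum_eq_zero fun k _ => by simp only [hM i k (Or.inl h), map_zero])
  have hd : ∀ {k k' : I}, k ≠ k' → ∀ m n, slice e k m ≠ slice e k' n := fun h m n hmn => by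
    have := e.injective hmn
    exact h (congrArg Prod.fst this)
  { toFun := T
    map_zero' := by simp [T]
    map_add' := fun M N => by
      obtain ⟨F, hM, hN⟩ := FinMat.exists_supp₂ M N
      simp only [hT hM, hT hN, hT (FinMat.supp_add hM hN), FinMat.add_entry, map_add,
        Finset.sum_add_distrib]
    map_smul' := fun c M => by
      obtain ⟨F, hM⟩ := FinMat.exists_supp M
      simp only [hT hM, hT (FinMat.supp_smul c hM), FinMat.smul_entry, map_smul,
        Finset.smul_sum, MonoidHom.id_apply]
    map_star' := fun M => by
      obtain ⟨F, hM⟩ := FinMat.exists_supp M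
      simp only [hT hM, hT (FinMat.supp_star hM), FinMat.star_entry, star_sum, spread_star]
      exact Finset.sum_comm
    map_mul' := fun M N => by
      obtain ⟨F, hM, hN⟩ := FinMat.exists_supp₂ M N
      simp only [hT hM, hT hN, hT (FinMat.supp_mul hM hN), FinMat.mul_entry hM, map_sum,
        Finset.sum_mul_sum]
      refine Finset.sum_congr rfl fun i _ => ?_
      rw [Finset.sum_comm]
      refine Finset.sum_congr rfl fun k hk => ?_
      rw [Finset.sum_eq_single_of_mem k hk fun k' _ hne => Finset.sum_eq_zero fun l _ =>
        spread_mul_of_disjoint _ _ _ _ (hd hne) _ _]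
      exact Finset.sum_congr rfl fun l _ => (spread_mul _ _ _ _ _).symm }

/-- `K(ℓ²(I)) ⊗ (K(ℓ²(J)) ⊗ A) ≅ K(ℓ²(K)) ⊗ A` for a bijection `I × J ≃ K`. -/
def flatten (e : I × J ≃ K) : Stab I (Stab J A) →⋆ₙₐ[ℂ] Stab K A := lift (unblock e)

end Stab

/-- The bijection `(i, n) ↦ 2n + i`. -/
def twoNat : Fin 2 × ℕ ≃ ℕ := (Equiv.prodComm _ _).trans (Nat.divModEquiv 2).symm

/-- The isomorphism `M₂(K ⊗ A) ≅ K ⊗ A` given by `ℓ²(ℕ) ⊕ ℓ²(ℕ) ≅ ℓ²(ℕ)`. -/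
def absorb (A : Type*) [NonUnitalCStarAlgebra A] :
    CStarMatrix (Fin 2) (Fin 2) (KTensor A) →⋆ₙₐ[ℂ] KTensor A :=
  (Stab.unblock twoNat).comp (FinMat.ofMat (Fin 2))

/-- The isomorphism `K ⊗ K ⊗ A ≅ K ⊗ A` given by `ℓ²(ℕ) ⊗ ℓ²(ℕ) ≅ ℓ²(ℕ)`. -/
def flattenK (A : Type*) [NonUnitalCStarAlgebra A] : KTensor (KTensor A) →⋆ₙₐ[ℂ] KTensor A :=
  Stab.flatten Nat.pairEquiv

end Stab

/-! ### The map `μ : q(K ⊗ B) → K ⊗ qB` -/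

section Mu

variable (B : Type*) [NonUnitalCStarAlgebra B]

/-- The map `Q(K ⊗ B) → K ⊗ QB` given by the pair `(id_K ⊗ ι, id_K ⊗ ῑ)`. -/
def muQ : Q (KTensor B) →⋆ₙₐ[ℂ] KTensor (Q B) :=
  FreeProd.lift (Stab.map ℕ (iota B)) (Stab.map ℕ (iotaBar B))

theorem map_fold_muQ (x : Q (KTensor B)) : Stab.map ℕ (fold B) (muQ B x) = fold (KTensor B) x := by
  suffices (Stab.map ℕ (fold B)).comp (muQ B) = fold (KTensor B) from DFunLike.congr_fun this x
  have h1 : (fold B).comp (iota B) = NonUnitalStarAlgHom.id ℂ B := by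
    ext b; simp [fold, iota]
  have h2 : (fold B).comp (iotaBar B) = NonUnitalStarAlgHom.id ℂ B := by
    ext b; simp [fold, iotaBar]
  refine FreeProd.hom_ext (fun a => ?_) fun a => ?_
  · rw [NonUnitalStarAlgHom.comp_apply, show muQ B (FreeProd.inl a) = Stab.map ℕ (iota B) a from
      FreeProd.lift_inl .., Stab.map_map, h1, Stab.map_id]
    exact (FreeProd.lift_inl (NonUnitalStarAlgHom.id ℂ (KTensor B))
      (NonUnitalStarAlgHom.id ℂ (KTensor B)) a).symm
  · rw [NonUnitalStarAlgHom.comp_apply, show muQ B (FreeProd.inr a) = Stab.map ℕ (iotaBar B) a from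
      FreeProd.lift_inr .., Stab.map_map, h2, Stab.map_id]
    exact (FreeProd.lift_inr (NonUnitalStarAlgHom.id ℂ (KTensor B))
      (NonUnitalStarAlgHom.id ℂ (KTensor B)) a).symm

theorem mem_range_of_map_fold (x : KTensor (Q B)) (hx : Stab.map ℕ (fold B) x = 0) :
    x ∈ NonUnitalStarAlgHom.range (Stab.map ℕ (qIncl B)) := by
  have hcl : IsClosed (Set.range (Stab.map ℕ (qIncl B))) :=
    (AddMonoidHomClass.isometry_of_norm (Stab.map ℕ (qIncl B))
      (Stab.norm_map_eq qIncl_injective)).isClosedEmbedding.isClosed_range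
  have key : ∀ x : KTensor (Q B), x - Stab.map ℕ ((iota B).comp (fold B)) x ∈
      Set.range (Stab.map ℕ (qIncl B)) := fun x => by
    refine Stab.ind x (hcl.preimage (continuous_id.sub (hom_continuous _))) fun M => ?_
    have hz : ∀ y : Q B, fold B (y - iota B (fold B y)) = 0 := fun y => by
      rw [map_sub]; simp [fold, iota]
    let N : FinMat ℕ (q B) := ⟨fun i j => ⟨M.entry i j - iota B (fold B (M.entry i j)), hz _⟩, by
      obtain ⟨F, hM⟩ := M.finite'
      refine ⟨F, fun i j h => ?_⟩
      refine Subtype.ext ?_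
      change M.entry i j - iota B (fold B (M.entry i j)) = 0
      rw [hM i j h, map_zero, map_zero, sub_zero]⟩
    refine ⟨Stab.of ℕ (q B) N, ?_⟩
    rw [Stab.map_of, Stab.map_of, ← map_sub]
    congr 1
    ext i j
    rw [sub_eq_add_neg]
    exact sub_eq_add_neg (M.entry i j) _
  have := key x
  rw [← Stab.map_map, hx, map_zero, sub_zero] at this
  exact this

/-- The natural map `μ : q(K ⊗ B) → K ⊗ qB` given by the pair `(id_K ⊗ ι, id_K ⊗ ῑ)`. -/
def mu : q (KTensor B) →⋆ₙₐ[ℂ] KTensor (q B) :=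
  ((StarAlgEquiv.ofInjective' (Stab.map ℕ (qIncl B)) (Stab.map_injective qIncl_injective)).symm :
    NonUnitalStarAlgHom.range (Stab.map ℕ (qIncl B)) →⋆ₙₐ[ℂ] KTensor (q B)).comp
  (NonUnitalStarAlgHom.codRestrict ((muQ B).comp (qIncl (KTensor B)))
    (NonUnitalStarAlgHom.range (Stab.map ℕ (qIncl B))) fun z =>
      mem_range_of_map_fold B _ (by
        rw [NonUnitalStarAlgHom.comp_apply, map_fold_muQ, fold_qIncl]))

theorem map_qIncl_mu (z : q (KTensor B)) :
    Stab.map ℕ (qIncl B) (mu B z) = muQ B (qIncl (KTensor B) z) :=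
  congrArg Subtype.val (StarAlgEquiv.apply_symm_apply
    (StarAlgEquiv.ofInjective' (Stab.map ℕ (qIncl B)) (Stab.map_injective qIncl_injective)) _)

end Mu

/-! ### Homotopy -/

section Homotopy

/-- The topology of pointwise norm convergence on *-homomorphisms. -/
instance homTopology (X Y : Type*) [NonUnitalCStarAlgebra X] [NonUnitalCStarAlgebra Y] :
    TopologicalSpace (X →⋆ₙₐ[ℂ] Y) :=
  TopologicalSpace.induced (fun f x => f x) Pi.topologicalSpace

variable {X Y : Type*} [NonUnitalCStarAlgebra X] [NonUnitalCStarAlgebra Y]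

/-- Two *-homomorphisms are homotopic if they are connected by a family of *-homomorphisms
`f_t`, `t ∈ [0,1]`, such that `t ↦ f_t x` is norm continuous for each `x`. -/
def Homotopic (f g : X →⋆ₙₐ[ℂ] Y) : Prop := Joined f g

variable (X Y) in
/-- `[X, Y]`, the set of homotopy classes of *-homomorphisms. -/
abbrev HomotopyClasses : Type _ := ZerothHomotopy (X →⋆ₙₐ[ℂ] Y)

/-- The homotopy class of a *-homomorphism. -/
def homotopyClass (f : X →⋆ₙₐ[ℂ] Y) : HomotopyClasses X Y := ZerothHomotopy.mk f

/-- `KK(A, B) = [qA, K ⊗ B]`. -/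
abbrev KK (A B : Type*) [NonUnitalCStarAlgebra A] [NonUnitalCStarAlgebra B] : Type _ :=
  HomotopyClasses (q A) (KTensor B)

/-- `f ⊕ g : X → M₂(Y)`, the diagonal sum. -/
def dsum (f g : X →⋆ₙₐ[ℂ] Y) : X →⋆ₙₐ[ℂ] CStarMatrix (Fin 2) (Fin 2) Y where
  toFun x := CStarMatrix.ofMatrix !![f x, 0; 0, g x]
  map_smul' c x := by ext i j; fin_cases i <;> fin_cases j <;> simp
  map_zero' := by ext i j; fin_cases i <;> fin_cases j <;> simp
  map_add' x y := by ext i j; fin_cases i <;> fin_cases j <;> simp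
  map_mul' x y := by
    ext i j; fin_cases i <;> fin_cases j <;> simp [CStarMatrix.mul_apply]
  map_star' x := by
    ext i j; fin_cases i <;> fin_cases j <;> simp [CStarMatrix.star_apply, map_star]

/-- The sum of two *-homomorphisms `X → K ⊗ Y`, by means of `M₂(K ⊗ Y) ≅ K ⊗ Y`. -/
def addHom (f g : X →⋆ₙₐ[ℂ] KTensor Y) : X →⋆ₙₐ[ℂ] KTensor Y := (absorb Y).comp (dsum f g)

/-- Entrywise application of a *-homomorphism to `2 × 2` matrices. -/
abbrev mat2 (f : X →⋆ₙₐ[ℂ] Y) :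
    CStarMatrix (Fin 2) (Fin 2) X →⋆ₙₐ[ℂ] CStarMatrix (Fin 2) (Fin 2) Y := CStarMatrix.mapₙₐ f

end Homotopy

/-! ### The universal map `φ_A : qA → M₂(q²A)` -/

section Multiplier

variable {A E : Type*} [NonUnitalCStarAlgebra A] [NonUnitalCStarAlgebra E]

/-- A *-homomorphism `f : A → E` whose values multiply a closed *-subalgebra `R` of `E` into
itself induces a *-homomorphism from `A` to the multiplier algebra of `R`. -/
def toMultiplier (R : NonUnitalStarSubalgebra ℂ E) [IsClosed (R : Set E)] (f : A →⋆ₙₐ[ℂ] E)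
    (hl : ∀ a, ∀ r ∈ R, f a * r ∈ R) : A →⋆ₙₐ[ℂ] DoubleCentralizer ℂ R :=
  have hr : ∀ a, ∀ r ∈ R, r * f a ∈ R := fun a r h => by
    have := star_mem (hl (star a) (star r) (star_mem h))
    rwa [map_star, star_mul, star_star, star_star] at this
  { toFun := fun a =>
      { fst := LinearMap.mkContinuous
          { toFun := fun r : R => ⟨f a * r, hl a r r.2⟩
            map_add' := fun r s => Subtype.ext (mul_add (f a) (r : E) s)
            map_smul' := fun c r => Subtype.ext (mul_smul_comm c (f a) (r : E)) }
          ‖f a‖ fun r => norm_mul_le (f a) (r : E)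
        snd := LinearMap.mkContinuous
          { toFun := fun r : R => ⟨r * f a, hr a r r.2⟩
            map_add' := fun r s => Subtype.ext (add_mul (r : E) s (f a))
            map_smul' := fun c r => Subtype.ext (smul_mul_assoc c (r : E) (f a)) }
          ‖f a‖ fun r => (norm_mul_le (r : E) (f a)).trans_eq (mul_comm _ _)
        central := fun r s => Subtype.ext (mul_assoc (r : E) (f a) s) }
    map_smul' := fun c a => by
      refine DoubleCentralizer.ext ℂ R _ _ (Prod.ext ?_ ?_)
      · ext r; exact (congrArg (· * (r : E)) (map_smul f c a)).trans (smul_mul_assoc _ _ _)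
      · ext r; exact (congrArg ((r : E) * ·) (map_smul f c a)).trans (mul_smul_comm _ _ _)
    map_zero' := by
      refine DoubleCentralizer.ext ℂ R _ _ (Prod.ext ?_ ?_)
      · ext r; exact (congrArg (· * (r : E)) (map_zero f)).trans (zero_mul _)
      · ext r; exact (congrArg ((r : E) * ·) (map_zero f)).trans (mul_zero _)
    map_add' := fun a b => by
      refine DoubleCentralizer.ext ℂ R _ _ (Prod.ext ?_ ?_)
      · ext r; exact (congrArg (· * (r : E)) (map_add f a b)).trans (add_mul _ _ _)
      · ext r; exact (congrArg ((r : E) * ·) (map_add f a b)).trans (mul_add _ _ _)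
    map_mul' := fun a b => by
      refine DoubleCentralizer.ext ℂ R _ _ (Prod.ext ?_ ?_)
      · ext r; exact (congrArg (· * (r : E)) (map_mul f a b)).trans (mul_assoc _ _ _)
      · ext r; exact (congrArg ((r : E) * ·) (map_mul f a b)).trans (mul_assoc _ _ _).symm
    map_star' := fun a => by
      refine DoubleCentralizer.ext ℂ R _ _ (Prod.ext ?_ ?_)
      · ext r
        refine (congrArg (· * (r : E)) (map_star f a)).trans ?_
        change _ = star (star (r : E) * f a)
        rw [star_mul, star_star]
      · ext r
        refine (congrArg ((r : E) * ·) (map_star f a)).trans ?_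
        change _ = star (f a * star (r : E))
        rw [star_mul, star_star] }

end Multiplier

/-- The automorphism `Ad F` of a unital C*-algebra, where `F = exp((πi/2) S)` for a self-adjoint
element `S`. -/
def adExp {M : Type*} [CStarAlgebra M] (S : selfAdjoint M) : M →⋆ₙₐ[ℂ] M :=
  ((Unitary.conjStarAlgAut ℂ M (selfAdjoint.expUnitary ((Real.pi / 2) • S)) : M ≃⋆ₐ[ℂ] M) :
    M →⋆ₙₐ[ℂ] M)

section Phi

variable (A : Type*) [NonUnitalCStarAlgebra A]

/-- The embedding `η : QA → Q²A = Q(QA)`. -/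
abbrev eta : Q A →⋆ₙₐ[ℂ] Q (Q A) := iota (Q A)

/-- The embedding `η̄ : QA → Q²A = Q(QA)`. -/
abbrev etaBar : Q A →⋆ₙₐ[ℂ] Q (Q A) := iotaBar (Q A)

/-- The embedding of `q²A = q(qA) ⊆ Q(qA)` in `Q²A`. -/
def q2Incl : q (q A) →⋆ₙₐ[ℂ] Q (Q A) := (QMap (qIncl A)).comp (qIncl (q A))

/-- The matrix with the single entry `a` at `(i, j)`. -/
def matUnit {Y : Type*} [Zero Y] (i j : Fin 2) (a : Y) : CStarMatrix (Fin 2) (Fin 2) Y :=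
  CStarMatrix.ofMatrix (Matrix.single i j a)

/-- The generators of `R`: the entries are from `R₁ = η(qA)`, `R₁R₂`, `R₂R₁` and
`R₂ = η̄(qA)`. -/
def RGen (m : CStarMatrix (Fin 2) (Fin 2) (Q (Q A))) : Prop :=
  (∃ z : q A, matUnit 0 0 (eta A (qIncl A z)) = m) ∨
  (∃ z w : q A, matUnit 0 1 (eta A (qIncl A z) * etaBar A (qIncl A w)) = m) ∨
  (∃ z w : q A, matUnit 1 0 (etaBar A (qIncl A z) * eta A (qIncl A w)) = m) ∨
  ∃ z : q A, matUnit 1 1 (etaBar A (qIncl A z)) = m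

/-- The C*-subalgebra `R` of `M₂(Q²A)` generated by the matrices with entries in
`R₁, R₁R₂; R₂R₁, R₂`. -/
def R : NonUnitalStarSubalgebra ℂ (CStarMatrix (Fin 2) (Fin 2) (Q (Q A))) :=
  (NonUnitalStarAlgebra.adjoin ℂ {m | RGen A m}).topologicalClosure

instance R_isClosed : IsClosed (R A : Set (CStarMatrix (Fin 2) (Fin 2) (Q (Q A)))) :=
  NonUnitalStarSubalgebra.isClosed_topologicalClosure _

/-- The map `x ↦ η(f x) ⊕ η̄(g x)` to `M₂(Q²A)`, for `f, g : A → QA`. -/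
def diagMap (f g : A →⋆ₙₐ[ℂ] Q A) : A →⋆ₙₐ[ℂ] CStarMatrix (Fin 2) (Fin 2) (Q (Q A)) :=
  dsum ((eta A).comp f) ((etaBar A).comp g)

theorem diagMap_mul_mem (f g : A →⋆ₙₐ[ℂ] Q A) (a : A) (r : CStarMatrix (Fin 2) (Fin 2) (Q (Q A)))
    (hr : r ∈ R A) : diagMap A f g a * r ∈ R A := by
  have hgen : ∀ m, RGen A m → diagMap A f g a * m ∈ R A := fun m hm => by
    have hs : ∀ m, RGen A m → m ∈ R A := fun m hm =>
      NonUnitalStarSubalgebra.le_topologicalClosure _ (NonUnitalStarAlgebra.subset_adjoin ℂ _ hm)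
    have hq : ∀ (y : Q A) (z : q A), ∃ w : q A, qIncl A w = y * qIncl A z := fun y z =>
      ⟨⟨y * qIncl A z, (map_mul (fold A) y _).trans (by rw [fold_qIncl, mul_zero])⟩, rfl⟩
    have h0 : ∀ (j : Fin 2) (y : Q (Q A)), diagMap A f g a * matUnit 0 j y =
        matUnit 0 j (eta A (f a) * y) := fun j y => by
      ext k l
      fin_cases k <;> fin_cases j <;> fin_cases l <;>
        simp [diagMap, dsum, matUnit, CStarMatrix.mul_apply, Matrix.single]
    have h1 : ∀ (j : Fin 2) (y : Q (Q A)), diagMap A f g a * matUnit 1 j y =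
        matUnit 1 j (etaBar A (g a) * y) := fun j y => by
      ext k l
      fin_cases k <;> fin_cases j <;> fin_cases l <;>
        simp [diagMap, dsum, matUnit, CStarMatrix.mul_apply, Matrix.single]
    rcases hm with ⟨z, rfl⟩ | ⟨z, v, rfl⟩ | ⟨z, v, rfl⟩ | ⟨z, rfl⟩
    · obtain ⟨w, hw⟩ := hq (f a) z
      rw [h0, ← map_mul, ← hw]
      exact hs _ (Or.inl ⟨w, rfl⟩)
    · obtain ⟨w, hw⟩ := hq (f a) z
      rw [h0, ← mul_assoc, ← map_mul, ← hw]
      exact hs _ (Or.inr (Or.inl ⟨w, v, rfl⟩))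
    · obtain ⟨w, hw⟩ := hq (g a) z
      rw [h1, ← mul_assoc, ← map_mul, ← hw]
      exact hs _ (Or.inr (Or.inr (Or.inl ⟨w, v, rfl⟩)))
    · obtain ⟨w, hw⟩ := hq (g a) z
      rw [h1, ← map_mul, ← hw]
      exact hs _ (Or.inr (Or.inr (Or.inr ⟨w, rfl⟩)))
  have hstar : ∀ m, RGen A m → RGen A (star m) := fun m hm => by
    have hst : ∀ (i j : Fin 2) (y : Q (Q A)), star (matUnit i j y) = matUnit j i (star y) :=
      fun i j y => by
        ext k l
        fin_cases k <;> fin_cases i <;> fin_cases j <;> fin_cases l <;>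
          simp [matUnit, CStarMatrix.star_apply, Matrix.single]
    rcases hm with ⟨z, rfl⟩ | ⟨z, v, rfl⟩ | ⟨z, v, rfl⟩ | ⟨z, rfl⟩
    · rw [hst, ← map_star, ← map_star]; exact Or.inl ⟨_, rfl⟩
    · rw [hst, star_mul, ← map_star, ← map_star, ← map_star, ← map_star]; exact Or.inr (Or.inr (Or.inl ⟨_, _, rfl⟩))
    · rw [hst, star_mul, ← map_star, ← map_star, ← map_star, ← map_star]; exact Or.inr (Or.inl ⟨_, _, rfl⟩)
    · rw [hst, ← map_star, ← map_star]; exact Or.inr (Or.inr (Or.inr ⟨_, rfl⟩))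
  have hcl : IsClosed {r | diagMap A f g a * r ∈ R A} :=
    (R_isClosed A).preimage (continuous_const.mul continuous_id)
  refine closure_minimal ?_ hcl hr
  intro r hr
  have hr' : r ∈ NonUnitalAlgebra.adjoin ℂ
      ({m | RGen A m} ∪ star {m | RGen A m} : Set (CStarMatrix (Fin 2) (Fin 2) (Q (Q A)))) := hr
  have hadj : ∀ x ∈ NonUnitalAlgebra.adjoin ℂ
      ({m | RGen A m} ∪ star {m | RGen A m} : Set (CStarMatrix (Fin 2) (Fin 2) (Q (Q A)))),
      x ∈ R A := fun x hx => NonUnitalStarSubalgebra.le_topologicalClosure _ hx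
  induction hr' using NonUnitalAlgebra.adjoin_induction with
  | mem x hx =>
    rcases hx with hx | hx
    · exact hgen x hx
    · exact hgen x (by simpa using hstar _ hx)
  | add x y hx hy ihx ihy =>
    change diagMap A f g a * (x + y) ∈ R A
    rw [mul_add]; exact add_mem (ihx hx) (ihy hy)
  | zero => change diagMap A f g a * 0 ∈ R A; rw [mul_zero]; exact zero_mem _
  | mul x y hx hy ihx ihy =>
    change diagMap A f g a * (x * y) ∈ R A
    rw [← mul_assoc]; exact mul_mem (ihx hx) (hadj y hy)
  | smul c x hx ihx =>
    change diagMap A f g a * (c • x) ∈ R A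
    rw [mul_smul_comm]; exact SMulMemClass.smul_mem c (ihx hx)

/-- `x ↦ η(f x) ⊕ η̄(g x)` as a map to the multiplier algebra of `R`. -/
def diagMult (f g : A →⋆ₙₐ[ℂ] Q A) : A →⋆ₙₐ[ℂ] DoubleCentralizer ℂ (R A) :=
  toMultiplier (R A) (diagMap A f g) (diagMap_mul_mem A f g)

/-- `h₁ = ηε ⊕ η̄ε̄`. -/
def h1 : A →⋆ₙₐ[ℂ] DoubleCentralizer ℂ (R A) := diagMult A (iota A) (iotaBar A)

/-- `h₂ = ηε̄ ⊕ η̄ε`. -/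
def h2 : A →⋆ₙₐ[ℂ] DoubleCentralizer ℂ (R A) := diagMult A (iotaBar A) (iota A)

/-- `d = ηε ⊕ η̄ε`, whose image is `D`. -/
def dMap : A →⋆ₙₐ[ℂ] DoubleCentralizer ℂ (R A) := diagMult A (iota A) (iota A)

variable {A}

/-- Membership in the ideal `J = R ∩ M₂(q²A)` of `R`. -/
def MemJ (r : R A) : Prop :=
  ∃ m : CStarMatrix (Fin 2) (Fin 2) (q (q A)), mat2 (q2Incl A) m = r

/-- The quotient map `R → R/J ≅ M₂(qA)`: it identifies the two copies of `QA` in `Q²A`. -/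
def foldR (r : R A) : CStarMatrix (Fin 2) (Fin 2) (Q A) := mat2 (fold (Q A)) r

/-- The matrix `(0 1; 1 0)` lifts to the multiplier `S` of `R`: modulo `J`, multiplication by `S`
from the left exchanges rows and multiplication by `S` from the right exchanges columns. -/
def LiftsFlip (S : DoubleCentralizer ℂ (R A)) : Prop :=
  ∀ (r : R A) (i j : Fin 2), foldR (S.fst r) i j = foldR r (Equiv.swap 0 1 i) j ∧
    foldR (S.snd r) i j = foldR r i (Equiv.swap 0 1 j)

/-- `S` commutes with `D` modulo `J`. -/
def CommutesModJ (S : DoubleCentralizer ℂ (R A)) : Prop :=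
  ∀ x : A, ∃ r : R A, MemJ r ∧ S * dMap A x - dMap A x * S = DoubleCentralizer.coeHom r

/-- The automorphism `σ = Ad F` of the multiplier algebra, with `F = exp((πi/2) S)`. -/
def sigma (S : selfAdjoint (DoubleCentralizer ℂ (R A))) :
    DoubleCentralizer ℂ (R A) →⋆ₙₐ[ℂ] DoubleCentralizer ℂ (R A) :=
  adExp S

/-- `φ : qA → M₂(q²A)` is a version of the universal map: `φ = q(h₁, σ h₂)`, where `σ = Ad F`,
`F = exp((πi/2) S)`, for some self-adjoint multiplier `S` of `R` that lifts the matrix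
`(0 1; 1 0)` and commutes with `D` modulo `J`. -/
def IsUniversalMap (φ : q A →⋆ₙₐ[ℂ] CStarMatrix (Fin 2) (Fin 2) (q (q A))) : Prop :=
  ∃ S : selfAdjoint (DoubleCentralizer ℂ (R A)),
    LiftsFlip (S : DoubleCentralizer ℂ (R A)) ∧ CommutesModJ (S : DoubleCentralizer ℂ (R A)) ∧
    ∀ z : q A, ∃ r : R A, (r : CStarMatrix (Fin 2) (Fin 2) (Q (Q A))) = mat2 (q2Incl A) (φ z) ∧
      DoubleCentralizer.coeHom r = FreeProd.lift (h1 A) ((sigma S).comp (h2 A)) (qIncl A z)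

end Phi

/-! ### The product and the comparison maps -/

section Product

variable {A B C : Type*} [NonUnitalCStarAlgebra A] [NonUnitalCStarAlgebra B]
  [NonUnitalCStarAlgebra C]

/-- `μ q(α) φ : qA → M₂(q²A) → M₂(q(K ⊗ B)) → M₂(K ⊗ qB) ≅ K ⊗ qB`. -/
def muq (φ : q A →⋆ₙₐ[ℂ] CStarMatrix (Fin 2) (Fin 2) (q (q A))) (α : q A →⋆ₙₐ[ℂ] KTensor B) :
    q A →⋆ₙₐ[ℂ] KTensor (q B) :=
  (absorb (q B)).comp ((mat2 (mu B)).comp ((mat2 (qMap α)).comp φ))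

/-- `β ♯ α = (id_K ⊗ β) μ q(α) φ : qA → K ⊗ K ⊗ C ≅ K ⊗ C`. -/
def sharp (φ : q A →⋆ₙₐ[ℂ] CStarMatrix (Fin 2) (Fin 2) (q (q A))) (β : q B →⋆ₙₐ[ℂ] KTensor C)
    (α : q A →⋆ₙₐ[ℂ] KTensor B) : q A →⋆ₙₐ[ℂ] KTensor C :=
  (flattenK C).comp ((Stab.map ℕ β).comp (muq φ α))

/-- `ᾱ = (id_K ⊗ π_B) α|_{qA}`, where `qA` is the upper left corner of `K ⊗ qA`. -/
def barMap (α : KTensor (q A) →⋆ₙₐ[ℂ] KTensor (q B)) : q A →⋆ₙₐ[ℂ] KTensor B :=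
  (Stab.map ℕ (piMap B)).comp (α.comp (Stab.corner 0))

/-- `β' = μ (id_K ⊗ q(β) φ) : K ⊗ qA → K ⊗ K ⊗ qB ≅ K ⊗ qB`. -/
def primeMap (φ : q A →⋆ₙₐ[ℂ] CStarMatrix (Fin 2) (Fin 2) (q (q A)))
    (β : q A →⋆ₙₐ[ℂ] KTensor B) : KTensor (q A) →⋆ₙₐ[ℂ] KTensor (q B) :=
  (flattenK (q B)).comp (Stab.map ℕ (muq φ β))

end Product

end

/-! Every homotopy around `φ` comes from one segment of multipliers. Let `S` be as in the definition
of a universal map and put `σ_t = Ad exp((πi/2) t S)`. The multipliers `h₁(x) - d(x)` and `h₂(x) -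
d(x)` lie in `R`, and so does `σ_t d(x) - d(x)`, because `S` commutes with `d(x)` modulo `R`. Hence
`h₁` and `σ_t h₂` agree modulo `R`, and the pair `(h₁, σ_t h₂)` maps `qA` to `R`; call the
restriction `λ_t` (`LiftsMulFlip.lam`). Modulo `J` it becomes the pair of maps `ε ⊕ ε̄` and `ε̄ ⊕ ε`
to `M₂(QA)` with the second one rotated through `exp((πi/2) t s)`, where `s` is the flip
(`LiftsMulFlip.foldRHom_lam`). At `t = 1` the rotation exchanges the two summands, so both
components coincide modulo `J` and `λ₁` takes values in `J`, inside `M₂(q²A)`: this is `φ`. At `t =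
0` one finds `λ₀ = η ⊕ η̄ ∘ swap`, where swap exchanges the two copies of `A`.

Applying `id ⋆ 0` to `λ_t` gives a path from `id ⊕ 0` to `π φ`, lifted to `R` by construction. On
`q(qA)` the pairs `(λ_t, ῑ fold λ_t)` lead from `id ⊕ 0` to `φ π`, because `fold λ₁ = 0`. The
admissible `S` form a convex set on which `φ` depends continuously, which gives uniqueness.

The algebra `R` is defined inside `M₂(Q²A)`, whereas these maps have to land in `M₂(Q(qA))`. So
`Q(qA) → Q(QA)` has to be injective (`QMap_qIncl_injective`); the reason is that representations of
an ideal extend to the whole algebra.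

The existence of `S` is the analytic part, an argument of the type of Kasparov's technical theorem.
For separable `A` there is a sequence `g_m` in `qA` that almost commutes with `A` and satisfies `∑
g_m² = 1` strictly. With `G_m = η(g_m) ⊕ η̄(g_m)` the series `∑ G_m s G_m` lifts the flip. Its
commutators with `d(x)` consist of a norm convergent part and of terms `G_m [s, d(x)] G_m` of `J`.
Replacing the summands by `(1 - w_m) G_m s G_m (1 - w_m)`, with quasicentral `w_m` in `J` that are
almost units for these terms, makes the commutators summable without changing anything modulo `J`
(`exists_cut_down`).

The bijection and the product use nothing about `φ` except that `π φ` is homotopic to `id ⊕ 0`. The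
other ingredients are that all embeddings of `K` in itself given by injections of `ℕ` are homotopic
to the identity (`Stab.homotopic_spreadHom`), and that `π_{qB}` and `q(π_B)` become homotopic as
maps `q²B → qB` after adding `0` (`piMap_q_homotopic_qMap_piMap`). These show that the product with
`ᾱ` is ordinary composition with `α`, so associativity is inherited from composition. -/

noncomputable section

/-! ### Families of *-homomorphisms -/

section Families

variable {W X Y Z : Type*} [NonUnitalCStarAlgebra W] [NonUnitalCStarAlgebra X]
  [NonUnitalCStarAlgebra Y] [NonUnitalCStarAlgebra Z]

/-- A family of *-homomorphisms is point-norm continuous. -/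
def PtCont {T : Type*} [TopologicalSpace T] (F : T → X →⋆ₙₐ[ℂ] Y) : Prop :=
  ∀ x, Continuous fun t => F t x

theorem ptCont_iff {T : Type*} [TopologicalSpace T] (F : T → X →⋆ₙₐ[ℂ] Y) :
    PtCont F ↔ Continuous F := by
  rw [continuous_induced_rng, continuous_pi_iff]; rfl

theorem Homotopic.of_family {F : unitInterval → X →⋆ₙₐ[ℂ] Y} (hF : PtCont F)
    {f g : X →⋆ₙₐ[ℂ] Y} (h0 : F 0 = f) (h1 : F 1 = g) : Homotopic f g :=
  ⟨⟨⟨F, (ptCont_iff F).1 hF⟩, h0, h1⟩⟩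

theorem Homotopic.exists_family {f g : X →⋆ₙₐ[ℂ] Y} (h : Homotopic f g) :
    ∃ F : unitInterval → X →⋆ₙₐ[ℂ] Y, PtCont F ∧ F 0 = f ∧ F 1 = g := by
  obtain ⟨p⟩ := h
  exact ⟨p, (ptCont_iff _).2 p.continuous, p.source, p.target⟩

theorem Homotopic.refl (f : X →⋆ₙₐ[ℂ] Y) : Homotopic f f := Joined.refl f

theorem Homotopic.symm {f g : X →⋆ₙₐ[ℂ] Y} (h : Homotopic f g) : Homotopic g f := Joined.symm h

theorem Homotopic.trans {f g k : X →⋆ₙₐ[ℂ] Y} (h : Homotopic f g) (h' : Homotopic g k) :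
    Homotopic f k := Joined.trans h h'

theorem homotopyClass_eq_iff {f g : X →⋆ₙₐ[ℂ] Y} :
    homotopyClass f = homotopyClass g ↔ Homotopic f g := Quotient.eq

theorem PtCont.comp_left {T : Type*} [TopologicalSpace T] {F : T → X →⋆ₙₐ[ℂ] Y} (hF : PtCont F)
    (g : Y →⋆ₙₐ[ℂ] Z) : PtCont fun t => g.comp (F t) :=
  fun x => (hom_continuous g).comp (hF x)

theorem PtCont.comp_right {T : Type*} [TopologicalSpace T] {F : T → X →⋆ₙₐ[ℂ] Y} (hF : PtCont F)
    (g : W →⋆ₙₐ[ℂ] X) : PtCont fun t => (F t).comp g := fun x => hF (g x)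

theorem Homotopic.comp_left {f g : X →⋆ₙₐ[ℂ] Y} (h : Homotopic f g) (k : Y →⋆ₙₐ[ℂ] Z) :
    Homotopic (k.comp f) (k.comp g) := by
  obtain ⟨F, hF, rfl, rfl⟩ := h.exists_family
  exact .of_family (hF.comp_left k) rfl rfl

theorem Homotopic.comp_right {f g : X →⋆ₙₐ[ℂ] Y} (h : Homotopic f g) (k : W →⋆ₙₐ[ℂ] X) :
    Homotopic (f.comp k) (g.comp k) := by
  obtain ⟨F, hF, rfl, rfl⟩ := h.exists_family
  exact .of_family (hF.comp_right k) rfl rfl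

/-- The points at which a family of *-homomorphisms is continuous form a closed set. -/
theorem isClosed_setOf_continuous {T : Type*} [TopologicalSpace T] (F : T → X →⋆ₙₐ[ℂ] Y) :
    IsClosed {x | Continuous fun t => F t x} := by
  refine isClosed_of_closure_subset fun x hx => ?_
  obtain ⟨u, hu, hux⟩ := mem_closure_iff_seq_limit.1 hx
  -- All `F t` are contractions, so convergence of `u n` to `x` is uniform in `t`.
  have : TendstoUniformly (fun n t => F t (u n)) (fun t => F t x) Filter.atTop := by
    rw [Metric.tendstoUniformly_iff]
    intro ε hε
    filter_upwards [Metric.tendsto_nhds.1 hux ε hε] with n hn t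
    rw [dist_comm, dist_eq_norm, ← map_sub]
    exact (NonUnitalStarAlgHom.norm_apply_le (F t) _).trans_lt (by rwa [← dist_eq_norm])
  exact this.continuous (Filter.Frequently.of_forall hu)

/-- Words in the letters are dense, and continuity of the orbit passes to sums, products, multiples
and limits; so only the letters have to be checked. -/
theorem PtCont.freeProd_lift {A B T : Type*} [NonUnitalCStarAlgebra A] [NonUnitalCStarAlgebra B]
    [TopologicalSpace T] {F : T → A →⋆ₙₐ[ℂ] X} {G : T → B →⋆ₙₐ[ℂ] X} (hF : PtCont F)
    (hG : PtCont G) : PtCont fun t => FreeProd.lift (F t) (G t) := by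
  intro x
  refine CStarSeminorm.Compl.ind (p := freeProdSeminorm A B) x
    (isClosed_setOf_continuous fun t => FreeProd.lift (F t) (G t)) fun x => ?_
  change Continuous fun t => FreeProd.lift (F t) (G t) (FreeProd.ofWord A B x)
  refine WordAlg.ind_letter x ?_ ?_ ?_ ?_ ?_
  · simp only [map_zero]; exact continuous_const
  · intro x y hx hy; simp only [map_add]; exact hx.add hy
  · intro c x hx; simp only [map_smul]; exact hx.const_smul c
  · intro x y hx hy; simp only [map_mul]; exact hx.mul hy
  · rintro (a | b)
    · change Continuous fun t => FreeProd.lift (F t) (G t) (FreeProd.inl a)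
      simp only [FreeProd.lift_inl]; exact hF a
    · change Continuous fun t => FreeProd.lift (F t) (G t) (FreeProd.inr b)
      simp only [FreeProd.lift_inr]; exact hG b

theorem PtCont.of_isometry {T : Type*} [TopologicalSpace T] {F : T → X →⋆ₙₐ[ℂ] Y}
    {i : Y →⋆ₙₐ[ℂ] Z} (hi : Function.Injective i) (h : PtCont fun t => i.comp (F t)) :
    PtCont F := fun x =>
  (AddMonoidHomClass.isometry_of_norm i
    (NonUnitalStarAlgHom.norm_map i hi)).isEmbedding.continuous_iff.2 (h x)

/-- The factorization of a *-homomorphism through an injective one. -/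
def factorThrough (i : Y →⋆ₙₐ[ℂ] Z) (hi : Function.Injective i) (f : X →⋆ₙₐ[ℂ] Z)
    (hf : ∀ x, f x ∈ Set.range i) : X →⋆ₙₐ[ℂ] Y :=
  ((StarAlgEquiv.ofInjective' i hi).symm : NonUnitalStarAlgHom.range i →⋆ₙₐ[ℂ] Y).comp
    (NonUnitalStarAlgHom.codRestrict f (NonUnitalStarAlgHom.range i) hf)

theorem apply_factorThrough (i : Y →⋆ₙₐ[ℂ] Z) (hi : Function.Injective i) (f : X →⋆ₙₐ[ℂ] Z)
    (hf : ∀ x, f x ∈ Set.range i) (x : X) : i (factorThrough i hi f hf x) = f x :=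
  congrArg Subtype.val (StarAlgEquiv.apply_symm_apply (StarAlgEquiv.ofInjective' i hi) _)

theorem PtCont.factorThrough {T : Type*} [TopologicalSpace T] (i : Y →⋆ₙₐ[ℂ] Z)
    (hi : Function.Injective i) {F : T → X →⋆ₙₐ[ℂ] Z} (hF : PtCont F)
    (hf : ∀ t x, F t x ∈ Set.range i) : PtCont fun t => factorThrough i hi (F t) (hf t) :=
  PtCont.of_isometry hi fun x => by
    simpa only [NonUnitalStarAlgHom.comp_apply, apply_factorThrough] using hF x

theorem isClosed_range_of_injective {i : Y →⋆ₙₐ[ℂ] Z} (hi : Function.Injective i) :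
    IsClosed (Set.range i) :=
  (AddMonoidHomClass.isometry_of_norm i
    (NonUnitalStarAlgHom.norm_map i hi)).isClosedEmbedding.isClosed_range

end Families

/-! ### Two by two matrices -/

section Mat2

variable {X Y Z : Type*} [NonUnitalCStarAlgebra X] [NonUnitalCStarAlgebra Y]
  [NonUnitalCStarAlgebra Z]

theorem mat2_apply (f : X →⋆ₙₐ[ℂ] Y) (M : CStarMatrix (Fin 2) (Fin 2) X) (i j : Fin 2) :
    mat2 f M i j = f (M i j) := rfl

theorem dsum_apply_zero_zero (f g : X →⋆ₙₐ[ℂ] Y) (x : X) : dsum f g x 0 0 = f x := rfl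
theorem dsum_apply_zero_one (f g : X →⋆ₙₐ[ℂ] Y) (x : X) : dsum f g x 0 1 = 0 := rfl
theorem dsum_apply_one_zero (f g : X →⋆ₙₐ[ℂ] Y) (x : X) : dsum f g x 1 0 = 0 := rfl
theorem dsum_apply_one_one (f g : X →⋆ₙₐ[ℂ] Y) (x : X) : dsum f g x 1 1 = g x := rfl

theorem mat_ext {X : Type*} {M N : CStarMatrix (Fin 2) (Fin 2) X} (h00 : M 0 0 = N 0 0)
    (h01 : M 0 1 = N 0 1) (h10 : M 1 0 = N 1 0) (h11 : M 1 1 = N 1 1) : M = N := by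
  ext i j; fin_cases i <;> fin_cases j <;> assumption

theorem mat2_injective {f : X →⋆ₙₐ[ℂ] Y} (hf : Function.Injective f) :
    Function.Injective (mat2 f) := fun M N h => by
  ext i j; exact hf (congrFun (congrFun h i) j)

theorem mat2_comp (g : Y →⋆ₙₐ[ℂ] Z) (f : X →⋆ₙₐ[ℂ] Y) :
    mat2 (g.comp f) = (mat2 g).comp (mat2 f) := rfl

theorem mat2_comp_dsum (k : Y →⋆ₙₐ[ℂ] Z) (f g : X →⋆ₙₐ[ℂ] Y) :
    (mat2 k).comp (dsum f g) = dsum (k.comp f) (k.comp g) := by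
  ext x i j; fin_cases i <;> fin_cases j <;> simp [dsum, CStarMatrix.mapₙₐ]

theorem dsum_comp {W : Type*} [NonUnitalCStarAlgebra W] (f g : X →⋆ₙₐ[ℂ] Y) (k : W →⋆ₙₐ[ℂ] X) :
    (dsum f g).comp k = dsum (f.comp k) (g.comp k) := rfl

/-- The topology of `CStarMatrix` is definitionally the product topology, so no norm estimate is
needed. -/
theorem continuous_mat_iff {T : Type*} [TopologicalSpace T]
    {f : T → CStarMatrix (Fin 2) (Fin 2) X} :
    Continuous f ↔ ∀ i j, Continuous fun t => f t i j := by
  refine (continuous_pi_iff (A := fun _ : Fin 2 => Fin 2 → X)).trans (forall_congr' fun i => ?_)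
  exact continuous_pi_iff

theorem continuous_entry (i j : Fin 2) :
    Continuous fun M : CStarMatrix (Fin 2) (Fin 2) X => M i j :=
  continuous_mat_iff.1 continuous_id i j

theorem PtCont.mat2 {T : Type*} [TopologicalSpace T] {F : T → X →⋆ₙₐ[ℂ] Y} (hF : PtCont F) :
    PtCont fun t => mat2 (F t) := fun M => continuous_mat_iff.2 fun i j => hF (M i j)

theorem Homotopic.mat2 {f g : X →⋆ₙₐ[ℂ] Y} (h : Homotopic f g) :
    Homotopic (mat2 f) (mat2 g) := by
  obtain ⟨F, hF, rfl, rfl⟩ := h.exists_family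
  exact .of_family hF.mat2 rfl rfl

theorem mem_range_mat2_iff {f : X →⋆ₙₐ[ℂ] Y} {M : CStarMatrix (Fin 2) (Fin 2) Y} :
    M ∈ Set.range (mat2 f) ↔ ∀ i j, M i j ∈ Set.range f := by
  constructor
  · rintro ⟨N, rfl⟩ i j
    exact ⟨N i j, rfl⟩
  · intro h
    choose N hN using h
    exact ⟨CStarMatrix.ofMatrix N, by ext i j; exact hN i j⟩

end Mat2

/-! ### Conjugation by a path of unitaries in the algebra generated by a symmetry -/

/-- A self-adjoint unitary multiplier, given by its left and right multiplication operators. -/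
structure Symmetry (Y : Type*) [NonUnitalCStarAlgebra Y] where
  L : Y →L[ℂ] Y
  R : Y →L[ℂ] Y
  L_mul : ∀ x y, L (x * y) = L x * y
  R_mul : ∀ x y, R x * y = x * L y
  L_L : ∀ x, L (L x) = x
  L_R : ∀ x, L (R x) = R (L x)
  star_L : ∀ x, star (L x) = R (star x)

namespace Symmetry

variable {X Y : Type*} [NonUnitalCStarAlgebra X] [NonUnitalCStarAlgebra Y] (s : Symmetry Y)

theorem star_R (x : Y) : star (s.R x) = s.L (star x) := by
  rw [← star_star x, ← s.star_L, star_star, star_star]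

theorem mul_R (x y : Y) : s.R (x * y) = x * s.R y := by
  apply star_injective
  rw [s.star_R, star_mul, s.L_mul, star_mul, s.star_R]

/-- Left multiplication by `cos(πt/2) + i sin(πt/2) s`. -/
def left (t : ℝ) (x : Y) : Y :=
  (Real.cos (Real.pi / 2 * t) : ℂ) • x + (Real.sin (Real.pi / 2 * t) * Complex.I : ℂ) • s.L x

/-- Right multiplication by `cos(πt/2) - i sin(πt/2) s`. -/
def right (t : ℝ) (x : Y) : Y :=
  (Real.cos (Real.pi / 2 * t) : ℂ) • x - (Real.sin (Real.pi / 2 * t) * Complex.I : ℂ) • s.R x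

theorem left_mul (t : ℝ) (x y : Y) : s.left t (x * y) = s.left t x * y := by
  simp only [left, s.L_mul, add_mul, smul_mul_assoc]

theorem mul_right (t : ℝ) (x y : Y) : s.right t (x * y) = x * s.right t y := by
  simp only [right, s.mul_R, mul_sub, mul_smul_comm]

theorem left_right (t : ℝ) (x : Y) : s.left t (s.right t x) = s.right t (s.left t x) := by
  simp only [left, right, map_sub, map_add, map_smul, s.L_R]
  module

theorem star_right (t : ℝ) (x : Y) : star (s.right t x) = s.left t (star x) := by
  simp only [left, right, star_sub, star_smul, s.star_R, star_mul', Complex.star_def,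
    Complex.conj_ofReal, Complex.conj_I, mul_neg, neg_smul, sub_neg_eq_add]

theorem star_left (t : ℝ) (x : Y) : star (s.left t x) = s.right t (star x) := by
  apply star_injective
  rw [star_right, star_star, star_star]

/-- With `u = c + i d s` the left side is `x u* u y`, and `u* u = c² + d² = 1` since `s² = 1`. -/
theorem right_mul_left (t : ℝ) (x y : Y) : s.right t x * s.left t y = x * y := by
  have h : (Real.cos (Real.pi / 2 * t) : ℂ) ^ 2 + (Real.sin (Real.pi / 2 * t) : ℂ) ^ 2 = 1 := by
    exact_mod_cast Real.cos_sq_add_sin_sq (Real.pi / 2 * t)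
  simp only [left, right, sub_mul, mul_add, smul_mul_assoc, mul_smul_comm, s.R_mul, s.L_L]
  generalize (Real.cos (Real.pi / 2 * t) : ℂ) = c at *
  generalize (Real.sin (Real.pi / 2 * t) : ℂ) = d at *
  have h2 : d * Complex.I * (d * Complex.I) = - d ^ 2 := by
    linear_combination d ^ 2 * Complex.I_sq
  calc _ = (c ^ 2 - d * Complex.I * (d * Complex.I)) • (x * y) := by module
    _ = _ := by rw [h2, sub_neg_eq_add, h, one_smul]

/-- Conjugation by `cos(πt/2) + i sin(πt/2) s`. -/
def conj (t : ℝ) : Y →⋆ₙₐ[ℂ] Y where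
  toFun x := s.left t (s.right t x)
  map_zero' := by simp [left, right]
  map_add' x y := by simp only [left, right, map_add, map_sub, map_smul, smul_add]; module
  map_smul' c x := by
    simp only [left, right, map_sub, map_smul, MonoidHom.id_apply]
    module
  map_mul' x y := by
    rw [← left_mul, right_mul_left, mul_right]
  map_star' x := by rw [s.star_left, star_right, left_right]

theorem conj_apply (t : ℝ) (x : Y) : s.conj t x = s.left t (s.right t x) := rfl

theorem conj_zero (x : Y) : s.conj 0 x = x := by simp [conj_apply, left, right]

/-- At `t = 1` the unitary is `i s`, and the scalars `i` and `-i` cancel. -/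
theorem conj_one (x : Y) : s.conj 1 x = s.L (s.R x) := by
  simp [conj_apply, left, right, smul_smul]

theorem ptCont_conj : PtCont s.conj := fun x => by
  change Continuous fun t => s.left t (s.right t x)
  unfold left right
  have h : Continuous s.L := s.L.continuous
  fun_prop

end Symmetry

/-- The symmetry `(0 1; 1 0)` of `M₂(Y)`. -/
def flip2 (Y : Type*) [NonUnitalCStarAlgebra Y] : Symmetry (CStarMatrix (Fin 2) (Fin 2) Y) where
  L := ⟨{ toFun := fun M => CStarMatrix.ofMatrix fun i j => M (Equiv.swap 0 1 i) j
          map_add' := fun _ _ => rfl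
          map_smul' := fun _ _ => rfl },
    continuous_mat_iff.2 fun i j => continuous_entry (Equiv.swap 0 1 i) j⟩
  R := ⟨{ toFun := fun M => CStarMatrix.ofMatrix fun i j => M i (Equiv.swap 0 1 j)
          map_add' := fun _ _ => rfl
          map_smul' := fun _ _ => rfl },
    continuous_mat_iff.2 fun i j => continuous_entry i (Equiv.swap 0 1 j)⟩
  L_mul x y := rfl
  R_mul x y := by
    ext i j
    change ∑ k, x i (Equiv.swap 0 1 k) * y k j = ∑ k, x i k * y (Equiv.swap 0 1 k) j
    simp [add_comm]
  L_L x := by ext i j; change x (Equiv.swap 0 1 (Equiv.swap 0 1 i)) j = _; simp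
  L_R x := rfl
  star_L x := rfl

section Flip2

variable {X Y Z : Type*} [NonUnitalCStarAlgebra X] [NonUnitalCStarAlgebra Y]
  [NonUnitalCStarAlgebra Z]

theorem flip2_L_apply (M : CStarMatrix (Fin 2) (Fin 2) Y) (i j : Fin 2) :
    (flip2 Y).L M i j = M (Equiv.swap 0 1 i) j := rfl

theorem flip2_R_apply (M : CStarMatrix (Fin 2) (Fin 2) Y) (i j : Fin 2) :
    (flip2 Y).R M i j = M i (Equiv.swap 0 1 j) := rfl

theorem mat2_flip2_left (f : Y →⋆ₙₐ[ℂ] Z) (t : ℝ) (M : CStarMatrix (Fin 2) (Fin 2) Y) :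
    mat2 f ((flip2 Y).left t M) = (flip2 Z).left t (mat2 f M) := by
  simp only [Symmetry.left, map_add, map_smul]; rfl

theorem mat2_flip2_right (f : Y →⋆ₙₐ[ℂ] Z) (t : ℝ) (M : CStarMatrix (Fin 2) (Fin 2) Y) :
    mat2 f ((flip2 Y).right t M) = (flip2 Z).right t (mat2 f M) := by
  simp only [Symmetry.right, map_sub, map_smul]; rfl

theorem mat2_flip2_conj (f : Y →⋆ₙₐ[ℂ] Z) (t : ℝ) (M : CStarMatrix (Fin 2) (Fin 2) Y) :
    mat2 f ((flip2 Y).conj t M) = (flip2 Z).conj t (mat2 f M) := by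
  rw [Symmetry.conj_apply, mat2_flip2_left, mat2_flip2_right]; rfl

theorem flip2_conj_one_dsum (f g : X →⋆ₙₐ[ℂ] Y) :
    ((flip2 Y).conj 1).comp (dsum f g) = dsum g f := by
  refine NonUnitalStarAlgHom.ext fun x => ?_
  rw [NonUnitalStarAlgHom.comp_apply, Symmetry.conj_one]
  apply mat_ext <;> simp [flip2_L_apply, flip2_R_apply, dsum]

theorem flip2_conj_zero_comp (f : X →⋆ₙₐ[ℂ] CStarMatrix (Fin 2) (Fin 2) Y) :
    ((flip2 Y).conj 0).comp f = f := NonUnitalStarAlgHom.ext fun _ => Symmetry.conj_zero _ _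

/-- The matrix `diag(y, y)` commutes with the flip, hence with the unitaries `c + i d s` in the
algebra generated by it. -/
theorem flip2_conj_dsum_self (f : X →⋆ₙₐ[ℂ] Y) (t : ℝ) :
    ((flip2 Y).conj t).comp (dsum f f) = dsum f f := by
  refine NonUnitalStarAlgHom.ext fun x => ?_
  have hR : (flip2 Y).R (dsum f f x) = (flip2 Y).L (dsum f f x) := by
    apply mat_ext <;> simp [flip2_L_apply, flip2_R_apply, dsum]
  have hc : (Real.cos (Real.pi / 2 * t) : ℂ) ^ 2 + (Real.sin (Real.pi / 2 * t) : ℂ) ^ 2 = 1 := by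
    exact_mod_cast Real.cos_sq_add_sin_sq (Real.pi / 2 * t)
  rw [NonUnitalStarAlgHom.comp_apply, Symmetry.conj_apply, Symmetry.left, Symmetry.right, hR]
  simp only [map_sub, map_smul, Symmetry.L_L]
  generalize (Real.cos (Real.pi / 2 * t) : ℂ) = c at *
  generalize (Real.sin (Real.pi / 2 * t) : ℂ) = d at *
  have h2 : d * Complex.I * (d * Complex.I) = - d ^ 2 := by
    linear_combination d ^ 2 * Complex.I_sq
  calc _ = (c ^ 2 - d * Complex.I * (d * Complex.I)) • dsum f f x := by module
    _ = _ := by rw [h2, sub_neg_eq_add, hc, one_smul]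

end Flip2

/-! ### Maps out of `QA` and `qA` -/

section QMaps

variable {A B C X Y Z : Type*} [NonUnitalCStarAlgebra A] [NonUnitalCStarAlgebra B]
  [NonUnitalCStarAlgebra C] [NonUnitalCStarAlgebra X] [NonUnitalCStarAlgebra Y]
  [NonUnitalCStarAlgebra Z]

theorem comp_freeProd_lift (k : X →⋆ₙₐ[ℂ] Y) (f : A →⋆ₙₐ[ℂ] X) (g : B →⋆ₙₐ[ℂ] X) :
    k.comp (FreeProd.lift f g) = FreeProd.lift (k.comp f) (k.comp g) :=
  FreeProd.hom_ext (fun a => by simp) fun b => by simp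

theorem freeProd_lift_dsum (f g : A →⋆ₙₐ[ℂ] X) (f' g' : B →⋆ₙₐ[ℂ] X) :
    FreeProd.lift (dsum f g) (dsum f' g') = dsum (FreeProd.lift f f') (FreeProd.lift g g') := by
  refine FreeProd.hom_ext (fun a => ?_) fun b => ?_ <;> apply mat_ext <;> simp [dsum]

theorem freeProd_lift_zero_right (f : A →⋆ₙₐ[ℂ] X) :
    FreeProd.lift f (0 : A →⋆ₙₐ[ℂ] X) = f.comp (evalQ A) :=
  FreeProd.hom_ext (fun a => by simp [evalQ]) fun b => by simp [evalQ]

theorem freeProd_lift_self (f : A →⋆ₙₐ[ℂ] X) : FreeProd.lift f f = f.comp (fold A) :=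
  FreeProd.hom_ext (fun a => by simp [fold]) fun b => by simp [fold]

theorem freeProd_lift_iota_iotaBar :
    FreeProd.lift (iota A) (iotaBar A) = NonUnitalStarAlgHom.id ℂ (Q A) :=
  FreeProd.hom_ext (fun a => by simp [iota]) fun b => by simp [iotaBar]

@[simp] theorem fold_iota (a : A) : fold A (iota A a) = a := by simp [fold, iota]
@[simp] theorem fold_iotaBar (a : A) : fold A (iotaBar A a) = a := by simp [fold, iotaBar]
@[simp] theorem evalQ_iota (a : A) : evalQ A (iota A a) = a := by simp [evalQ, iota]
@[simp] theorem evalQ_iotaBar (a : A) : evalQ A (iotaBar A a) = 0 := by simp [evalQ, iotaBar]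
@[simp] theorem lift_iota (f g : A →⋆ₙₐ[ℂ] X) (a : A) : FreeProd.lift f g (iota A a) = f a :=
  FreeProd.lift_inl f g a
@[simp] theorem lift_iotaBar (f g : A →⋆ₙₐ[ℂ] X) (a : A) :
    FreeProd.lift f g (iotaBar A a) = g a := FreeProd.lift_inr f g a
@[simp] theorem QMap_iota (f : A →⋆ₙₐ[ℂ] B) (a : A) : QMap f (iota A a) = iota B (f a) :=
  FreeProd.lift_inl _ _ a
@[simp] theorem QMap_iotaBar (f : A →⋆ₙₐ[ℂ] B) (a : A) :
    QMap f (iotaBar A a) = iotaBar B (f a) := FreeProd.lift_inr _ _ a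

theorem Q_hom_ext {f g : Q A →⋆ₙₐ[ℂ] X} (h : ∀ a, f (iota A a) = g (iota A a))
    (h' : ∀ a, f (iotaBar A a) = g (iotaBar A a)) : f = g := FreeProd.hom_ext h h'

theorem mem_range_qIncl_iff {y : Q A} : y ∈ Set.range (qIncl A) ↔ fold A y = 0 :=
  ⟨by rintro ⟨z, rfl⟩; exact fold_qIncl z, fun h => ⟨⟨y, h⟩, rfl⟩⟩

theorem qIncl_qMap (f : A →⋆ₙₐ[ℂ] B) (z : q A) : qIncl B (qMap f z) = QMap f (qIncl A z) := rfl

theorem qIncl_comp_qMap (f : A →⋆ₙₐ[ℂ] B) :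
    (qIncl B).comp (qMap f) = (QMap f).comp (qIncl A) := NonUnitalStarAlgHom.ext (qIncl_qMap f)

theorem hom_comp_zero (f : Y →⋆ₙₐ[ℂ] Z) : f.comp (0 : X →⋆ₙₐ[ℂ] Y) = 0 :=
  NonUnitalStarAlgHom.ext fun _ => map_zero f

theorem hom_zero_comp (f : X →⋆ₙₐ[ℂ] Y) : (0 : Y →⋆ₙₐ[ℂ] Z).comp f = 0 := rfl

theorem hom_id_comp (f : X →⋆ₙₐ[ℂ] Y) : (NonUnitalStarAlgHom.id ℂ Y).comp f = f := rfl

theorem QMap_comp (g : B →⋆ₙₐ[ℂ] C) (f : A →⋆ₙₐ[ℂ] B) :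
    QMap (g.comp f) = (QMap g).comp (QMap f) := Q_hom_ext (fun a => by simp) fun a => by simp

theorem qMap_comp (g : B →⋆ₙₐ[ℂ] C) (f : A →⋆ₙₐ[ℂ] B) :
    qMap (g.comp f) = (qMap g).comp (qMap f) := by
  refine NonUnitalStarAlgHom.ext fun z => qIncl_injective ?_
  rw [NonUnitalStarAlgHom.comp_apply, qIncl_qMap, qIncl_qMap, qIncl_qMap, QMap_comp]; rfl

theorem piMap_qMap (f : A →⋆ₙₐ[ℂ] B) : (piMap B).comp (qMap f) = f.comp (piMap A) := by
  have h : (evalQ B).comp (QMap f) = f.comp (evalQ A) :=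
    Q_hom_ext (fun a => by simp) fun a => by simp
  exact NonUnitalStarAlgHom.ext fun z => DFunLike.congr_fun h (qIncl A z)

theorem PtCont.QMap {T : Type*} [TopologicalSpace T] {F : T → A →⋆ₙₐ[ℂ] B} (hF : PtCont F) :
    PtCont fun t => QMap (F t) := (hF.comp_left _).freeProd_lift (hF.comp_left _)

theorem Homotopic.qMap {f g : A →⋆ₙₐ[ℂ] B} (h : Homotopic f g) : Homotopic (qMap f) (qMap g) := by
  obtain ⟨F, hF, rfl, rfl⟩ := h.exists_family
  exact .of_family (F := fun t => _root_.qMap (F t))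
    (PtCont.of_isometry qIncl_injective fun z => hF.QMap (qIncl A z)) rfl rfl

/-- After `fold` both components of the pair coincide, so the pair factors through `fold A`, which
vanishes on `qA`. -/
theorem mat2_fold_lift_qIncl {a b : A →⋆ₙₐ[ℂ] CStarMatrix (Fin 2) (Fin 2) (Q B)}
    (h : ∀ x, mat2 (fold B) (a x) = mat2 (fold B) (b x)) (z : q A) :
    mat2 (fold B) (FreeProd.lift a b (qIncl A z)) = 0 := by
  have : (mat2 (fold B)).comp (FreeProd.lift a b) = ((mat2 (fold B)).comp a).comp (fold A) := by
    rw [comp_freeProd_lift, ← freeProd_lift_self]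
    congr 1
    exact NonUnitalStarAlgHom.ext fun x => (h x).symm
  have h2 := DFunLike.congr_fun this (qIncl A z)
  simpa only [NonUnitalStarAlgHom.comp_apply, fold_qIncl, map_zero] using h2

theorem mem_range_mat2_qIncl_iff {M : CStarMatrix (Fin 2) (Fin 2) (Q A)} :
    M ∈ Set.range (mat2 (qIncl A)) ↔ mat2 (fold A) M = 0 := by
  simp only [mem_range_mat2_iff, mem_range_qIncl_iff, ← CStarMatrix.ext_iff]
  rfl

/-- The map `qA → M₂(qB)` given by a pair of maps `A → M₂(QB)` that agree modulo `M₂(qB)`. -/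
def qPair (a b : A →⋆ₙₐ[ℂ] CStarMatrix (Fin 2) (Fin 2) (Q B))
    (h : ∀ x, mat2 (fold B) (a x) = mat2 (fold B) (b x)) :
    q A →⋆ₙₐ[ℂ] CStarMatrix (Fin 2) (Fin 2) (q B) :=
  factorThrough (mat2 (qIncl B)) (mat2_injective qIncl_injective)
    ((FreeProd.lift a b).comp (qIncl A)) fun z =>
      mem_range_mat2_qIncl_iff.2 (mat2_fold_lift_qIncl h z)

theorem mat2_qIncl_qPair (a b : A →⋆ₙₐ[ℂ] CStarMatrix (Fin 2) (Fin 2) (Q B))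
    (h : ∀ x, mat2 (fold B) (a x) = mat2 (fold B) (b x)) (z : q A) :
    mat2 (qIncl B) (qPair a b h z) = FreeProd.lift a b (qIncl A z) :=
  apply_factorThrough _ _ _ _ z

/-- Continuous families of pairs induce homotopic maps. -/
theorem homotopic_of_pairs {a b : unitInterval → A →⋆ₙₐ[ℂ] CStarMatrix (Fin 2) (Fin 2) (Q B)}
    (ha : PtCont a) (hb : PtCont b)
    (h : ∀ t x, mat2 (fold B) (a t x) = mat2 (fold B) (b t x))
    {f g : q A →⋆ₙₐ[ℂ] CStarMatrix (Fin 2) (Fin 2) (q B)}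
    (hf : ∀ z, mat2 (qIncl B) (f z) = FreeProd.lift (a 0) (b 0) (qIncl A z))
    (hg : ∀ z, mat2 (qIncl B) (g z) = FreeProd.lift (a 1) (b 1) (qIncl A z)) :
    Homotopic f g := by
  refine .of_family (F := fun t => qPair (a t) (b t) (h t)) ?_ ?_ ?_
  · exact PtCont.factorThrough _ _ ((ha.freeProd_lift hb).comp_right (qIncl A)) _
  · refine NonUnitalStarAlgHom.ext fun z => mat2_injective qIncl_injective ?_
    rw [mat2_qIncl_qPair, hf]
  · refine NonUnitalStarAlgHom.ext fun z => mat2_injective qIncl_injective ?_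
    rw [mat2_qIncl_qPair, hg]

theorem ptCont_flip2_conj (f : A →⋆ₙₐ[ℂ] CStarMatrix (Fin 2) (Fin 2) X) :
    PtCont fun t : unitInterval => ((flip2 X).conj t).comp f :=
  fun x => ((flip2 X).ptCont_conj (f x)).comp continuous_subtype_val

theorem ptCont_const {T : Type*} [TopologicalSpace T] (f : X →⋆ₙₐ[ℂ] Y) :
    PtCont fun _ : T => f := fun _ => continuous_const

theorem fold_comp_iota : (fold A).comp (iota A) = NonUnitalStarAlgHom.id ℂ A :=
  NonUnitalStarAlgHom.ext fun a => by simp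

theorem fold_comp_iotaBar : (fold A).comp (iotaBar A) = NonUnitalStarAlgHom.id ℂ A :=
  NonUnitalStarAlgHom.ext fun a => by simp

theorem fold_comp_qIncl : (fold A).comp (qIncl A) = 0 :=
  NonUnitalStarAlgHom.ext fun z => fold_qIncl z

theorem mat2_fold_conj (t : ℝ) (f : X →⋆ₙₐ[ℂ] CStarMatrix (Fin 2) (Fin 2) (Q A)) :
    (mat2 (fold A)).comp (((flip2 (Q A)).conj t).comp f) =
      ((flip2 A).conj t).comp ((mat2 (fold A)).comp f) :=
  NonUnitalStarAlgHom.ext fun x => mat2_flip2_conj (fold A) t (f x)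

/-- The maps `π_{qA}` and `q(π_A)` from `q²A` to `qA` are stably homotopic. -/
theorem piMap_q_homotopic_qMap_piMap (A : Type*) [NonUnitalCStarAlgebra A] :
    Homotopic (dsum (qMap (piMap A)) 0) (dsum (piMap (q A)) 0) := by
  -- On `qA` the pair `(ι ⊕ ῑ, c)` is `ι π ⊕ 0` for `c = 0 ⊕ ῑ` and `id ⊕ ῑ π` for `c = ῑ ⊕ 0`,
  -- while `(ῑ ⊕ ῑ, c)` is `ῑ π ⊕ 0` and `0 ⊕ ῑ π` respectively. The pair formed by these two maps
  -- of `qA` is therefore `q(π) ⊕ 0` at one end and `π_{qA} ⊕ 0` at the other, and rotating `c`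
  -- joins the ends.
  let c : unitInterval → A →⋆ₙₐ[ℂ] CStarMatrix (Fin 2) (Fin 2) (Q A) :=
    fun t => ((flip2 (Q A)).conj t).comp (dsum 0 (iotaBar A))
  have hc : PtCont c := ptCont_flip2_conj _
  have hc0 : c 0 = dsum 0 (iotaBar A) := flip2_conj_zero_comp _
  have hc1 : c 1 = dsum (iotaBar A) 0 := flip2_conj_one_dsum _ _
  refine homotopic_of_pairs
    (a := fun t => (FreeProd.lift (dsum (iota A) (iotaBar A)) (c t)).comp (qIncl A))
    (b := fun t => (FreeProd.lift (dsum (iotaBar A) (iotaBar A)) (c t)).comp (qIncl A))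
    (((ptCont_const _).freeProd_lift hc).comp_right _)
    (((ptCont_const _).freeProd_lift hc).comp_right _) (fun t z => ?_) ?_ ?_
  · change ((mat2 (fold A)).comp (FreeProd.lift _ _)) (qIncl A z) =
      ((mat2 (fold A)).comp (FreeProd.lift _ _)) (qIncl A z)
    rw [comp_freeProd_lift, comp_freeProd_lift, mat2_comp_dsum, mat2_comp_dsum, fold_comp_iota,
      fold_comp_iotaBar]
  · have h : FreeProd.lift
        ((FreeProd.lift (dsum (iota A) (iotaBar A)) (c 0)).comp (qIncl A))
        ((FreeProd.lift (dsum (iotaBar A) (iotaBar A)) (c 0)).comp (qIncl A)) =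
        dsum (QMap (piMap A)) 0 := by
      rw [hc0, freeProd_lift_dsum, freeProd_lift_dsum, freeProd_lift_zero_right,
        freeProd_lift_zero_right, freeProd_lift_self, dsum_comp, dsum_comp, freeProd_lift_dsum,
        NonUnitalStarAlgHom.comp_assoc _ (fold A), fold_comp_qIncl, hom_comp_zero,
        freeProd_lift_self, hom_zero_comp, NonUnitalStarAlgHom.comp_assoc,
        NonUnitalStarAlgHom.comp_assoc, ← piMap, ← QMap]
    have h' : (mat2 (qIncl A)).comp (dsum (qMap (piMap A)) 0) =
        (dsum (QMap (piMap A)) 0).comp (qIncl (q A)) := by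
      rw [mat2_comp_dsum, qIncl_comp_qMap, hom_comp_zero, dsum_comp, hom_zero_comp]
    intro z
    rw [h]
    exact DFunLike.congr_fun h' z
  · have h : FreeProd.lift
        ((FreeProd.lift (dsum (iota A) (iotaBar A)) (c 1)).comp (qIncl A))
        ((FreeProd.lift (dsum (iotaBar A) (iotaBar A)) (c 1)).comp (qIncl A)) =
        dsum ((qIncl A).comp (evalQ (q A))) (((iotaBar A).comp (piMap A)).comp (fold (q A))) := by
      rw [hc1, freeProd_lift_dsum, freeProd_lift_dsum, freeProd_lift_zero_right,
        freeProd_lift_iota_iotaBar, freeProd_lift_self, dsum_comp, dsum_comp, freeProd_lift_dsum,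
        NonUnitalStarAlgHom.comp_assoc _ (fold A), fold_comp_qIncl, hom_comp_zero, hom_id_comp,
        freeProd_lift_self, freeProd_lift_zero_right, NonUnitalStarAlgHom.comp_assoc (iotaBar A),
        ← piMap]
    have h' : (mat2 (qIncl A)).comp (dsum (piMap (q A)) 0) =
        (dsum ((qIncl A).comp (evalQ (q A)))
          (((iotaBar A).comp (piMap A)).comp (fold (q A)))).comp (qIncl (q A)) := by
      rw [mat2_comp_dsum, dsum_comp, hom_comp_zero, NonUnitalStarAlgHom.comp_assoc _ (fold (q A)),
        fold_comp_qIncl, hom_comp_zero, NonUnitalStarAlgHom.comp_assoc, ← piMap]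
    intro z
    rw [h]
    exact DFunLike.congr_fun h' z

end QMaps

/-! ### Infinite concatenation of paths -/

section Concatenation

variable {X : Type*} [TopologicalSpace X] {f : ℕ → X} (γ : ∀ k, Path (f k) (f (k + 1)))

/-- The first `n + 1` paths of a sequence, run through on the intervals `[k, k + 1]`. -/
def concatPaths : ℕ → ℝ → X
  | 0 => (γ 0).extend
  | n + 1 => fun s => if s ≤ n + 1 then concatPaths n s else (γ (n + 1)).extend (s - (n + 1))

theorem concatPaths_of_gt (n : ℕ) {s : ℝ} (hs : n < s) :
    concatPaths γ n s = (γ n).extend (s - n) := by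
  cases n with
  | zero => simp [concatPaths]
  | succ n =>
    push_cast at hs ⊢
    simp only [concatPaths, if_neg hs.not_ge]

theorem continuous_concatPaths (n : ℕ) : Continuous (concatPaths γ n) := by
  induction n with
  | zero => exact (γ 0).continuous_extend
  | succ n ih =>
    refine Continuous.if_le ih
      ((γ (n + 1)).continuous_extend.comp (continuous_id.sub continuous_const))
      continuous_id continuous_const fun s hs => ?_
    have hs : s = n + 1 := hs
    subst hs
    rw [concatPaths_of_gt γ n (by linarith)]
    simp

theorem concatPaths_succ (n : ℕ) {s : ℝ} (hs : s ≤ n + 1) :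
    concatPaths γ (n + 1) s = concatPaths γ n s := by simp only [concatPaths, if_pos hs]

theorem concatPaths_eq (n : ℕ) {s : ℝ} (hs : s ≤ n + 1) {m : ℕ} (hm : n ≤ m) :
    concatPaths γ m s = concatPaths γ n s := by
  induction m, hm using Nat.le_induction with
  | base => rfl
  | succ m hm ih =>
    have : (n : ℝ) ≤ m := by exact_mod_cast hm
    rw [concatPaths_succ γ m (by linarith), ih]

theorem concatPaths_mem {U : Set X} {N : ℕ} (h : ∀ k ≥ N, ∀ t, γ k t ∈ U) {s : ℝ} (hs : N < s)
    {n : ℕ} (hn : N ≤ n) : concatPaths γ n s ∈ U := by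
  have he : ∀ k ≥ N, ∀ t, (γ k).extend t ∈ U := fun k hk t => by
    have : (γ k).extend t ∈ Set.range (γ k) := by
      rw [← Path.extend_range]; exact ⟨t, rfl⟩
    obtain ⟨r, hr⟩ := this
    rw [← hr]; exact h k hk r
  induction n, hn using Nat.le_induction with
  | base => rw [concatPaths_of_gt γ N hs]; exact he N le_rfl _
  | succ n hn ih =>
    by_cases h1 : s ≤ n + 1
    · rwa [concatPaths_succ γ n h1]
    · simp only [concatPaths, if_neg h1]; exact he _ (by omega) _

/-- A sequence of consecutive paths that converges to a point can be concatenated to a path. -/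
theorem joined_of_paths {g : X} (h : ∀ U ∈ 𝓝 g, ∃ N, ∀ k ≥ N, ∀ t, γ k t ∈ U) :
    Joined (f 0) g := by
  -- The function `s` identifies `[0, 1)` with `[0, ∞)`, where the `k`-th path occupies `[k, k +
  -- 1]`.
  let s : ℝ → ℝ := fun t => (1 - t)⁻¹ - 1
  have hcs : ∀ t : ℝ, t < 1 → ContinuousAt s t := fun t ht =>
    ((continuousAt_const.sub continuousAt_id).inv₀ (by simp; linarith)).sub continuousAt_const
  -- The ceiling is only one choice: every index `n` with `s t ≤ n + 1` gives the same value, which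
  -- is what `hloc` records.
  let F : ℝ → X := fun t => if t < 1 then concatPaths γ ⌈s t⌉₊ (s t) else g
  have hloc : ∀ (n : ℕ) (t : ℝ), t < 1 → s t ≤ n + 1 → F t = concatPaths γ n (s t) := by
    intro n t ht hst
    simp only [F, if_pos ht]
    have h1 : s t ≤ (⌈s t⌉₊ : ℝ) + 1 := (Nat.le_ceil _).trans (by linarith)
    rw [← concatPaths_eq γ _ h1 (le_max_left ⌈s t⌉₊ n), concatPaths_eq γ n hst (le_max_right _ _)]
  have hF : Continuous F := by
    rw [continuous_iff_continuousAt]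
    intro t
    rcases lt_trichotomy t 1 with ht | rfl | ht
    · obtain ⟨n, hn⟩ := exists_nat_gt (s t)
      have h1 : ∀ᶠ r in 𝓝 t, r < 1 := eventually_lt_nhds ht
      have h2 : ∀ᶠ r in 𝓝 t, s r < n := (hcs t ht).eventually (eventually_lt_nhds hn)
      have h3 : F =ᶠ[𝓝 t] fun r => concatPaths γ n (s r) := by
        filter_upwards [h1, h2] with r hr hr'
        exact hloc n r hr (by linarith)
      exact ContinuousAt.congr
        (((continuous_concatPaths γ n).continuousAt).comp (hcs t ht)) h3.symm
    · have hF1 : F 1 = g := by simp [F]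
      rw [ContinuousAt, hF1]
      intro U hU
      obtain ⟨N, hN⟩ := h U hU
      have h1 : ∀ᶠ r : ℝ in 𝓝 1, 1 - r < ((N : ℝ) + 1)⁻¹ := by
        have : ContinuousAt (fun r : ℝ => 1 - r) 1 := by fun_prop
        refine this.eventually (eventually_lt_nhds ?_)
        simp; positivity
      rw [Filter.mem_map]
      filter_upwards [h1] with r hr
      by_cases hr1 : r < 1
      · have h2 : (N : ℝ) < s r := by
          have := (lt_inv_comm₀ (by linarith) (by positivity)).1 hr
          simp only [s]; linarith
        change F r ∈ U
        rw [hloc (max N ⌈s r⌉₊) r hr1]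
        · exact concatPaths_mem γ hN h2 (le_max_left _ _)
        · have := Nat.le_ceil (s r)
          have h3 : (⌈s r⌉₊ : ℝ) ≤ (max N ⌈s r⌉₊ : ℕ) := by exact_mod_cast le_max_right _ _
          linarith
      · change F r ∈ U
        simp only [F, if_neg hr1]; exact mem_of_mem_nhds hU
    · refine ContinuousAt.congr (f := fun _ => g) continuousAt_const ?_
      filter_upwards [eventually_gt_nhds ht] with r hr
      simp [F, hr.not_gt]
  refine ⟨⟨⟨fun t => F t, hF.comp continuous_subtype_val⟩, ?_, ?_⟩⟩
  · change F ((0 : unitInterval) : ℝ) = f 0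
    rw [hloc 0 _ (by simp) (by simp [s])]
    simp [concatPaths, s]
  · change F ((1 : unitInterval) : ℝ) = g
    simp [F]

end Concatenation

/-! ### Matrix units in `K ⊗ A` -/

namespace FinMat

variable {I A X : Type*} [NonUnitalCStarAlgebra A] [NonUnitalCStarAlgebra X]

theorem single_add (i j : I) (a b : A) : single i j (a + b) = single i j a + single i j b := by
  ext i' j'; by_cases h : i' = i ∧ j' = j <;> simp [single, h]

theorem single_smul (i j : I) (c : ℂ) (a : A) : single i j (c • a) = c • single i j a := by
  ext i' j'; by_cases h : i' = i ∧ j' = j <;> simp [single, h]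

theorem star_single (i j : I) (a : A) : star (single i j a) = single j i (star a) := by
  ext i' j'
  by_cases h1 : i' = j <;> by_cases h2 : j' = i <;> simp [single, h1, h2]

theorem supp_single [DecidableEq I] (i j : I) (a : A) : (single i j a).Supp {i, j} :=
  fun i' j' h => by
    simp only [single]
    rw [if_neg]; rintro ⟨rfl, rfl⟩; simp at h

theorem single_mul_single (i j l : I) (a b : A) :
    single i j a * single j l b = single i l (a * b) := by
  classical
  ext i' l'
  rw [mul_entry (supp_single i j a), Finset.sum_eq_single_of_mem j (by simp)]
  · by_cases h1 : i' = i <;> by_cases h2 : l' = l <;> simp [single, h1, h2]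
  · intro k _ hk; simp [single, hk]

theorem single_mul_single_of_ne {j k : I} (h : j ≠ k) (i l : I) (a b : A) :
    single i j a * single k l b = 0 := by
  classical
  ext i' l'
  rw [mul_entry (supp_single i j a)]
  refine Finset.sum_eq_zero fun m _ => ?_
  by_cases h1 : m = j
  · subst h1; simp [single, h]
  · simp [single, h1]

/-- A system of matrix units with coefficients in `A` defines a *-homomorphism. -/
def liftUnits (T : I → I → A →ₗ[ℂ] X)
    (hmul : ∀ i j l a b, T i j a * T j l b = T i l (a * b))
    (hne : ∀ i j k l a b, j ≠ k → T i j a * T k l b = 0)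
    (hstar : ∀ i j a, star (T i j a) = T j i (star a)) : FinMat I A →⋆ₙₐ[ℂ] X :=
  let S : FinMat I A → X := fun M => ∑ᶠ i, ∑ᶠ k, T i k (M.entry i k)
  have hS : ∀ {F : Finset I} {M : FinMat I A}, M.Supp F →
      S M = ∑ i ∈ F, ∑ k ∈ F, T i k (M.entry i k) := fun {F M} hM => by
    have h1 : ∀ i, ∑ᶠ k, T i k (M.entry i k) = ∑ k ∈ F, T i k (M.entry i k) := fun i => by
      refine finsum_eq_sum_of_support_subset _ fun k hk => ?_
      by_contra h
      exact hk (by simp only [hM i k (Or.inr h), map_zero])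
    simp only [S, h1]
    refine finsum_eq_sum_of_support_subset _ fun i hi => ?_
    by_contra h
    exact hi (Finset.sum_eq_zero fun k _ => by simp only [hM i k (Or.inl h), map_zero])
  { toFun := S
    map_zero' := by simp [S]
    map_add' := fun M N => by
      obtain ⟨F, hM, hN⟩ := exists_supp₂ M N
      simp only [hS hM, hS hN, hS (supp_add hM hN), add_entry, map_add, Finset.sum_add_distrib]
    map_smul' := fun c M => by
      obtain ⟨F, hM⟩ := exists_supp M
      simp only [hS hM, hS (supp_smul c hM), smul_entry, map_smul, Finset.smul_sum,
        MonoidHom.id_apply]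
    map_star' := fun M => by
      obtain ⟨F, hM⟩ := exists_supp M
      simp only [hS hM, hS (supp_star hM), star_entry, star_sum, hstar]
      exact Finset.sum_comm
    map_mul' := fun M N => by
      obtain ⟨F, hM, hN⟩ := exists_supp₂ M N
      simp only [hS hM, hS hN, hS (supp_mul hM hN), mul_entry hM, map_sum, Finset.sum_mul_sum]
      refine Finset.sum_congr rfl fun i _ => ?_
      rw [Finset.sum_comm]
      refine Finset.sum_congr rfl fun k hk => ?_
      rw [Finset.sum_eq_single_of_mem k hk fun k' _ hk' => Finset.sum_eq_zero fun l _ =>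
        hne _ _ _ _ _ _ hk']
      exact Finset.sum_congr rfl fun l _ => (hmul _ _ _ _ _).symm }

theorem liftUnits_single (T : I → I → A →ₗ[ℂ] X)
    (hmul : ∀ i j l a b, T i j a * T j l b = T i l (a * b))
    (hne : ∀ i j k l a b, j ≠ k → T i j a * T k l b = 0)
    (hstar : ∀ i j a, star (T i j a) = T j i (star a)) (i j : I) (a : A) :
    liftUnits T hmul hne hstar (single i j a) = T i j a := by
  change ∑ᶠ i', ∑ᶠ k, T i' k ((single i j a).entry i' k) = _
  rw [finsum_eq_single _ i, finsum_eq_single _ j]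
  · simp [single]
  · intro k hk; simp [single, hk]
  · intro k hk; simp [single, hk]

end FinMat

namespace Stab

variable {I J K A B C X : Type*} [NonUnitalCStarAlgebra A] [NonUnitalCStarAlgebra B]
  [NonUnitalCStarAlgebra C] [NonUnitalCStarAlgebra X]

/-- The elementary tensor `e_{ij} ⊗ a`. -/
def elem (i j : I) : A →ₗ[ℂ] Stab I A where
  toFun a := of I A (FinMat.single i j a)
  map_add' a b := by rw [FinMat.single_add, map_add]
  map_smul' c a := by rw [FinMat.single_smul, map_smul]; rfl

theorem elem_apply (i j : I) (a : A) : elem i j a = of I A (FinMat.single i j a) := rfl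

theorem corner_apply (i : I) (a : A) : corner i a = elem i i a := rfl

theorem elem_mul (i j l : I) (a b : A) : elem i j a * elem j l b = elem i l (a * b) := by
  rw [elem_apply, elem_apply, ← map_mul, FinMat.single_mul_single]; rfl

theorem elem_mul_of_ne (i j k l : I) (a b : A) (h : j ≠ k) : elem i j a * elem k l b = 0 := by
  rw [elem_apply, elem_apply, ← map_mul, FinMat.single_mul_single_of_ne h, map_zero]

theorem star_elem (i j : I) (a : A) : star (elem i j a) = elem j i (star a) := by
  rw [elem_apply, ← map_star, FinMat.star_single]; rfl

theorem spread_elem (u v : J ↪ K) (i j : J) (a : A) :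
    spread u v (elem i j a) = elem (u i) (v j) a := by
  rw [elem_apply, spread_of, elem_apply]
  congr 1
  symm
  refine FinMat.spread_ext (fun m n => ?_) (fun r s h => ?_) fun r s h => ?_
  · simp only [FinMat.single]
    by_cases h : m = i ∧ n = j
    · rw [if_pos h, if_pos ⟨congrArg u h.1, congrArg v h.2⟩]
    · rw [if_neg h, if_neg fun h' => h ⟨u.injective h'.1, v.injective h'.2⟩]
  · simp only [FinMat.single]
    rw [if_neg]; rintro ⟨rfl, -⟩; exact h ⟨i, rfl⟩
  · simp only [FinMat.single]
    rw [if_neg]; rintro ⟨-, rfl⟩; exact h ⟨j, rfl⟩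

theorem map_elem (f : A →⋆ₙₐ[ℂ] B) (i j : I) (a : A) : map I f (elem i j a) = elem i j (f a) := by
  rw [elem_apply, map_of, elem_apply]
  congr 1
  ext i' j'
  by_cases h : i' = i ∧ j' = j <;> simp [FinMat.single, h]

theorem continuous_elem (i j : I) : Continuous (elem i j : A → Stab I A) := by
  -- For `i ≠ j` the map `elem i j` is not a *-homomorphism. It is the corner embedding over a
  -- one-point index set followed by `spread` along the points `i` and `j`, and both of these are
  -- continuous.
  let u : I → Unit ↪ I := fun i => ⟨fun _ => i, fun _ _ _ => rfl⟩
  have h : (elem i j : A → Stab I A) = fun a => spread (u i) (u j) (corner () a) := by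
    funext a
    rw [corner_apply, spread_elem]; rfl
  rw [h]
  exact (spread (u i) (u j)).continuous.comp (hom_continuous (corner ()))

@[elab_as_elim]
theorem ind_elem {P : Stab I A → Prop} (x : Stab I A) (hc : IsClosed {x | P x}) (h0 : P 0)
    (ha : ∀ x y, P x → P y → P (x + y)) (he : ∀ i j a, P (elem i j a)) : P x := by
  refine ind x hc fun M => ?_
  refine FinMat.ind M ?_ ?_ ?_
  · rwa [map_zero]
  · intro M N hM hN; rw [map_add]; exact ha _ _ hM hN
  · exact he

theorem hom_ext_elem {f g : Stab I A →⋆ₙₐ[ℂ] X} (h : ∀ i j a, f (elem i j a) = g (elem i j a)) :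
    f = g :=
  NonUnitalStarAlgHom.ext fun x => ind_elem x (isClosed_eq (hom_continuous f) (hom_continuous g))
    (by rw [map_zero, map_zero]) (fun x y hx hy => by rw [map_add, map_add, hx, hy]) h

theorem hom_ext_elem_elem {f g : Stab I (Stab J A) →⋆ₙₐ[ℂ] X}
    (h : ∀ i j m n a, f (elem i j (elem m n a)) = g (elem i j (elem m n a))) : f = g := by
  refine hom_ext_elem fun i j x => ?_
  refine ind_elem x (isClosed_eq ((hom_continuous f).comp (continuous_elem i j))
    ((hom_continuous g).comp (continuous_elem i j))) ?_ (fun x y hx hy => ?_) (h i j)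
  · rw [map_zero, map_zero, map_zero]
  · rw [map_add, map_add, map_add, hx, hy]

theorem spread_spread {J' : Type*} (u v : J ↪ K) (u' v' : J' ↪ J) (x : Stab J' A) :
    spread u v (spread u' v' x) = spread (u'.trans u) (v'.trans v) x := by
  refine ind_elem x (isClosed_eq ((spread u v).continuous.comp (spread u' v').continuous)
    (spread _ _).continuous) ?_ (fun x y hx hy => ?_) fun i j a => ?_
  · simp only [map_zero]
  · simp only [map_add, hx, hy]
  · simp only [spread_elem]; rfl

theorem spread_refl (x : Stab J A) : spread (.refl J) (.refl J) x = x := by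
  refine ind_elem x (isClosed_eq (spread _ _).continuous continuous_id) ?_
    (fun x y hx hy => ?_) fun i j a => ?_
  · simp only [map_zero]
  · simp only [map_add, hx, hy]
  · rw [spread_elem]; rfl

/-- Moving entries along one injection, as a *-homomorphism. -/
def spreadHom (u : J ↪ K) : Stab J A →⋆ₙₐ[ℂ] Stab K A where
  toFun := spread u u
  map_smul' := map_smul (spread u u)
  map_zero' := map_zero (spread u u)
  map_add' := map_add (spread u u)
  map_mul' x y := (spread_mul u u u x y).symm
  map_star' x := (spread_star u u x).symm

theorem spreadHom_apply (u : J ↪ K) (x : Stab J A) : spreadHom u x = spread u u x := rfl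

theorem spreadHom_elem (u : J ↪ K) (i j : J) (a : A) :
    spreadHom u (elem i j a) = elem (u i) (u j) a := spread_elem u u i j a

theorem unblock_single (e : I × J ≃ K) (i k : I) (x : Stab J A) :
    unblock e (FinMat.single i k x) = spread (slice e i) (slice e k) x := by
  change ∑ᶠ i', ∑ᶠ k', spread (slice e i') (slice e k') ((FinMat.single i k x).entry i' k') = _
  rw [finsum_eq_single _ i, finsum_eq_single _ k]
  · simp [FinMat.single]
  · intro k hk; simp [FinMat.single, hk]
  · intro k hk; simp [FinMat.single, hk]

theorem flatten_elem (e : I × J ≃ K) (i k : I) (x : Stab J A) :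
    flatten e (elem i k x) = spread (slice e i) (slice e k) x :=
  (lift_of _ _).trans (unblock_single e i k x)

theorem flatten_elem_elem (e : I × J ≃ K) (i k : I) (m n : J) (a : A) :
    flatten e (elem i k (elem m n a)) = elem (e (i, m)) (e (k, n)) a := by
  rw [flatten_elem, spread_elem]; rfl

/-- The inverse of `flatten`. -/
def unflatten (e : I × J ≃ K) : Stab K A →⋆ₙₐ[ℂ] Stab I (Stab J A) :=
  lift (FinMat.liftUnits
    (fun r s => (elem (e.symm r).1 (e.symm s).1).comp (elem (e.symm r).2 (e.symm s).2))
    (fun i j l a b => by simp only [LinearMap.comp_apply, elem_mul])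
    (fun i j k l a b h => by
      simp only [LinearMap.comp_apply]
      by_cases h1 : (e.symm j).1 = (e.symm k).1
      · rw [h1, elem_mul, elem_mul_of_ne, map_zero]
        intro h2
        exact h (e.symm.injective (Prod.ext h1 h2))
      · rw [elem_mul_of_ne _ _ _ _ _ _ h1])
    (fun i j a => by simp only [LinearMap.comp_apply, star_elem]))

theorem unflatten_elem (e : I × J ≃ K) (r s : K) (a : A) :
    unflatten e (elem r s a) =
      elem (e.symm r).1 (e.symm s).1 (elem (e.symm r).2 (e.symm s).2 a) :=
  (lift_of _ _).trans (FinMat.liftUnits_single _ _ _ _ r s a)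

theorem unflatten_comp_flatten (e : I × J ≃ K) :
    (unflatten e).comp (flatten e) = NonUnitalStarAlgHom.id ℂ (Stab I (Stab J A)) :=
  hom_ext_elem_elem fun i j m n a => by
    rw [NonUnitalStarAlgHom.comp_apply, flatten_elem_elem, unflatten_elem]
    simp

theorem flatten_comp_map_map (e : I × J ≃ K) (f : A →⋆ₙₐ[ℂ] B) :
    (flatten e).comp (map I (map J f)) = (map K f).comp (flatten e) :=
  hom_ext_elem_elem fun i j m n a => by
    simp only [NonUnitalStarAlgHom.comp_apply, map_elem, flatten_elem_elem]

theorem flatten_comp_corner (e : I × J ≃ K) (i : I) :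
    (flatten e).comp (corner i : Stab J A →⋆ₙₐ[ℂ] Stab I (Stab J A)) = spreadHom (slice e i) :=
  NonUnitalStarAlgHom.ext fun x => flatten_elem e i i x

theorem flatten_comp_map_corner (e : I × J ≃ K) (j : J) :
    (flatten e).comp (map I (corner j : A →⋆ₙₐ[ℂ] Stab J A)) =
      spreadHom ⟨fun i => e (i, j), fun i i' h => by simpa using e.injective h⟩ :=
  hom_ext_elem fun i k a => by
    rw [NonUnitalStarAlgHom.comp_apply, map_elem, corner_apply, flatten_elem_elem,
      spreadHom_elem]; rfl

theorem map_comp_corner (f : A →⋆ₙₐ[ℂ] B) (i : I) :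
    (map I f).comp (corner i) = (corner i).comp f :=
  NonUnitalStarAlgHom.ext fun a => map_elem f i i a

theorem map_comp (g : B →⋆ₙₐ[ℂ] C) (f : A →⋆ₙₐ[ℂ] B) :
    map I (g.comp f) = (map I g).comp (map I f) :=
  NonUnitalStarAlgHom.ext fun x => (map_map g f x).symm

theorem map_spread (f : A →⋆ₙₐ[ℂ] B) (u v : J ↪ K) (x : Stab J A) :
    map K f (spread u v x) = spread u v (map J f x) := by
  refine ind_elem x (isClosed_eq ((hom_continuous _).comp (spread _ _).continuous)
    ((spread _ _).continuous.comp (hom_continuous _))) ?_ (fun x y hx hy => ?_) fun i j a => ?_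
  · simp only [map_zero]
  · simp only [map_add, hx, hy]
  · simp only [spread_elem, map_elem]

/-! ### Homotopies -/

theorem ptCont_map {T : Type*} [TopologicalSpace T] {F : T → A →⋆ₙₐ[ℂ] B} (hF : PtCont F) :
    PtCont fun t => map I (F t) := fun x => by
  refine ind_elem x (isClosed_setOf_continuous fun t => map I (F t)) ?_ (fun x y hx hy => ?_)
    fun i j a => ?_
  · simp only [map_zero]; exact continuous_const
  · simp only [map_add]; exact hx.add hy
  · simp only [map_elem]; exact (continuous_elem i j).comp (hF a)

theorem homotopic_map {f g : A →⋆ₙₐ[ℂ] B} (h : Homotopic f g) :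
    Homotopic (map I f) (map I g) := by
  obtain ⟨F, hF, rfl, rfl⟩ := h.exists_family
  exact .of_family (ptCont_map hF) rfl rfl

/-- The symmetry of `K(ℓ²(I)) ⊗ A` given by the transposition of two indices. -/
def swapSymmetry [DecidableEq I] (i j : I) : Symmetry (Stab I A) where
  L := spread (Equiv.swap i j).toEmbedding (.refl I)
  R := spread (.refl I) (Equiv.swap i j).toEmbedding
  L_mul x y := by
    conv_rhs => rw [← spread_refl y, spread_mul]
  R_mul x y := by
    have h : y = spread (Equiv.swap i j).toEmbedding (.refl I)
        (spread (Equiv.swap i j).toEmbedding (.refl I) y) := by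
      rw [spread_spread]
      have : (Equiv.swap i j).toEmbedding.trans (Equiv.swap i j).toEmbedding = .refl I := by
        ext k; simp
      rw [this]
      exact (spread_refl y).symm
    conv_lhs => rw [h, spread_mul, spread_refl]
  L_L x := by
    rw [spread_spread]
    have : (Equiv.swap i j).toEmbedding.trans (Equiv.swap i j).toEmbedding = .refl I := by
      ext k; simp
    rw [this]
    exact spread_refl x
  L_R x := by rw [spread_spread, spread_spread]; rfl
  star_L x := spread_star _ _ x

/-- If `k` and `l` avoid `i` and `j`, the transposition fixes `e_{kl} ⊗ a` from both sides. So the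
unitary `c + i d s` acts on it by the scalar `c + i d` of modulus one, which cancels in a
conjugation. -/
theorem swapSymmetry_conj_elem [DecidableEq I] {i j k l : I} (hki : k ≠ i) (hkj : k ≠ j)
    (hli : l ≠ i) (hlj : l ≠ j) (t : ℝ) (a : A) :
    (swapSymmetry i j).conj t (elem k l a) = elem k l a := by
  have hL : (swapSymmetry i j).L (elem k l a) = elem k l a := by
    refine (spread_elem _ _ _ _ _).trans ?_
    simp [Equiv.swap_apply_of_ne_of_ne hki hkj]
  have hR : (swapSymmetry i j).R (elem k l a) = elem k l a := by
    refine (spread_elem _ _ _ _ _).trans ?_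
    simp [Equiv.swap_apply_of_ne_of_ne hli hlj]
  have hc : (Real.cos (Real.pi / 2 * t) : ℂ) ^ 2 + (Real.sin (Real.pi / 2 * t) : ℂ) ^ 2 = 1 := by
    exact_mod_cast Real.cos_sq_add_sin_sq (Real.pi / 2 * t)
  simp only [Symmetry.conj_apply, Symmetry.left, Symmetry.right, hR, map_sub, map_smul, hL]
  generalize (Real.cos (Real.pi / 2 * t) : ℂ) = c at *
  generalize (Real.sin (Real.pi / 2 * t) : ℂ) = d at *
  have h2 : d * Complex.I * (d * Complex.I) = - d ^ 2 := by
    linear_combination d ^ 2 * Complex.I_sq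
  generalize elem k l a = x
  calc _ = (c ^ 2 - d * Complex.I * (d * Complex.I)) • x := by module
    _ = _ := by rw [h2, sub_neg_eq_add, hc, one_smul]

/-- Changes `u` at the places `0, …, n - 1` to `v` by transpositions of the values. -/
def swapSeq (u v : ℕ ↪ ℕ) : ℕ → (ℕ ↪ ℕ)
  | 0 => u
  | n + 1 => (swapSeq u v n).trans (Equiv.swap (swapSeq u v n n) (v n)).toEmbedding

/-- By injectivity, the `n`-th transposition does not touch the values `v k`, `k < n`, that are
already in place. The two inequalities are what makes the later rotations fix `e_{ij} ⊗ a` for small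
`i` and `j`. -/
theorem swapSeq_ne (u v : ℕ ↪ ℕ) {n k : ℕ} (hk : k < n) :
    swapSeq u v n k = v k ∧ v k ≠ swapSeq u v n n ∧ v k ≠ v n := by
  have h : swapSeq u v n k = v k := by
    induction n with
    | zero => omega
    | succ n ih =>
      rcases Nat.lt_succ_iff_lt_or_eq.1 hk with h | rfl
      · have h1 := ih h
        simp only [swapSeq, Function.Embedding.trans_apply, Equiv.coe_toEmbedding, h1]
        refine Equiv.swap_apply_of_ne_of_ne ?_ fun h2 => h.ne (v.injective h2)
        rw [← h1]
        exact fun h2 => h.ne ((swapSeq u v n).injective h2)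
      · simp [swapSeq]
  refine ⟨h, fun h2 => ?_, fun h2 => hk.ne (v.injective h2)⟩
  rw [← h] at h2
  exact hk.ne ((swapSeq u v n).injective h2)

theorem conj_one_comp_spreadHom (i j : ℕ) (u : ℕ ↪ ℕ) :
    ((swapSymmetry i j).conj 1).comp (spreadHom u : Stab ℕ A →⋆ₙₐ[ℂ] Stab ℕ A) =
      spreadHom (u.trans (Equiv.swap i j).toEmbedding) := by
  refine NonUnitalStarAlgHom.ext fun x => ?_
  rw [NonUnitalStarAlgHom.comp_apply, Symmetry.conj_one, spreadHom_apply, spreadHom_apply]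
  change spread _ _ (spread _ _ (spread u u x)) = _
  rw [spread_spread, spread_spread]; rfl

/-- Any two isometries given by injections of `ℕ` induce homotopic maps. -/
theorem homotopic_spreadHom (u v : ℕ ↪ ℕ) :
    Homotopic (spreadHom u : Stab ℕ A →⋆ₙₐ[ℂ] Stab ℕ A) (spreadHom v) := by
  let f : ℕ → (Stab ℕ A →⋆ₙₐ[ℂ] Stab ℕ A) := fun n => spreadHom (swapSeq u v n)
  let s : ℕ → Symmetry (Stab ℕ A) := fun n => swapSymmetry (swapSeq u v n n) (v n)
  let F : ℕ → unitInterval → (Stab ℕ A →⋆ₙₐ[ℂ] Stab ℕ A) := fun n t => ((s n).conj t).comp (f n)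
  have hF : ∀ n, PtCont (F n) := fun n x =>
    ((s n).ptCont_conj (f n x)).comp continuous_subtype_val
  let γ : ∀ n, Path (f n) (f (n + 1)) := fun n =>
    ⟨⟨F n, (ptCont_iff _).1 (hF n)⟩,
      NonUnitalStarAlgHom.ext fun x => (s n).conj_zero (f n x),
      conj_one_comp_spreadHom _ _ _⟩
  refine joined_of_paths γ (g := spreadHom v) ?_
  -- The rotations are concatenated. On `e_{ij} ⊗ a` all those with index above `i` and `j` are
  -- constantly equal to `spreadHom v`; the span of these elements is dense and everything is
  -- contractive, so the paths converge pointwise to `spreadHom v`.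
  have key : ∀ x : Stab ℕ A, ∀ ε > 0, ∃ N, ∀ n ≥ N, ∀ t, ‖F n t x - spreadHom v x‖ < ε := by
    have hfin : ∀ x : Stab ℕ A, ∀ ε > 0, ∃ y, ‖x - y‖ < ε ∧
        ∃ N, ∀ n ≥ N, ∀ t, F n t y = spreadHom v y := by
      intro x ε hε
      have hd : x ∈ closure {y : Stab ℕ A | ∃ N, ∀ n ≥ N, ∀ t, F n t y = spreadHom v y} := by
        refine ind x isClosed_closure fun M => subset_closure ?_
        refine FinMat.ind M ?_ ?_ ?_
        · exact ⟨0, fun n _ t => by simp only [map_zero]⟩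
        · rintro M N ⟨m, hm⟩ ⟨n, hn⟩
          refine ⟨max m n, fun k hk t => ?_⟩
          rw [map_add, map_add, map_add, hm k (by omega), hn k (by omega)]
        · intro i j a
          refine ⟨max i j + 1, fun n hn t => ?_⟩
          change (s n).conj t (spreadHom (swapSeq u v n) (elem i j a)) =
            spreadHom v (elem i j a)
          obtain ⟨h1, h2, h3⟩ := swapSeq_ne u v (n := n) (k := i) (by omega)
          obtain ⟨k1, k2, k3⟩ := swapSeq_ne u v (n := n) (k := j) (by omega)
          rw [spreadHom_elem, h1, k1, spreadHom_elem]
          exact swapSymmetry_conj_elem h2 h3 k2 k3 t a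
      obtain ⟨y, hy, hxy⟩ := Metric.mem_closure_iff.1 hd ε hε
      exact ⟨y, by rwa [← dist_eq_norm], hy⟩
    intro x ε hε
    obtain ⟨y, hxy, N, hN⟩ := hfin x (ε / 2) (by positivity)
    refine ⟨N, fun n hn t => ?_⟩
    have h1 : F n t x - spreadHom v x = F n t (x - y) - spreadHom v (x - y) := by
      rw [map_sub, map_sub, hN n hn t]; abel
    rw [h1]
    calc _ ≤ ‖F n t (x - y)‖ + ‖spreadHom v (x - y)‖ := norm_sub_le _ _
      _ ≤ ‖x - y‖ + ‖x - y‖ := add_le_add (NonUnitalStarAlgHom.norm_apply_le _ _)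
        (NonUnitalStarAlgHom.norm_apply_le _ _)
      _ < ε := by linarith
  intro U hU
  -- A neighbourhood in the point-norm topology restricts only finitely many elements `x`, so the
  -- maximum of their indices `N x` works.
  have hU' : U ∈ Filter.comap (fun (f : Stab ℕ A →⋆ₙₐ[ℂ] Stab ℕ A) x => f x)
      (𝓝 fun x => spreadHom v x) := by
    rwa [← nhds_induced]
  obtain ⟨V, hV, hVU⟩ := hU'
  rw [nhds_pi, Filter.mem_pi] at hV
  obtain ⟨S, hS, W, hW, hWV⟩ := hV
  have : ∀ x : Stab ℕ A, ∃ N, ∀ n ≥ N, ∀ t, F n t x ∈ W x := fun x => by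
    obtain ⟨ε, hε, h⟩ := Metric.mem_nhds_iff.1 (hW x)
    obtain ⟨N, hN⟩ := key x ε hε
    exact ⟨N, fun n hn t => h (by rw [Metric.mem_ball, dist_eq_norm]; exact hN n hn t)⟩
  choose N hN using this
  refine ⟨hS.toFinset.sup N, fun k hk t => hVU (hWV fun x hx => ?_)⟩
  exact hN x k (le_trans (Finset.le_sup (f := N) (hS.mem_toFinset.2 hx)) hk) t

theorem spreadHom_refl : (spreadHom (.refl ℕ) : Stab ℕ A →⋆ₙₐ[ℂ] Stab ℕ A) =
    NonUnitalStarAlgHom.id ℂ _ := NonUnitalStarAlgHom.ext spread_refl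

theorem homotopic_spreadHom_id (u : ℕ ↪ ℕ) :
    Homotopic (spreadHom u : Stab ℕ A →⋆ₙₐ[ℂ] Stab ℕ A) (NonUnitalStarAlgHom.id ℂ _) := by
  rw [← spreadHom_refl]; exact homotopic_spreadHom u _

end Stab

/-! ### Stabilization and homotopy -/

section Stable

variable {A B C D X Y Z : Type*} [NonUnitalCStarAlgebra A] [NonUnitalCStarAlgebra B]
  [NonUnitalCStarAlgebra C] [NonUnitalCStarAlgebra D] [NonUnitalCStarAlgebra X]
  [NonUnitalCStarAlgebra Y] [NonUnitalCStarAlgebra Z]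

theorem absorb_apply (M : CStarMatrix (Fin 2) (Fin 2) (KTensor A)) : absorb A M =
    ∑ i, ∑ k, Stab.spread (Stab.slice twoNat i) (Stab.slice twoNat k) (M i k) := by
  have h : FinMat.ofMat (Fin 2) M = ∑ i, ∑ k, FinMat.single i k (M i k) :=
    FinMat.eq_sum_single (F := Finset.univ) fun i j h => by simp at h
  change Stab.unblock twoNat (FinMat.ofMat (Fin 2) M) = _
  rw [h]
  simp only [map_sum, Stab.unblock_single]

theorem absorb_comp_mat2_map (f : A →⋆ₙₐ[ℂ] B) :
    (absorb B).comp (mat2 (Stab.map ℕ f)) = (Stab.map ℕ f).comp (absorb A) := by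
  refine NonUnitalStarAlgHom.ext fun M => ?_
  simp only [NonUnitalStarAlgHom.comp_apply, absorb_apply, map_sum, Stab.map_spread, mat2_apply]

theorem absorb_comp_dsum_zero (f : X →⋆ₙₐ[ℂ] KTensor Y) :
    (absorb Y).comp (dsum f 0) = (Stab.spreadHom (Stab.slice twoNat 0)).comp f := by
  refine NonUnitalStarAlgHom.ext fun x => ?_
  simp only [NonUnitalStarAlgHom.comp_apply, absorb_apply, Fin.sum_univ_two,
    dsum_apply_zero_zero, dsum_apply_zero_one, dsum_apply_one_zero, dsum_apply_one_one, map_zero,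
    NonUnitalStarAlgHom.zero_apply, add_zero]
  rfl

theorem absorb_comp_dsum_zero_homotopic (f : X →⋆ₙₐ[ℂ] KTensor Y) :
    Homotopic ((absorb Y).comp (dsum f 0)) f := by
  rw [absorb_comp_dsum_zero]
  exact (Stab.homotopic_spreadHom_id _).comp_right f

theorem flattenK_comp_map_map (f : A →⋆ₙₐ[ℂ] B) :
    (flattenK B).comp (Stab.map ℕ (Stab.map ℕ f)) = (Stab.map ℕ f).comp (flattenK A) :=
  Stab.flatten_comp_map_map _ f

theorem flattenK_comp_corner_homotopic (A : Type*) [NonUnitalCStarAlgebra A] :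
    Homotopic ((flattenK A).comp (Stab.corner 0)) (NonUnitalStarAlgHom.id ℂ (KTensor A)) := by
  have h : (flattenK A).comp (Stab.corner 0) = _ := Stab.flatten_comp_corner _ _
  rw [h]
  exact Stab.homotopic_spreadHom_id _

theorem flattenK_comp_map_corner_homotopic (A : Type*) [NonUnitalCStarAlgebra A] :
    Homotopic ((flattenK A).comp (Stab.map ℕ (Stab.corner 0)))
      (NonUnitalStarAlgHom.id ℂ (KTensor A)) := by
  have h : (flattenK A).comp (Stab.map ℕ (Stab.corner 0)) = _ := Stab.flatten_comp_map_corner _ _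
  rw [h]
  exact Stab.homotopic_spreadHom_id _

theorem flattenK_comp_corner_comp (f : X →⋆ₙₐ[ℂ] KTensor A) :
    Homotopic ((flattenK A).comp ((Stab.corner 0).comp f)) f :=
  (flattenK_comp_corner_homotopic A).comp_right f

/-- The two corner embeddings of `K ⊗ A` in `K ⊗ K ⊗ A` are homotopic. -/
theorem map_corner_homotopic_corner (A : Type*) [NonUnitalCStarAlgebra A] :
    Homotopic (Stab.map ℕ (Stab.corner 0))
      (Stab.corner 0 : KTensor A →⋆ₙₐ[ℂ] KTensor (KTensor A)) := by
  -- Both embeddings are homotopic to the identity after `flattenK`, and `flattenK` has a left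
  -- inverse.
  have h := ((flattenK_comp_map_corner_homotopic A).trans
    (flattenK_comp_corner_homotopic A).symm).comp_left (Stab.unflatten Nat.pairEquiv)
  have hu : (Stab.unflatten Nat.pairEquiv).comp (flattenK A) = NonUnitalStarAlgHom.id ℂ _ :=
    Stab.unflatten_comp_flatten _
  rwa [← NonUnitalStarAlgHom.comp_assoc, ← NonUnitalStarAlgHom.comp_assoc, hu, hom_id_comp,
    hom_id_comp] at h

/-- A map `f` from `K ⊗ X` to `K ⊗ Y` is determined up to homotopy by its restriction to `X`. -/
theorem flattenK_comp_map_comp_corner (f : KTensor X →⋆ₙₐ[ℂ] KTensor Y) :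
    Homotopic ((flattenK Y).comp (Stab.map ℕ (f.comp (Stab.corner 0)))) f := by
  rw [Stab.map_comp]
  -- Once `id ⊗ corner` is replaced by the other corner embedding, `f` moves past it by naturality.
  refine (((map_corner_homotopic_corner X).comp_left (Stab.map ℕ f)).comp_left
    (flattenK Y)).trans ?_
  rw [Stab.map_comp_corner]
  exact flattenK_comp_corner_comp f

/-- The inclusion `M₂(Y) → K ⊗ Y`. -/
def mat2ToK (Y : Type*) [NonUnitalCStarAlgebra Y] :
    CStarMatrix (Fin 2) (Fin 2) Y →⋆ₙₐ[ℂ] KTensor Y :=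
  (Stab.spreadHom Fin.valEmbedding).comp ((Stab.of (Fin 2) Y).comp (FinMat.ofMat (Fin 2)))

theorem mat2ToK_comp_dsum_zero (f : X →⋆ₙₐ[ℂ] Y) :
    (mat2ToK Y).comp (dsum f 0) = (Stab.corner 0).comp f := by
  refine NonUnitalStarAlgHom.ext fun x => ?_
  have h : FinMat.ofMat (Fin 2) (dsum f 0 x) = FinMat.single 0 0 (f x) := by
    ext i j
    change dsum f 0 x i j = _
    fin_cases i <;> fin_cases j <;> simp [dsum, FinMat.single]
  change Stab.spreadHom Fin.valEmbedding (Stab.of (Fin 2) Y (FinMat.ofMat (Fin 2) (dsum f 0 x))) =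
    Stab.elem 0 0 (f x)
  rw [h, ← Stab.elem_apply, Stab.spreadHom_elem]
  rfl

/-- A zero summand is invisible after stabilization: `M₂(Y) ⊆ K ⊗ Y` sends `f ⊕ 0` to `e₀₀ ⊗ f`, and
the corner embedding is absorbed by `K ⊗ K ≅ K`. -/
theorem homotopic_map_of_dsum_zero {f g : X →⋆ₙₐ[ℂ] Y} (h : Homotopic (dsum f 0) (dsum g 0)) :
    Homotopic (Stab.map ℕ f) (Stab.map ℕ g) := by
  have h1 := h.comp_left (mat2ToK Y)
  rw [mat2ToK_comp_dsum_zero, mat2ToK_comp_dsum_zero] at h1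
  have h2 := (Stab.homotopic_map (I := ℕ) h1).comp_left (flattenK Y)
  rw [Stab.map_comp, Stab.map_comp, ← NonUnitalStarAlgHom.comp_assoc,
    ← NonUnitalStarAlgHom.comp_assoc] at h2
  have h3 := flattenK_comp_map_corner_homotopic Y
  exact ((h3.comp_right _).symm.trans h2).trans (h3.comp_right _)

theorem muQ_comp_QMap_map (f : A →⋆ₙₐ[ℂ] B) :
    (muQ B).comp (QMap (Stab.map ℕ f)) = (Stab.map ℕ (QMap f)).comp (muQ A) := by
  have h1 : (QMap f).comp (iota A) = (iota B).comp f := NonUnitalStarAlgHom.ext (QMap_iota f)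
  have h2 : (QMap f).comp (iotaBar A) = (iotaBar B).comp f :=
    NonUnitalStarAlgHom.ext (QMap_iotaBar f)
  refine Q_hom_ext (fun x => ?_) fun x => ?_
  · simp only [NonUnitalStarAlgHom.comp_apply, QMap_iota, muQ, lift_iota, Stab.map_map, h1]
  · simp only [NonUnitalStarAlgHom.comp_apply, QMap_iotaBar, muQ, lift_iotaBar, Stab.map_map, h2]

/-- Naturality of `μ`. -/
theorem mu_comp_qMap_map (f : A →⋆ₙₐ[ℂ] B) :
    (mu B).comp (qMap (Stab.map ℕ f)) = (Stab.map ℕ (qMap f)).comp (mu A) := by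
  refine NonUnitalStarAlgHom.ext fun z => Stab.map_injective (I := ℕ) qIncl_injective ?_
  rw [NonUnitalStarAlgHom.comp_apply, map_qIncl_mu, qIncl_qMap, NonUnitalStarAlgHom.comp_apply,
    Stab.map_map, qIncl_comp_qMap, ← Stab.map_map, map_qIncl_mu]
  exact DFunLike.congr_fun (muQ_comp_QMap_map f) _

/-- Both sides are restrictions of the map on `Q(K ⊗ B)` given by the pair `(id, 0)`. -/
theorem map_piMap_comp_mu : (Stab.map ℕ (piMap B)).comp (mu B) = piMap (KTensor B) := by
  have h1 : (evalQ B).comp (iota B) = NonUnitalStarAlgHom.id ℂ B :=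
    NonUnitalStarAlgHom.ext evalQ_iota
  have h2 : (evalQ B).comp (iotaBar B) = 0 := NonUnitalStarAlgHom.ext evalQ_iotaBar
  have h0 : Stab.map ℕ (0 : B →⋆ₙₐ[ℂ] B) = 0 := Stab.hom_ext_elem fun i j a => by
    rw [Stab.map_elem]; exact map_zero _
  have h : (Stab.map ℕ (evalQ B)).comp (muQ B) = evalQ (KTensor B) := by
    refine Q_hom_ext (fun x => ?_) fun x => ?_
    · simp only [NonUnitalStarAlgHom.comp_apply, muQ, lift_iota, Stab.map_map, h1, Stab.map_id,
        evalQ_iota]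
    · simp only [NonUnitalStarAlgHom.comp_apply, muQ, lift_iotaBar, Stab.map_map, h2, h0,
        evalQ_iotaBar, NonUnitalStarAlgHom.zero_apply]
  refine NonUnitalStarAlgHom.ext fun z => ?_
  rw [NonUnitalStarAlgHom.comp_apply, piMap, ← Stab.map_map, map_qIncl_mu]
  exact DFunLike.congr_fun h _

end Stable

/-! ### The bijection and the product -/

section Product

variable {A B C D Y : Type*} [NonUnitalCStarAlgebra A] [NonUnitalCStarAlgebra B]
  [NonUnitalCStarAlgebra C] [NonUnitalCStarAlgebra D] [NonUnitalCStarAlgebra Y]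
  {φ : q A →⋆ₙₐ[ℂ] CStarMatrix (Fin 2) (Fin 2) (q (q A))}

theorem Homotopic.muq (φ : q A →⋆ₙₐ[ℂ] CStarMatrix (Fin 2) (Fin 2) (q (q A)))
    {α α' : q A →⋆ₙₐ[ℂ] KTensor B} (h : Homotopic α α') : Homotopic (muq φ α) (muq φ α') :=
  ((h.qMap.mat2.comp_right φ).comp_left (_root_.mat2 (mu B))).comp_left (absorb (q B))

theorem Homotopic.sharp (φ : q A →⋆ₙₐ[ℂ] CStarMatrix (Fin 2) (Fin 2) (q (q A)))
    {α α' : q A →⋆ₙₐ[ℂ] KTensor B} {β β' : q B →⋆ₙₐ[ℂ] KTensor C} (h : Homotopic β β')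
    (h' : Homotopic α α') : Homotopic (sharp φ β α) (sharp φ β' α') :=
  (((Stab.homotopic_map h).comp_right _).comp_left _).trans ((h'.muq φ).comp_left _ |>.comp_left _)

theorem Homotopic.primeMap (φ : q A →⋆ₙₐ[ℂ] CStarMatrix (Fin 2) (Fin 2) (q (q A)))
    {β β' : q A →⋆ₙₐ[ℂ] KTensor B} (h : Homotopic β β') :
    Homotopic (primeMap φ β) (primeMap φ β') :=
  (Stab.homotopic_map (h.muq φ)).comp_left _

theorem Homotopic.barMap {α α' : KTensor (q A) →⋆ₙₐ[ℂ] KTensor (q B)} (h : Homotopic α α') :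
    Homotopic (barMap α) (barMap α') := (h.comp_right _).comp_left _

/-- This is the only place where the homotopy between `π φ` and `id ⊕ 0` enters the study of the
product: it turns `b π φ` into `b ⊕ 0`, and `absorb` removes the zero summand up to homotopy. -/
theorem absorb_comp_mat2_comp_homotopic
    (hφ : Homotopic (dsum (NonUnitalStarAlgHom.id ℂ (q A)) 0) ((mat2 (piMap (q A))).comp φ))
    (b : q A →⋆ₙₐ[ℂ] KTensor Y) :
    Homotopic ((absorb Y).comp ((mat2 (b.comp (piMap (q A)))).comp φ)) b := by
  have h := (hφ.comp_left (mat2 b)).comp_left (absorb Y)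
  rw [mat2_comp_dsum, hom_comp_zero] at h
  exact h.symm.trans (absorb_comp_dsum_zero_homotopic b)

/-- By naturality of `π`, one has `(id ⊗ π_B) μ q(β) = π_{K ⊗ B} q(β) = β π_{qA}`. -/
theorem map_piMap_comp_muq_homotopic
    (hφ : Homotopic (dsum (NonUnitalStarAlgHom.id ℂ (q A)) 0) ((mat2 (piMap (q A))).comp φ))
    (β : q A →⋆ₙₐ[ℂ] KTensor B) :
    Homotopic ((Stab.map ℕ (piMap B)).comp (muq φ β)) β := by
  have h : (Stab.map ℕ (piMap B)).comp (muq φ β) =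
      (absorb B).comp ((mat2 (β.comp (piMap (q A)))).comp φ) := by
    rw [muq, ← NonUnitalStarAlgHom.comp_assoc, ← absorb_comp_mat2_map, ← piMap_qMap,
      ← map_piMap_comp_mu]
    rfl
  rw [h]
  exact absorb_comp_mat2_comp_homotopic hφ β

/-- Naturality of `μ` gives `μ q((id ⊗ π_B) a) = (id ⊗ q(π_B)) μ q(a)`. After stabilization `q(π_B)`
may be replaced by the other map `π_{qB} : q²B → qB`, and `(id ⊗ π_{qB}) μ q(a) = a π_{qA}`. -/
theorem muq_map_piMap_homotopic
    (hφ : Homotopic (dsum (NonUnitalStarAlgHom.id ℂ (q A)) 0) ((mat2 (piMap (q A))).comp φ))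
    (a : q A →⋆ₙₐ[ℂ] KTensor (q B)) :
    Homotopic (muq φ ((Stab.map ℕ (piMap B)).comp a)) a := by
  have h1 : muq φ ((Stab.map ℕ (piMap B)).comp a) = (Stab.map ℕ (qMap (piMap B))).comp
      ((absorb (q (q B))).comp ((mat2 ((mu (q B)).comp (qMap a))).comp φ)) := by
    rw [muq, qMap_comp, mat2_comp, ← NonUnitalStarAlgHom.comp_assoc (mat2 (mu B)),
      ← NonUnitalStarAlgHom.comp_assoc (mat2 (mu B)), ← mat2_comp, mu_comp_qMap_map, mat2_comp,
      ← NonUnitalStarAlgHom.comp_assoc (Stab.map ℕ (qMap (piMap B))), ← absorb_comp_mat2_map]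
    rfl
  have h2 : (Stab.map ℕ (piMap (q B))).comp
      ((absorb (q (q B))).comp ((mat2 ((mu (q B)).comp (qMap a))).comp φ)) =
      (absorb (q B)).comp ((mat2 (a.comp (piMap (q A)))).comp φ) := by
    rw [← NonUnitalStarAlgHom.comp_assoc, ← absorb_comp_mat2_map, ← piMap_qMap,
      ← map_piMap_comp_mu]
    rfl
  rw [h1]
  refine ((homotopic_map_of_dsum_zero (piMap_q_homotopic_qMap_piMap B)).comp_right _).trans ?_
  rw [h2]
  exact absorb_comp_mat2_comp_homotopic hφ a

theorem muq_barMap_homotopic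
    (hφ : Homotopic (dsum (NonUnitalStarAlgHom.id ℂ (q A)) 0) ((mat2 (piMap (q A))).comp φ))
    (α : KTensor (q A) →⋆ₙₐ[ℂ] KTensor (q B)) :
    Homotopic (muq φ (barMap α)) (α.comp (Stab.corner 0)) :=
  muq_map_piMap_homotopic hφ _

theorem barMap_primeMap_homotopic
    (hφ : Homotopic (dsum (NonUnitalStarAlgHom.id ℂ (q A)) 0) ((mat2 (piMap (q A))).comp φ))
    (β : q A →⋆ₙₐ[ℂ] KTensor B) :
    Homotopic (barMap (primeMap φ β)) β := by
  rw [barMap, primeMap, NonUnitalStarAlgHom.comp_assoc, Stab.map_comp_corner]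
  exact ((flattenK_comp_corner_comp _).comp_left _).trans (map_piMap_comp_muq_homotopic hφ β)

theorem primeMap_barMap_homotopic
    (hφ : Homotopic (dsum (NonUnitalStarAlgHom.id ℂ (q A)) 0) ((mat2 (piMap (q A))).comp φ))
    (α : KTensor (q A) →⋆ₙₐ[ℂ] KTensor (q B)) :
    Homotopic (primeMap φ (barMap α)) α :=
  ((Stab.homotopic_map (muq_barMap_homotopic hφ α)).comp_left _).trans
    (flattenK_comp_map_comp_corner α)

/-- The factor `μ q(ᾱ) φ` of the product collapses to `α` on the corner, so the product with `ᾱ` is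
composition with `α`. -/
theorem sharp_barMap_homotopic
    (hφ : Homotopic (dsum (NonUnitalStarAlgHom.id ℂ (q A)) 0) ((mat2 (piMap (q A))).comp φ))
    (δ : q B →⋆ₙₐ[ℂ] KTensor C)
    (α : KTensor (q A) →⋆ₙₐ[ℂ] KTensor (q B)) :
    Homotopic (sharp φ δ (barMap α))
      ((flattenK C).comp ((Stab.map ℕ δ).comp (α.comp (Stab.corner 0)))) :=
  ((muq_barMap_homotopic hφ α).comp_left _).comp_left _

/-- It remains to move `id ⊗ π_C` past `flattenK` and to recover `β` from its restriction to the
corner. -/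
theorem barMap_comp_homotopic
    (hφ : Homotopic (dsum (NonUnitalStarAlgHom.id ℂ (q A)) 0) ((mat2 (piMap (q A))).comp φ))
    (α : KTensor (q A) →⋆ₙₐ[ℂ] KTensor (q B))
    (β : KTensor (q B) →⋆ₙₐ[ℂ] KTensor (q C)) :
    Homotopic (barMap (β.comp α)) (sharp φ (barMap β) (barMap α)) := by
  refine .symm ((sharp_barMap_homotopic hφ _ _).trans ?_)
  have h : (flattenK C).comp ((Stab.map ℕ (barMap β)).comp (α.comp (Stab.corner 0))) =
      (Stab.map ℕ (piMap C)).comp (((flattenK (q C)).comp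
        (Stab.map ℕ (β.comp (Stab.corner 0)))).comp (α.comp (Stab.corner 0))) := by
    rw [barMap, Stab.map_comp, NonUnitalStarAlgHom.comp_assoc, ← NonUnitalStarAlgHom.comp_assoc,
      flattenK_comp_map_map]
    rfl
  rw [h]
  exact ((flattenK_comp_map_comp_corner β).comp_right _).comp_left _

/-- Up to homotopy `α` and `β` are of the form `ā` and `b̄`. Then every product becomes a
composition, and both sides reduce to `γ` applied to the restriction of `b a` to the corner. -/
theorem sharp_assoc_homotopic
    (hφ : Homotopic (dsum (NonUnitalStarAlgHom.id ℂ (q A)) 0) ((mat2 (piMap (q A))).comp φ))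
    {φB : q B →⋆ₙₐ[ℂ] CStarMatrix (Fin 2) (Fin 2) (q (q B))}
    (hφB : Homotopic (dsum (NonUnitalStarAlgHom.id ℂ (q B)) 0) ((mat2 (piMap (q B))).comp φB))
    (α : q A →⋆ₙₐ[ℂ] KTensor B) (β : q B →⋆ₙₐ[ℂ] KTensor C) (γ : q C →⋆ₙₐ[ℂ] KTensor D) :
    Homotopic (sharp φ (sharp φB γ β) α) (sharp φ γ (sharp φ β α)) := by
  have hα : Homotopic α (barMap (primeMap φ α)) := (barMap_primeMap_homotopic hφ α).symm
  have hβ : Homotopic β (barMap (primeMap φB β)) := (barMap_primeMap_homotopic hφB β).symm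
  generalize primeMap φ α = a at hα
  generalize primeMap φB β = b at hβ
  have hl : Homotopic (sharp φ (sharp φB γ β) α)
      ((flattenK D).comp ((Stab.map ℕ γ).comp ((b.comp a).comp (Stab.corner 0)))) := by
    refine (Homotopic.sharp φ ((Homotopic.sharp φB (.refl γ) hβ).trans
      (sharp_barMap_homotopic hφB γ b)) hα).trans ?_
    refine (sharp_barMap_homotopic hφ _ a).trans ?_
    have := (flattenK_comp_map_comp_corner ((flattenK D).comp ((Stab.map ℕ γ).comp b))).comp_right
      (a.comp (Stab.corner 0))
    exact this
  have hr : Homotopic (sharp φ γ (sharp φ β α))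
      ((flattenK D).comp ((Stab.map ℕ γ).comp ((b.comp a).comp (Stab.corner 0)))) := by
    refine (Homotopic.sharp φ (.refl γ) ((Homotopic.sharp φ hβ hα).trans
      (barMap_comp_homotopic hφ a b).symm)).trans ?_
    exact sharp_barMap_homotopic hφ γ _
  exact hl.trans hr.symm

/-- The bijection `[K ⊗ qA, K ⊗ qB] ≃ KK(A, B)`. -/
theorem exists_classes_equiv
    (hφ : Homotopic (dsum (NonUnitalStarAlgHom.id ℂ (q A)) 0) ((mat2 (piMap (q A))).comp φ)) :
    ∃ Φ : HomotopyClasses (KTensor (q A)) (KTensor (q B)) ≃ KK A B,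
      (∀ α : KTensor (q A) →⋆ₙₐ[ℂ] KTensor (q B),
        Φ (homotopyClass α) = homotopyClass (barMap α)) ∧
      (∀ β : q A →⋆ₙₐ[ℂ] KTensor B,
        Φ.symm (homotopyClass β) = homotopyClass (primeMap φ β)) ∧
      ∀ α α' : KTensor (q A) →⋆ₙₐ[ℂ] KTensor (q B),
        Φ (homotopyClass (addHom α α')) = homotopyClass (addHom (barMap α) (barMap α')) := by
  refine ⟨⟨Quotient.map barMap fun _ _ h => Homotopic.barMap h,
    Quotient.map (primeMap φ) fun _ _ h => Homotopic.primeMap φ h, ?_, ?_⟩, fun _ => rfl,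
    fun _ => rfl, fun α α' => ?_⟩
  · rintro ⟨α⟩
    exact homotopyClass_eq_iff.2 (primeMap_barMap_homotopic hφ α)
  · rintro ⟨β⟩
    exact homotopyClass_eq_iff.2 (barMap_primeMap_homotopic hφ β)
  · change homotopyClass (barMap (addHom α α')) = _
    congr 1
    rw [barMap, addHom, NonUnitalStarAlgHom.comp_assoc, ← NonUnitalStarAlgHom.comp_assoc,
      ← absorb_comp_mat2_map, dsum_comp, NonUnitalStarAlgHom.comp_assoc, mat2_comp_dsum]
    rfl

end Product

theorem exists_product {A B C : Type*} [NonUnitalCStarAlgebra A] [NonUnitalCStarAlgebra B]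
    [NonUnitalCStarAlgebra C] (φ : q A →⋆ₙₐ[ℂ] CStarMatrix (Fin 2) (Fin 2) (q (q A))) :
    ∃ P : KK A B → KK B C → KK A C,
      ∀ (α : q A →⋆ₙₐ[ℂ] KTensor B) (β : q B →⋆ₙₐ[ℂ] KTensor C),
        P (homotopyClass α) (homotopyClass β) = homotopyClass (sharp φ β α) :=
  ⟨Quotient.map₂ (fun α β => sharp φ β α) fun _ _ h _ _ h' => Homotopic.sharp φ h' h,
    fun _ _ => rfl⟩

/-! ### Representations of ideals -/

open Filter in
-- Uniformly bounded operators are equicontinuous, so the Cauchy property passes to limits of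
-- vectors. The bound `C + 1` instead of `C` only keeps the denominator positive.
theorem isClosed_setOf_exists_tendsto {ι H : Type*} [NormedAddCommGroup H] [NormedSpace ℂ H]
    [CompleteSpace H] {l : Filter ι} [l.NeBot] (T : ι → H →L[ℂ] H) (C : ℝ)
    (hT : ∀ᶠ u in l, ‖T u‖ ≤ C) : IsClosed {ξ | ∃ y, Tendsto (fun u => T u ξ) l (𝓝 y)} := by
  refine isClosed_of_closure_subset fun ξ hξ => ?_
  have hC : 0 ≤ C := by
    obtain ⟨u, hu⟩ := hT.exists
    exact (norm_nonneg _).trans hu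
  refine cauchy_map_iff_exists_tendsto.1 (Metric.cauchy_iff.2 ⟨inferInstance, fun ε hε => ?_⟩)
  obtain ⟨ζ, ⟨y, hy⟩, hζ⟩ := Metric.mem_closure_iff.1 hξ (ε / 4 / (C + 1)) (by positivity)
  have h1 := (hy.eventually (Metric.ball_mem_nhds y (show (0 : ℝ) < ε / 4 by positivity))).and hT
  have key : ∀ u, dist (T u ζ) y < ε / 4 ∧ ‖T u‖ ≤ C → dist (T u ξ) y < ε / 2 := by
    rintro u ⟨hu, hu'⟩
    have h2 : dist (T u ξ) (T u ζ) ≤ ε / 4 := by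
      rw [dist_eq_norm, ← map_sub]
      refine (T u).le_of_opNorm_le hu' _ |>.trans ?_
      rw [dist_eq_norm, lt_div_iff₀ (by positivity)] at hζ
      nlinarith [norm_nonneg (ξ - ζ)]
    linarith [dist_triangle (T u ξ) (T u ζ) y]
  refine ⟨_, image_mem_map h1, ?_⟩
  rintro _ ⟨u, hu, rfl⟩ _ ⟨v, hv, rfl⟩
  have := dist_triangle_right (T u ξ) (T v ξ) y
  linarith [key u hu, key v hv]

open Filter in
theorem isClosed_setOf_tendsto_self {ι H : Type*} [NormedAddCommGroup H] [NormedSpace ℂ H]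
    {l : Filter ι} (T : ι → H →L[ℂ] H) (C : ℝ)
    (hT : ∀ᶠ u in l, ‖T u‖ ≤ C) : IsClosed {ξ | Tendsto (fun u => T u ξ) l (𝓝 ξ)} := by
  refine isClosed_of_closure_subset fun ξ hξ => Metric.tendsto_nhds.2 fun ε hε => ?_
  obtain ⟨ζ, hy, hζ⟩ := Metric.mem_closure_iff.1 hξ (ε / 4 / (|C| + 1)) (by positivity)
  filter_upwards [hT, hy.eventually (Metric.ball_mem_nhds ζ (show (0 : ℝ) < ε / 4 by positivity))]
    with u hu hu'
  have h0 : dist ξ ζ < ε / 4 :=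
    hζ.trans_le (div_le_self (by positivity) (by linarith [abs_nonneg C]))
  have h2 : dist (T u ξ) (T u ζ) ≤ ε / 4 := by
    rw [dist_eq_norm, ← map_sub]
    refine (T u).le_of_opNorm_le (hu.trans (le_abs_self C)) _ |>.trans ?_
    rw [dist_eq_norm, lt_div_iff₀ (by positivity)] at hζ
    nlinarith [norm_nonneg (ξ - ζ)]
  have h3 : dist (T u ζ) ζ < ε / 4 := hu'
  rw [dist_comm] at h0
  linarith [dist_triangle4 (T u ξ) (T u ζ) ζ ξ]

section Extension

open Filter

variable {I B H : Type*} [NonUnitalCStarAlgebra I] [NonUnitalCStarAlgebra B]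
  [NormedAddCommGroup H] [InnerProductSpace ℂ H] [CompleteSpace H]

/-- A representation of an ideal extends to the whole algebra. -/
theorem exists_extend_rep (i : I →⋆ₙₐ[ℂ] B) (hi : Function.Injective i)
    (hid : ∀ (b : B) (x : I), ∃ y, i y = b * i x) (π : I →⋆ₙₐ[ℂ] (H →L[ℂ] H)) :
    ∃ ρ : B →⋆ₙₐ[ℂ] (H →L[ℂ] H), ρ.comp i = π := by
  let _ := CStarAlgebra.spectralOrder I
  let _ := CStarAlgebra.spectralOrderedRing I
  have hl := CStarAlgebra.increasingApproximateUnit I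
  set l := CStarAlgebra.approximateUnit I
  have := hl.neBot
  -- Here `m b x` is the product `b x`, seen as an element of the ideal `I`.
  choose m hm using hid
  have hmn : ∀ b x, ‖m b x‖ ≤ ‖b‖ * ‖x‖ := fun b x => by
    rw [← NonUnitalStarAlgHom.norm_map i hi, hm, ← NonUnitalStarAlgHom.norm_map i hi x]
    exact norm_mul_le _ _
  have hm_add : ∀ b b' x, m (b + b') x = m b x + m b' x := fun b b' x => hi (by
    simp [hm, add_mul])
  have hm_smul : ∀ (c : ℂ) b x, m (c • b) x = c • m b x := fun c b x => hi (by
    simp [hm, smul_mul_assoc])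
  have hm_mul : ∀ b b' x, m (b * b') x = m b (m b' x) := fun b b' x => hi (by
    simp [hm, mul_assoc])
  have hm_r : ∀ b x y, m b (x * y) = m b x * y := fun b x y => hi (by
    simp [hm, mul_assoc])
  have hm_sub : ∀ b x y, m b (x - y) = m b x - m b y := fun b x y => hi (by
    simp [hm, mul_sub])
  have hm_i : ∀ z x, m (i z) x = z * x := fun z x => hi (by simp [hm])
  have hm_cont : ∀ b, Continuous (m b) := fun b => by
    refine LipschitzWith.continuous (K := ‖b‖₊) (LipschitzWith.of_dist_le_mul fun x y => ?_)
    rw [dist_eq_norm, dist_eq_norm, ← hm_sub]; exact hmn _ _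
  have hπc : Continuous π := hom_continuous π
  have hTn : ∀ b x, ‖π (m b x)‖ ≤ ‖b‖ * ‖x‖ := fun b x =>
    (NonUnitalStarAlgHom.norm_apply_le π _).trans (hmn b x)
  have hTb : ∀ b, ∀ᶠ u in l, ‖π (m b u)‖ ≤ ‖b‖ := fun b => by
    filter_upwards [hl.eventually_norm] with u hu
    exact (hTn b u).trans (mul_le_of_le_one_right (norm_nonneg _) hu)
  -- The operator `ρ b` is going to be the strong limit of `π(b u)` along an approximate unit. On
  -- the vectors `π(x) η` the limit is `π(b x) η`.
  have hTπ : ∀ b x η, Tendsto (fun u => π (m b u) (π x η)) l (𝓝 (π (m b x) η)) := fun b x η => by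
    have h1 : Tendsto (fun u => π (m b (u * x))) l (𝓝 (π (m b x))) :=
      ((hπc.comp (hm_cont b)).tendsto x).comp (hl.tendsto_mul_right x)
    have h2 := ((ContinuousLinearMap.apply ℂ H η).continuous.tendsto _).comp h1
    refine h2.congr fun u => ?_
    simp [hm_r]
  have hconv : ∀ b ξ, ∃ y, Tendsto (fun u => π (m b u) ξ) l (𝓝 y) := by
    intro b
    let D : Submodule ℂ H :=
      { carrier := {ξ | ∃ y, Tendsto (fun u => π (m b u) ξ) l (𝓝 y)}
        add_mem' := by
          rintro x y ⟨x', hx⟩ ⟨y', hy⟩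
          exact ⟨x' + y', by simpa using hx.add hy⟩
        zero_mem' := ⟨0, by simp⟩
        smul_mem' := by
          rintro c x ⟨x', hx⟩
          exact ⟨c • x', by simpa using hx.const_smul c⟩ }
    have hD : IsClosed (D : Set H) :=
      isClosed_setOf_exists_tendsto (fun u => π (m b u)) ‖b‖ (hTb b)
    let K : Submodule ℂ H := (Submodule.span ℂ {ζ | ∃ x η, π x η = ζ}).topologicalClosure
    have hK : K ≤ D := by
      refine Submodule.topologicalClosure_minimal _ (Submodule.span_le.2 ?_) hD
      rintro _ ⟨x, η, rfl⟩
      exact ⟨_, hTπ b x η⟩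
    -- On the orthogonal complement of `π(I) H` the representation vanishes, so the limit exists
    -- there too and is zero.
    have hK' : Kᗮ ≤ D := by
      intro ξ hξ
      have h0 : ∀ x, π x ξ = 0 := fun x => by
        refine ext_inner_left ℂ fun ζ => ?_
        rw [inner_zero_right, ← ContinuousLinearMap.adjoint_inner_left,
          ← ContinuousLinearMap.star_eq_adjoint, ← map_star]
        exact (Submodule.mem_orthogonal _ _).1 hξ _
          (Submodule.le_topologicalClosure _ (Submodule.subset_span ⟨star x, ζ, rfl⟩))
      exact ⟨0, by simp [h0]⟩
    have : CompleteSpace K := (Submodule.isClosed_topologicalClosure _).completeSpace_coe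
    have htop : K ⊔ Kᗮ = ⊤ := Submodule.sup_orthogonal_of_hasOrthogonalProjection
    intro ξ
    exact (sup_le hK hK') (htop ▸ Submodule.mem_top : ξ ∈ K ⊔ Kᗮ)
  choose P hP using hconv
  have hPn : ∀ b ξ, ‖P b ξ‖ ≤ ‖b‖ * ‖ξ‖ := fun b ξ => by
    refine le_of_tendsto (hP b ξ).norm ?_
    filter_upwards [hTb b] with u hu
    exact (π (m b u)).le_of_opNorm_le hu ξ
  let ρ : B → H →L[ℂ] H := fun b => LinearMap.mkContinuous
    { toFun := P b
      map_add' := fun x y => tendsto_nhds_unique (hP b _) (by simpa using (hP b x).add (hP b y))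
      map_smul' := fun c x => tendsto_nhds_unique (hP b _) (by simpa using (hP b x).const_smul c) }
    ‖b‖ (hPn b)
  have hρ : ∀ b ξ, Tendsto (fun u => π (m b u) ξ) l (𝓝 (ρ b ξ)) := hP
  have hρπ : ∀ b x η, ρ b (π x η) = π (m b x) η := fun b x η =>
    tendsto_nhds_unique (hρ b _) (hTπ b x η)
  -- The element `star (m (star b) (star x))` is the product `x b`, so the claim is `π(x) ρ(b) = π(x
  -- b)`.
  have hleft : ∀ b x η, π x (ρ b η) = π (star (m (star b) (star x))) η := fun b x η => by
    have h1 := ((π x).continuous.tendsto _).comp (hρ b η)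
    have h2 : Tendsto (fun u => π (star (m (star b) (star x)) * u)) l
        (𝓝 (π (star (m (star b) (star x))))) := (hπc.tendsto _).comp (hl.tendsto_mul_left _)
    have h3 := ((ContinuousLinearMap.apply ℂ H η).continuous.tendsto _).comp h2
    refine tendsto_nhds_unique h1 (h3.congr fun u => ?_)
    have : star (m (star b) (star x)) * u = x * m b u := hi (by
      simp [hm, map_star, mul_assoc])
    rw [Function.comp_apply, Function.comp_apply, this, map_mul]
    rfl
  have hπu : ∀ ζ, ζ ∈ closure {ζ | ∃ x η, π x η = ζ} → Tendsto (fun u => π u ζ) l (𝓝 ζ) := by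
    intro ζ hζ
    refine closure_minimal ?_ (isClosed_setOf_tendsto_self (fun u => π u) 1 ?_) hζ
    · rintro _ ⟨x, η, rfl⟩
      have h1 : Tendsto (fun u => π (u * x)) l (𝓝 (π x)) :=
        (hπc.tendsto x).comp (hl.tendsto_mul_right x)
      exact (((ContinuousLinearMap.apply ℂ H η).continuous.tendsto _).comp h1).congr fun u => by
        simp
    · filter_upwards [hl.eventually_norm] with u hu
      exact (NonUnitalStarAlgHom.norm_apply_le π u).trans hu
  have hρcl : ∀ b η, ρ b η ∈ closure {ζ | ∃ x η, π x η = ζ} := fun b η =>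
    mem_closure_of_tendsto (hρ b η) (Eventually.of_forall fun u => ⟨_, _, rfl⟩)
  -- The range of `ρ b` lies in the closure of `π(I) H`, where `π(u)` tends to the identity. So both
  -- sides are limits of one net, because `π(u) ρ(b) = π(u b)` is the adjoint of `π(b* u)` for
  -- self-adjoint `u`.
  have hstar : ∀ b ξ η, inner ℂ (ρ (star b) ξ) η = inner ℂ ξ (ρ b η) := by
    intro b ξ η
    have h1 : Tendsto (fun u => inner ℂ (π (m (star b) u) ξ) η) l (𝓝 (inner ℂ (ρ (star b) ξ) η)) :=
      (hρ (star b) ξ).inner tendsto_const_nhds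
    have h2 : Tendsto (fun u => inner ℂ ξ (π u (ρ b η))) l (𝓝 (inner ℂ ξ (ρ b η))) :=
      tendsto_const_nhds.inner (hπu _ (hρcl b η))
    refine tendsto_nhds_unique h1 (h2.congr' ?_)
    filter_upwards [hl.eventually_star_eq] with u hu
    rw [hleft, hu, map_star, ContinuousLinearMap.star_eq_adjoint,
      ContinuousLinearMap.adjoint_inner_right]
  refine ⟨{ toFun := ρ, map_smul' := fun c b => ?_, map_zero' := ?_, map_add' := fun b b' => ?_,
            map_mul' := fun b b' => ?_, map_star' := fun b => ?_ }, ?_⟩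
  · ext ξ
    exact tendsto_nhds_unique (hρ _ ξ) (by simpa [hm_smul] using (hρ b ξ).const_smul c)
  · ext ξ
    exact norm_le_zero_iff.1 ((hPn 0 ξ).trans (by simp))
  · ext ξ
    exact tendsto_nhds_unique (hρ _ ξ) (by simpa [hm_add] using (hρ b ξ).add (hρ b' ξ))
  · ext ξ
    refine tendsto_nhds_unique (hρ _ ξ) ?_
    have := ((ρ b).continuous.tendsto _).comp (hρ b' ξ)
    refine this.congr fun u => ?_
    simp [hm_mul, hρπ]
  · exact (ContinuousLinearMap.eq_adjoint_iff _ _).2 fun ξ η => hstar b ξ η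
  · refine DFunLike.ext _ _ fun x => ContinuousLinearMap.ext fun ξ => ?_
    refine tendsto_nhds_unique (hρ (i x) ξ) ?_
    have h1 : Tendsto (fun u => π (x * u)) l (𝓝 (π x)) :=
        (hπc.tendsto x).comp (hl.tendsto_mul_left x)
    refine (((ContinuousLinearMap.apply ℂ H ξ).continuous.tendsto _).comp h1).congr fun u => ?_
    simp [hm_i]

end Extension

-- Enough representations: Hahn–Banach and GNS

universe u

/-- A nonzero element of a C*-algebra is detected by a GNS representation. -/
theorem exists_rep_ne_zero {E : Type u} [NonUnitalCStarAlgebra E] {y : E} (hy : y ≠ 0) :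
    ∃ (H : Type u) (_ : NormedAddCommGroup H) (_ : InnerProductSpace ℂ H) (_ : CompleteSpace H)
      (π : E →⋆ₙₐ[ℂ] (H →L[ℂ] H)), π y ≠ 0 := by
  let _ := CStarAlgebra.spectralOrder E
  let _ := CStarAlgebra.spectralOrderedRing E
  -- Without a unit the vector of `y*` serves as test vector: `π(y)` sends it to the vector of `a =
  -- y y*`, whose squared norm is `F(a* a)`. So a positive functional with `F(a* a) ≠ 0` is wanted,
  -- and it is found by separating `-a* a` from the closed cone of positive elements.
  set a : E := y * star y
  have ha0 : a ≠ 0 := fun h => hy (CStarRing.mul_star_self_eq_zero_iff y |>.1 h)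
  have hasa : star a = a := by simp [a]
  have hb0 : star a * a ≠ 0 := fun h => ha0 (CStarRing.star_mul_self_eq_zero_iff a |>.1 h)
  have hbnn : 0 ≤ star a * a := star_mul_self_nonneg a
  have hneg : -(star a * a) ∉ {x : E | 0 ≤ x} := fun h =>
    hb0 (le_antisymm (neg_nonneg.1 h) hbnn)
  obtain ⟨f, c, hfc, hf⟩ := RCLike.geometric_hahn_banach_point_closed (𝕜 := ℂ)
    (t := {x : E | 0 ≤ x})
    (fun x hx z hz s t hs ht _ => show 0 ≤ s • x + t • z from
      add_nonneg (smul_nonneg hs hx) (smul_nonneg ht hz))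
    CStarAlgebra.isClosed_nonneg hneg
  have hc0 : c < 0 := by simpa using hf 0 (show (0 : E) ≤ 0 from le_rfl)
  -- If `Re f` were negative at `x ≥ 0`, a positive multiple of `x` would give exactly the
  -- separating value `c`, which is excluded on the cone.
  have hpos : ∀ x : E, 0 ≤ x → 0 ≤ (f x).re := fun x hx => by
    by_contra hlt
    push Not at hlt
    have h1 := hf ((c / (f x).re) • x) (smul_nonneg (div_nonneg_of_nonpos hc0.le hlt.le) hx)
    rw [show f ((c / (f x).re) • x) = ((c / (f x).re : ℝ) : ℂ) * f x by
      rw [← smul_eq_mul, ← map_smul]; simp] at h1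
    simp only [RCLike.re_to_complex, Complex.re_ofReal_mul] at h1
    rw [div_mul_cancel₀ _ hlt.ne] at h1
    exact lt_irrefl _ h1
  -- The real part of `f` is not complex linear; the symmetrization is, and on positive elements it
  -- equals `2 Re f`.
  let g : E →ₗ[ℂ] ℂ :=
    { toFun := fun x => f x + starRingEnd ℂ (f (star x))
      map_add' := fun x z => by simp only [star_add, map_add]; ring
      map_smul' := fun s x => by simp [mul_add] }
  have hg : ∀ x, 0 ≤ x → g x = ((2 * (f x).re : ℝ) : ℂ) := fun x hx => by
    change f x + starRingEnd ℂ (f (star x)) = _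
    rw [(IsSelfAdjoint.of_nonneg hx).star_eq, Complex.add_conj]
  open scoped ComplexOrder in
  let F : E →ₚ[ℂ] ℂ := PositiveLinearMap.mk₀ g fun x hx => by
    rw [hg x hx]
    exact_mod_cast mul_nonneg zero_le_two (hpos x hx)
  have hFa : F (star a * a) ≠ 0 := by
    change g (star a * a) ≠ 0
    rw [hg _ hbnn]
    have : 0 < (f (star a * a)).re := by
      have := hfc.trans hc0
      simp only [map_neg, RCLike.re_to_complex] at this
      linarith
    exact_mod_cast (mul_pos two_pos this).ne'
  refine ⟨F.GNS, inferInstance, inferInstance, inferInstance, F.gnsNonUnitalStarAlgHom, fun h => ?_⟩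
  have h1 : F.gnsNonUnitalStarAlgHom y (F.toPreGNS (star y)) = 0 := by rw [h]; rfl
  rw [PositiveLinearMap.gnsNonUnitalStarAlgHom_apply_coe] at h1
  have h2 : ‖F.toPreGNS a‖ = 0 := by
    rw [← UniformSpace.Completion.norm_coe]
    exact norm_eq_zero.2 h1
  apply hFa
  have h3 := F.preGNS_norm_sq (F.toPreGNS a)
  rw [h2] at h3
  simpa using h3.symm

/-! ### The embedding of `Q(qA)` in `Q(QA)` -/

section

variable (A : Type*) [NonUnitalCStarAlgebra A]

theorem exists_qIncl_eq_mul (y : Q A) (z : q A) : ∃ w, qIncl A w = y * qIncl A z :=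
  mem_range_qIncl_iff.2 (by rw [map_mul, fold_qIncl, mul_zero])

/-- A representation of `Q(qA)` is a pair of representations of `qA` on the same space. Since `qA`
is an ideal of `QA`, both extend to `QA`, and the pair of extensions is a representation of `Q(QA)`.
Thus all representations of `Q(qA)` factor through `Q(QA)`, and they separate points. -/
theorem QMap_qIncl_injective : Function.Injective (QMap (qIncl A)) := by
  rw [injective_iff_map_eq_zero]
  intro y hy
  by_contra hne
  obtain ⟨H, _, _, _, π, hπ⟩ := exists_rep_ne_zero hne
  obtain ⟨ρ, hρ⟩ := exists_extend_rep (qIncl A) qIncl_injective (exists_qIncl_eq_mul A)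
    (π.comp (iota (q A)))
  obtain ⟨ρ', hρ'⟩ := exists_extend_rep (qIncl A) qIncl_injective (exists_qIncl_eq_mul A)
    (π.comp (iotaBar (q A)))
  have h : (FreeProd.lift ρ ρ').comp (QMap (qIncl A)) = π := by
    refine Q_hom_ext ?_ ?_
    · intro x
      have := DFunLike.congr_fun hρ x
      simpa using this
    · intro x
      have := DFunLike.congr_fun hρ' x
      simpa using this
  apply hπ
  rw [← h, NonUnitalStarAlgHom.comp_apply, hy, map_zero]

theorem q2Incl_injective : Function.Injective (q2Incl A) :=
  (QMap_qIncl_injective A).comp (qIncl_injective)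

end

/-! ### Multipliers and pairs of homomorphisms -/

@[elab_as_elim]
theorem Q_induction {A : Type*} [NonUnitalCStarAlgebra A] {P : Q A → Prop} (y : Q A)
    (hc : IsClosed {y | P y}) (h0 : P 0) (ha : ∀ x y, P x → P y → P (x + y))
    (hs : ∀ (c : ℂ) x, P x → P (c • x)) (hm : ∀ x y, P x → P y → P (x * y))
    (hi : ∀ a, P (iota A a)) (hi' : ∀ a, P (iotaBar A a)) : P y := by
  refine CStarSeminorm.Compl.ind (p := freeProdSeminorm A A) y hc fun x => ?_
  change P (FreeProd.ofWord A A x)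
  refine WordAlg.ind_letter x ?_ ?_ ?_ ?_ ?_
  · rw [map_zero]; exact h0
  · intro x y hx hy; rw [map_add]; exact ha _ _ hx hy
  · intro c x hx; rw [map_smul]; exact hs _ _ hx
  · intro x y hx hy; rw [map_mul]; exact hm _ _ hx hy
  · rintro (a | b)
    · exact hi a
    · exact hi' b

namespace DoubleCentralizer

variable {E : Type*} [NonUnitalCStarAlgebra E]

theorem coeHom_fst_apply (r s : E) : (coeHom (𝕜 := ℂ) r).fst s = r * s := rfl

/-- The norm of a multiplier is the norm of its left multiplication. -/
theorem ext_fst {m n : DoubleCentralizer ℂ E} (h : ∀ r, m.fst r = n.fst r) : m = n := by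
  rw [← sub_eq_zero, ← norm_eq_zero, ← norm_fst, norm_eq_zero, sub_fst, sub_eq_zero]
  exact ContinuousLinearMap.ext h

theorem coeHom_injective : Function.Injective (coeHom : E →⋆ₙₐ[ℂ] DoubleCentralizer ℂ E) := by
  rw [injective_iff_map_eq_zero]
  intro r hr
  have : r * star r = 0 := by rw [← coeHom_fst_apply r (star r), hr]; rfl
  exact CStarRing.mul_star_self_eq_zero_iff r |>.1 this

theorem mul_coeHom (m : DoubleCentralizer ℂ E) (r : E) :
    m * coeHom r = coeHom (m.fst r) := by
  refine ext_fst fun s => ?_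
  change m.fst (r * s) = m.fst r * s
  -- Centrality moves `m` to the left factor, `t (m y) = (t m) y`, so any `t` annihilates the
  -- difference; in particular its adjoint does.
  rw [← sub_eq_zero, ← CStarRing.star_mul_self_eq_zero_iff]
  set t := star (m.fst (r * s) - m.fst r * s)
  rw [mul_sub, ← mul_assoc, ← m.central, ← m.central, mul_assoc, sub_self]

theorem coeHom_mul (m : DoubleCentralizer ℂ E) (r : E) :
    coeHom r * m = coeHom (m.snd r) := by
  refine ext_fst fun s => ?_
  exact (m.central r s).symm

theorem fst_mul (m : DoubleCentralizer ℂ E) (r s : E) : m.fst (r * s) = m.fst r * s :=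
  DFunLike.congr_fun (congrArg (fun n => n.fst) (mul_coeHom m r)) s

theorem continuous_fst_apply (r : E) : Continuous fun m : DoubleCentralizer ℂ E => m.fst r := by
  refine LipschitzWith.continuous (K := ‖r‖₊) (LipschitzWith.of_dist_le_mul fun m n => ?_)
  rw [dist_eq_norm, dist_eq_norm, mul_comm, ← norm_fst (m - n), ← sub_apply]
  exact (m - n).fst.le_opNorm r

/-- Evaluation of multipliers at an element. -/
def evalL (r : E) : DoubleCentralizer ℂ E →L[ℂ] E :=
  ⟨{ toFun := fun m => m.fst r, map_add' := fun _ _ => rfl, map_smul' := fun _ _ => rfl },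
    continuous_fst_apply r⟩

/-- The range of the embedding of an algebra in its multiplier algebra. -/
abbrev IsInner (m : DoubleCentralizer ℂ E) : Prop :=
  m ∈ Set.range (coeHom : E →⋆ₙₐ[ℂ] DoubleCentralizer ℂ E)

theorem isClosed_inner : IsClosed {m : DoubleCentralizer ℂ E | IsInner m} :=
  isClosed_range_of_injective coeHom_injective

variable {m n : DoubleCentralizer ℂ E}

theorem IsInner.mul_left (h : IsInner m) (n : DoubleCentralizer ℂ E) : IsInner (n * m) := by
  obtain ⟨r, rfl⟩ := h
  exact ⟨_, (mul_coeHom n r).symm⟩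

theorem IsInner.mul_right (h : IsInner m) (n : DoubleCentralizer ℂ E) : IsInner (m * n) := by
  obtain ⟨r, rfl⟩ := h
  exact ⟨_, (coeHom_mul n r).symm⟩

theorem IsInner.zero : IsInner (0 : DoubleCentralizer ℂ E) := ⟨0, map_zero _⟩

theorem IsInner.add (h : IsInner m) (h' : IsInner n) : IsInner (m + n) := by
  obtain ⟨r, rfl⟩ := h
  obtain ⟨s, rfl⟩ := h'
  exact ⟨r + s, map_add _ _ _⟩

theorem IsInner.smul (h : IsInner m) (c : ℂ) : IsInner (c • m) := by
  obtain ⟨r, rfl⟩ := h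
  exact ⟨c • r, map_smul _ _ _⟩

/-- The multipliers that commute with `x` modulo the closed ideal `E` form a closed subalgebra,
which contains the exponential of each of its elements. -/
theorem inner_commutator_exp {x S : DoubleCentralizer ℂ E} (h : IsInner (S * x - x * S)) :
    IsInner (NormedSpace.exp S * x - x * NormedSpace.exp S) := by
  let s : Subalgebra ℂ (DoubleCentralizer ℂ E) :=
    { carrier := {m | IsInner (m * x - x * m)}
      mul_mem' := fun {a b} ha hb => by
        have : a * b * x - x * (a * b) = a * (b * x - x * b) + (a * x - x * a) * b := by
          noncomm_ring
        rw [Set.mem_ofPred_eq, this]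
        exact (hb.mul_left a).add (ha.mul_right b)
      add_mem' := fun {a b} ha hb => by
        have : (a + b) * x - x * (a + b) = (a * x - x * a) + (b * x - x * b) := by
          noncomm_ring
        rw [Set.mem_ofPred_eq, this]
        exact ha.add hb
      algebraMap_mem' := fun c => by
        rw [Set.mem_ofPred_eq, Algebra.commutes, sub_self]
        exact IsInner.zero }
  have hs : IsClosed (s : Set (DoubleCentralizer ℂ E)) :=
    isClosed_inner.preimage ((continuous_id.mul continuous_const).sub
      (continuous_const.mul continuous_id))
  let _ : Algebra ℚ (DoubleCentralizer ℂ E) := Algebra.compHom _ (algebraMap ℚ ℂ)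
  have : IsScalarTower ℚ ℂ (DoubleCentralizer ℂ E) := ⟨fun a b x => by
    rw [Algebra.smul_def a b, mul_smul]; rfl⟩
  exact NormedSpace.exp_mem (R := ℂ) hs (show S ∈ s from h)

/-- Under `ψ` the multiplier `x` becomes `c L` with `L² = 1`. On the eigenspaces of `L`, reached by
`(v ± L v)/2`, the powers of `x` act as `cⁿ` and `(-c)ⁿ`, and the exponential series adds up to
`cosh c + sinh c L`. -/
theorem apply_exp_fst {V : Type*} [NormedAddCommGroup V] [NormedSpace ℂ V] (ψ : E →L[ℂ] V)
    (L : V →L[ℂ] V) (hL : ∀ v, L (L v) = v) {x : DoubleCentralizer ℂ E} {c : ℂ}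
    (h : ∀ r, ψ (x.fst r) = c • L (ψ r)) (r : E) :
    ψ ((NormedSpace.exp x).fst r) =
      Complex.cosh c • ψ r + Complex.sinh c • L (ψ r) := by
  have hp : ∀ n : ℕ, ψ ((x ^ n).fst r) =
      c ^ n • ((1 / 2 : ℂ) • (ψ r + L (ψ r))) + (-c) ^ n • ((1 / 2 : ℂ) • (ψ r - L (ψ r))) := by
    intro n
    induction n with
    | zero =>
      change ψ r = _
      module
    | succ n ih =>
      rw [pow_succ', mul_fst]
      change ψ (x.fst ((x ^ n).fst r)) = _
      rw [h, ih]
      simp only [map_add, map_smul, map_sub, hL]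
      module
  have h1 : HasSum (fun n : ℕ => ((n.factorial : ℂ)⁻¹) • x ^ n) (NormedSpace.exp x) :=
    NormedSpace.exp_series_hasSum_exp' x
  have h2 := (ψ.comp (evalL r)).hasSum h1
  have h3 : ∀ d : ℂ, HasSum (fun n : ℕ => ((n.factorial : ℂ)⁻¹) • d ^ n) (Complex.exp d) :=
    fun d => by rw [Complex.exp_eq_exp_ℂ]; exact NormedSpace.exp_series_hasSum_exp' d
  have h4 := ((h3 c).smul_const ((1 / 2 : ℂ) • (ψ r + L (ψ r)))).add
    ((h3 (-c)).smul_const ((1 / 2 : ℂ) • (ψ r - L (ψ r))))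
  have h5 := h2.unique (h4.congr_fun fun n => ?_)
  · refine h5.trans ?_
    rw [Complex.cosh, Complex.sinh]
    module
  · rw [map_smul]
    change ((n.factorial : ℂ)⁻¹) • ψ ((x ^ n).fst r) = _
    rw [hp]
    simp only [smul_eq_mul]
    module

end DoubleCentralizer

/-! ### Homomorphisms from `QA` to multiplier algebras -/

section Acts

open DoubleCentralizer

variable {A E Y Z : Type*} [NonUnitalCStarAlgebra A] [NonUnitalCStarAlgebra E]
  [NonUnitalCStarAlgebra Y] [NonUnitalCStarAlgebra Z]

/-- The multiplier `m` of `E` induces the left multiplication by `k` on the image of `ψ`. -/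
def Acts (ψ : E →⋆ₙₐ[ℂ] Y) (m : DoubleCentralizer ℂ E) (k : Y) : Prop :=
  ∀ r, ψ (m.fst r) = k * ψ r

theorem Acts.apply_Q {ψ : E →⋆ₙₐ[ℂ] Y} {f : Q A →⋆ₙₐ[ℂ] DoubleCentralizer ℂ E}
    {k : Q A →⋆ₙₐ[ℂ] Y} (h : ∀ a, Acts ψ (f (iota A a)) (k (iota A a)))
    (h' : ∀ a, Acts ψ (f (iotaBar A a)) (k (iotaBar A a))) (y : Q A) : Acts ψ (f y) (k y) := by
  induction y using Q_induction with
  | hc =>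
    simp only [Acts, Set.ofPred_forall]
    exact isClosed_iInter fun r => isClosed_eq
      ((hom_continuous ψ).comp ((continuous_fst_apply r).comp (hom_continuous f)))
      ((hom_continuous k).mul continuous_const)
  | h0 => intro r; rw [map_zero, map_zero, zero_mul]; exact map_zero ψ
  | ha x y hx hy =>
    intro r
    rw [map_add, map_add, add_mul, ← hx, ← hy]; exact map_add ψ _ _
  | hs c x hx =>
    intro r
    rw [map_smul, map_smul, smul_mul_assoc, ← hx]; exact map_smul ψ _ _
  | hm x y hx hy =>
    intro r
    rw [map_mul, map_mul, mul_assoc, ← hy, ← hx]; rfl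
  | hi a => exact h a
  | hi' a => exact h' a

theorem adExp_apply {M : Type*} [CStarAlgebra M] (S : selfAdjoint M) (m : M) :
    adExp S m = (selfAdjoint.expUnitary ((Real.pi / 2) • S) : M) * m *
      star (selfAdjoint.expUnitary ((Real.pi / 2) • S) : M) := rfl

theorem Acts.adExp {ψ : E →⋆ₙₐ[ℂ] Y} (s : Symmetry Y) {S : selfAdjoint (DoubleCentralizer ℂ E)}
    {t : ℝ} (hS : ∀ r, ψ ((S : DoubleCentralizer ℂ E).fst r) = (t : ℂ) • s.L (ψ r))
    {m : DoubleCentralizer ℂ E} {k : Y} (h : Acts ψ m k) :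
    Acts ψ (_root_.adExp S m) (s.conj t k) := by
  set F : DoubleCentralizer ℂ E := (selfAdjoint.expUnitary ((Real.pi / 2) • S) :
    DoubleCentralizer ℂ E) with hF
  have hFu : F * star F = 1 := (selfAdjoint.expUnitary ((Real.pi / 2) • S)).2.2
  have hF' : F = NormedSpace.exp ((Complex.I * (Real.pi / 2 : ℝ)) •
      (S : DoubleCentralizer ℂ E)) := by
    rw [hF, selfAdjoint.expUnitary_coe, mul_smul]
    rfl
  have hl : ∀ r, ψ (F.fst r) = s.left t (ψ r) := fun r => by
    have := apply_exp_fst (ψ := (⟨(ψ : E →ₗ[ℂ] Y), hom_continuous ψ⟩ : E →L[ℂ] Y)) s.L s.L_L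
      (x := (Complex.I * (Real.pi / 2 : ℝ)) • (S : DoubleCentralizer ℂ E))
      (c := ((Real.pi / 2 * t : ℝ) : ℂ) * Complex.I) (fun r => ?_) r
    · rw [← hF', Complex.cosh_mul_I, Complex.sinh_mul_I, ← Complex.ofReal_cos,
        ← Complex.ofReal_sin] at this
      exact this
    · change ψ ((Complex.I * (Real.pi / 2 : ℝ)) • (S : DoubleCentralizer ℂ E).fst r) =
        _ • s.L (ψ r)
      rw [map_smul, hS, smul_smul]
      congr 1
      push_cast
      ring
  intro r
  -- Only left multiplications are visible through `ψ`. Writing `r = F (F* r)` allows the factor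
  -- `u*` of `u k u*` to be moved onto `k`, because `u ψ(F* r) = ψ(r)`.
  have hr : r = F.fst ((star F).fst r) := by
    change r = (F * star F).fst r
    rw [hFu]; rfl
  have h1 : ψ ((_root_.adExp S m).fst r) = s.left t (k * ψ ((star F).fst r)) := by
    rw [adExp_apply, ← hF]
    change ψ (F.fst (m.fst ((star F).fst r))) = _
    rw [hl, h]
  rw [h1, ← s.right_mul_left t, s.left_mul, ← hl, ← hr]
  rfl

/-- The homomorphisms `f` and `f ι fold` agree on the first copy of `A` and modulo the closed ideal
`I` on the second one; as the two copies generate `QA`, they agree modulo `I` everywhere. -/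
theorem sub_iota_fold_mem {Z : Type*} [NonUnitalCStarAlgebra Z] (f : Q A →⋆ₙₐ[ℂ] Z) {I : Set Z}
    (hc : IsClosed I) (h0 : (0 : Z) ∈ I) (ha : ∀ x ∈ I, ∀ y ∈ I, x + y ∈ I)
    (hs : ∀ (c : ℂ), ∀ x ∈ I, c • x ∈ I) (hl : ∀ y, ∀ x ∈ I, y * x ∈ I)
    (hr : ∀ y, ∀ x ∈ I, x * y ∈ I) (h : ∀ a, f (iotaBar A a) - f (iota A a) ∈ I) (y : Q A) :
    f y - f (iota A (fold A y)) ∈ I := by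
  induction y using Q_induction with
  | hc => exact hc.preimage ((hom_continuous f).sub
      ((hom_continuous f).comp ((hom_continuous _).comp (hom_continuous _))))
  | h0 => simpa using h0
  | ha x y hx hy =>
    have := ha _ hx _ hy
    simp only [map_add]
    convert this using 1
    abel
  | hs c x hx =>
    have := hs c _ hx
    simpa only [map_smul, smul_sub] using this
  | hm x y hx hy =>
    have := ha _ (hr (f y) _ hx) _ (hl (f (iota A (fold A x))) _ hy)
    simp only [map_mul]
    convert this using 1
    rw [sub_mul, mul_sub]
    abel
  | hi a => simpa using h0
  | hi' a => simpa using h a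

/-- A homomorphism on `QA` whose two components agree modulo `E` maps `qA` to `E`. -/
theorem inner_apply_qIncl {f : Q A →⋆ₙₐ[ℂ] DoubleCentralizer ℂ E}
    (h : ∀ a, IsInner (f (iotaBar A a) - f (iota A a))) (z : q A) : IsInner (f (qIncl A z)) := by
  have := sub_iota_fold_mem f (I := {m | IsInner m}) isClosed_inner IsInner.zero
    (fun _ hx _ hy => IsInner.add hx hy) (fun c _ hx => IsInner.smul hx c)
    (fun y _ hx => IsInner.mul_left hx y) (fun y _ hx => IsInner.mul_right hx y) h (qIncl A z)
  rw [fold_qIncl, map_zero, map_zero, sub_zero] at this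
  exact this

end Acts

/-! ### The algebra `R` -/

open DoubleCentralizer

section AlgR

variable (A : Type*) [NonUnitalCStarAlgebra A]

/-- The inclusion of `R` in `M₂(Q²A)`. -/
def inclR : R A →⋆ₙₐ[ℂ] CStarMatrix (Fin 2) (Fin 2) (Q (Q A)) :=
  NonUnitalStarSubalgebraClass.subtype (R A)

theorem inclR_apply (r : R A) : inclR A r = (r : CStarMatrix (Fin 2) (Fin 2) (Q (Q A))) := rfl

theorem inclR_injective : Function.Injective (inclR A) := Subtype.val_injective

/-- The map `R → M₂(QA)` that identifies the two copies of `QA` in `Q²A`. -/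
def foldRHom : R A →⋆ₙₐ[ℂ] CStarMatrix (Fin 2) (Fin 2) (Q A) := (mat2 (fold (Q A))).comp (inclR A)

theorem foldRHom_apply (r : R A) : foldRHom A r = foldR r := rfl

variable {A}

theorem mem_R_of_RGen {m : CStarMatrix (Fin 2) (Fin 2) (Q (Q A))} (hm : RGen A m) : m ∈ R A :=
  NonUnitalStarSubalgebra.le_topologicalClosure _ (NonUnitalStarAlgebra.subset_adjoin ℂ _ hm)

theorem R_le {s : NonUnitalStarSubalgebra ℂ (CStarMatrix (Fin 2) (Fin 2) (Q (Q A)))}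
    (hs : IsClosed (s : Set (CStarMatrix (Fin 2) (Fin 2) (Q (Q A)))))
    (h : ∀ m, RGen A m → m ∈ s) : R A ≤ s :=
  NonUnitalStarSubalgebra.topologicalClosure_minimal _ (NonUnitalStarAlgebra.adjoin_le h) hs

theorem matUnit_mem_range {X Y : Type*} [NonUnitalCStarAlgebra X] [NonUnitalCStarAlgebra Y]
    {f : X →⋆ₙₐ[ℂ] Y} (i j : Fin 2) {y : Y} (hy : y ∈ Set.range f) :
    matUnit i j y ∈ Set.range (mat2 f) := by
  refine mem_range_mat2_iff.2 fun k l => ?_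
  by_cases h : i = k ∧ j = l
  · rw [show matUnit i j y k l = y by simp [matUnit, Matrix.single, h]]; exact hy
  · rw [show matUnit i j y k l = 0 by simp [matUnit, Matrix.single, h]]; exact ⟨0, map_zero f⟩

theorem inclR_mem_range (r : R A) : inclR A r ∈ Set.range (mat2 (QMap (qIncl A))) := by
  refine R_le (s := NonUnitalStarAlgHom.range (mat2 (QMap (qIncl A))))
    (isClosed_range_of_injective (mat2_injective (QMap_qIncl_injective A))) ?_ r.2
  have h1 : ∀ z : q A, eta A (qIncl A z) ∈ Set.range (QMap (qIncl A)) :=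
    fun z => ⟨iota _ z, QMap_iota _ z⟩
  have h2 : ∀ z : q A, etaBar A (qIncl A z) ∈ Set.range (QMap (qIncl A)) :=
    fun z => ⟨iotaBar _ z, QMap_iotaBar _ z⟩
  have h3 : ∀ x y, x ∈ Set.range (QMap (qIncl A)) → y ∈ Set.range (QMap (qIncl A)) →
      x * y ∈ Set.range (QMap (qIncl A)) := by
    rintro _ _ ⟨x, rfl⟩ ⟨y, rfl⟩
    exact ⟨x * y, map_mul _ _ _⟩
  rintro m (⟨z, rfl⟩ | ⟨z, w, rfl⟩ | ⟨z, w, rfl⟩ | ⟨z, rfl⟩)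
  · exact matUnit_mem_range _ _ (h1 z)
  · exact matUnit_mem_range _ _ (h3 _ _ (h1 z) (h2 w))
  · exact matUnit_mem_range _ _ (h3 _ _ (h2 z) (h1 w))
  · exact matUnit_mem_range _ _ (h2 z)

variable (A) in
/-- The inclusion of `R` in `M₂(Q(qA))`. -/
def toQq : R A →⋆ₙₐ[ℂ] CStarMatrix (Fin 2) (Fin 2) (Q (q A)) :=
  factorThrough (mat2 (QMap (qIncl A))) (mat2_injective (QMap_qIncl_injective A)) (inclR A)
    inclR_mem_range

theorem mat2_QMap_toQq (r : R A) : mat2 (QMap (qIncl A)) (toQq A r) = inclR A r :=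
  apply_factorThrough _ _ _ _ r

theorem fold_comp_QMap {X Y : Type*} [NonUnitalCStarAlgebra X] [NonUnitalCStarAlgebra Y]
    (f : X →⋆ₙₐ[ℂ] Y) : (fold Y).comp (QMap f) = f.comp (fold X) :=
  NonUnitalStarAlgHom.ext (fold_QMap f)

theorem evalQ_comp_QMap {X Y : Type*} [NonUnitalCStarAlgebra X] [NonUnitalCStarAlgebra Y]
    (f : X →⋆ₙₐ[ℂ] Y) : (evalQ Y).comp (QMap f) = f.comp (evalQ X) :=
  Q_hom_ext (fun a => by simp) fun a => by simp

theorem foldRHom_eq (r : R A) :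
    foldRHom A r = mat2 (qIncl A) (mat2 (fold (q A)) (toQq A r)) := by
  have h : (mat2 (fold (Q A))).comp (mat2 (QMap (qIncl A))) =
      (mat2 (qIncl A)).comp (mat2 (fold (q A))) := by
    rw [← mat2_comp, fold_comp_QMap, mat2_comp]
  rw [foldRHom, NonUnitalStarAlgHom.comp_apply, ← mat2_QMap_toQq]
  exact DFunLike.congr_fun h _

theorem mat2_evalQ_inclR (r : R A) :
    mat2 (evalQ (Q A)) (inclR A r) = mat2 (qIncl A) (mat2 (evalQ (q A)) (toQq A r)) := by
  have h : (mat2 (evalQ (Q A))).comp (mat2 (QMap (qIncl A))) =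
      (mat2 (qIncl A)).comp (mat2 (evalQ (q A))) := by
    rw [← mat2_comp, evalQ_comp_QMap, mat2_comp]
  rw [← mat2_QMap_toQq]
  exact DFunLike.congr_fun h _

theorem mat2_q2Incl (m : CStarMatrix (Fin 2) (Fin 2) (q (q A))) :
    mat2 (q2Incl A) m = mat2 (QMap (qIncl A)) (mat2 (qIncl (q A)) m) := by
  rw [q2Incl, mat2_comp]; rfl

theorem memJ_iff_toQq {r : R A} : MemJ r ↔ mat2 (fold (q A)) (toQq A r) = 0 := by
  rw [← mem_range_mat2_qIncl_iff]
  refine exists_congr fun m => ?_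
  rw [mat2_q2Incl, ← inclR_apply, ← mat2_QMap_toQq,
    (mat2_injective (QMap_qIncl_injective A)).eq_iff]

/-- So `J` is the kernel of the folding map on `R`. Folding on `Q(qA)` is the restriction of folding
on `Q(QA)`, and its kernel there is `q(qA)`. -/
theorem memJ_iff {r : R A} : MemJ r ↔ foldRHom A r = 0 := by
  rw [memJ_iff_toQq, foldRHom_eq, map_eq_zero_iff _ (mat2_injective qIncl_injective)]

/-! #### Diagonal elements -/

/-- The element `η(z) ⊕ η̄(w)` of `R`. -/
def diagR (z w : q A) : R A :=
  ⟨matUnit 0 0 (eta A (qIncl A z)) + matUnit 1 1 (etaBar A (qIncl A w)),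
    add_mem (mem_R_of_RGen (Or.inl ⟨z, rfl⟩)) (mem_R_of_RGen (Or.inr (Or.inr (Or.inr ⟨w, rfl⟩))))⟩

theorem inclR_diagR_zero_zero (z w : q A) : inclR A (diagR z w) 0 0 = eta A (qIncl A z) := by
  simp [inclR_apply, diagR, matUnit, Matrix.single]

theorem inclR_diagR_zero_one (z w : q A) : inclR A (diagR z w) 0 1 = 0 := by
  simp [inclR_apply, diagR, matUnit, Matrix.single]

theorem inclR_diagR_one_zero (z w : q A) : inclR A (diagR z w) 1 0 = 0 := by
  simp [inclR_apply, diagR, matUnit, Matrix.single]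

theorem inclR_diagR_one_one (z w : q A) : inclR A (diagR z w) 1 1 = etaBar A (qIncl A w) := by
  simp [inclR_apply, diagR, matUnit, Matrix.single]

theorem inclR_diagR (z w : q A) : inclR A (diagR z w) =
    CStarMatrix.ofMatrix !![eta A (qIncl A z), 0; 0, etaBar A (qIncl A w)] :=
  mat_ext (inclR_diagR_zero_zero z w) (inclR_diagR_zero_one z w) (inclR_diagR_one_zero z w)
    (inclR_diagR_one_one z w)

theorem foldRHom_diagR (z w : q A) : foldRHom A (diagR z w) =
    CStarMatrix.ofMatrix !![qIncl A z, 0; 0, qIncl A w] := by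
  rw [foldRHom, NonUnitalStarAlgHom.comp_apply, inclR_diagR]
  refine mat_ext ?_ ?_ ?_ ?_ <;> simp [CStarMatrix.mapₙₐ]

/-- The *-homomorphism `x ↦ η(f x) ⊕ η̄(g x)` to `R`. -/
def diagRHom {X : Type*} [NonUnitalCStarAlgebra X] (f g : X →⋆ₙₐ[ℂ] q A) : X →⋆ₙₐ[ℂ] R A :=
  NonUnitalStarAlgHom.codRestrict
    (dsum ((eta A).comp ((qIncl A).comp f)) ((etaBar A).comp ((qIncl A).comp g))) (R A)
    fun x => by
      rw [show dsum ((eta A).comp ((qIncl A).comp f)) ((etaBar A).comp ((qIncl A).comp g)) x =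
        inclR A (diagR (f x) (g x)) by rw [inclR_diagR]; exact mat_ext rfl rfl rfl rfl]
      exact (diagR (f x) (g x)).2

theorem inclR_comp_diagRHom {X : Type*} [NonUnitalCStarAlgebra X] (f g : X →⋆ₙₐ[ℂ] q A) :
    (inclR A).comp (diagRHom f g) =
      dsum ((eta A).comp ((qIncl A).comp f)) ((etaBar A).comp ((qIncl A).comp g)) := rfl

theorem diagRHom_apply {X : Type*} [NonUnitalCStarAlgebra X] (f g : X →⋆ₙₐ[ℂ] q A) (x : X) :
    diagRHom f g x = diagR (f x) (g x) :=
  inclR_injective A (by rw [inclR_diagR]; exact mat_ext rfl rfl rfl rfl)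

theorem toQq_comp_diagRHom {X : Type*} [NonUnitalCStarAlgebra X] (f g : X →⋆ₙₐ[ℂ] q A) :
    (toQq A).comp (diagRHom f g) = dsum ((iota (q A)).comp f) ((iotaBar (q A)).comp g) := by
  refine NonUnitalStarAlgHom.ext fun x => mat2_injective (QMap_qIncl_injective A) ?_
  rw [NonUnitalStarAlgHom.comp_apply, mat2_QMap_toQq, diagRHom_apply, inclR_diagR]
  refine mat_ext ?_ ?_ ?_ ?_
  · exact (QMap_iota (qIncl A) (f x)).symm
  · exact (map_zero (QMap (qIncl A))).symm
  · exact (map_zero (QMap (qIncl A))).symm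
  · exact (QMap_iotaBar (qIncl A) (g x)).symm

theorem diagMult_fst_coe (f g : A →⋆ₙₐ[ℂ] Q A) (a : A) (r : R A) :
    inclR A ((diagMult A f g a).fst r) = diagMap A f g a * inclR A r := rfl

theorem acts_inclR_diagMult (f g : A →⋆ₙₐ[ℂ] Q A) (a : A) :
    Acts (inclR A) (diagMult A f g a) (dsum ((eta A).comp f) ((etaBar A).comp g) a) := fun _ => rfl

theorem acts_foldRHom_diagMult (f g : A →⋆ₙₐ[ℂ] Q A) (a : A) :
    Acts (foldRHom A) (diagMult A f g a) (dsum f g a) := fun r => by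
  have h : (mat2 (fold (Q A))).comp (diagMap A f g) = dsum f g := by
    rw [diagMap, mat2_comp_dsum, ← NonUnitalStarAlgHom.comp_assoc, fold_comp_iota,
      ← NonUnitalStarAlgHom.comp_assoc, fold_comp_iotaBar, hom_id_comp, hom_id_comp]
  rw [foldRHom, NonUnitalStarAlgHom.comp_apply, diagMult_fst_coe, map_mul, ← h]
  rfl

theorem dsum_sub_dsum {X Y : Type*} [NonUnitalCStarAlgebra X] [NonUnitalCStarAlgebra Y]
    (f g f' g' : X →⋆ₙₐ[ℂ] Y) (x : X) : dsum f g x - dsum f' g' x =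
      CStarMatrix.ofMatrix !![f x - f' x, 0; 0, g x - g' x] := by
  refine mat_ext rfl ?_ ?_ rfl
  · exact sub_zero 0
  · exact sub_zero 0

/-- The differences `f a - f' a` and `g a - g' a` lie in `qA`, so the diagonal multiplier formed
from them is an element `diagR` of `R`. -/
theorem inner_diagMult_sub {f g f' g' : A →⋆ₙₐ[ℂ] Q A} {a : A}
    (hf : fold A (f a) = fold A (f' a)) (hg : fold A (g a) = fold A (g' a)) :
    IsInner (diagMult A f g a - diagMult A f' g' a) := by
  obtain ⟨z, hz⟩ := mem_range_qIncl_iff.2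
    (show fold A (f a - f' a) = 0 by rw [map_sub, hf, sub_self])
  obtain ⟨w, hw⟩ := mem_range_qIncl_iff.2
    (show fold A (g a - g' a) = 0 by rw [map_sub, hg, sub_self])
  refine ⟨diagR z w, ext_fst fun r => inclR_injective A ?_⟩
  rw [coeHom_fst_apply, map_mul, sub_fst, sub_apply, map_sub, diagMult_fst_coe, diagMult_fst_coe,
    ← sub_mul, inclR_diagR, hz, hw]
  rw [diagMap, diagMap, dsum_sub_dsum, map_sub, map_sub]
  rfl

/-- The image of `R` contains `diag(u, u)` for every `u` in `qA`. With `u` the adjoint of an entry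
of `M - N`, that entry is seen to vanish. -/
theorem eq_of_mul_foldRHom {M N : CStarMatrix (Fin 2) (Fin 2) (q A)}
    (h : ∀ r : R A, mat2 (qIncl A) M * foldRHom A r = mat2 (qIncl A) N * foldRHom A r) :
    M = N := by
  have key : ∀ i j, M i j = N i j := fun i j => by
    rw [← sub_eq_zero, ← CStarRing.mul_star_self_eq_zero_iff]
    set u := star (M i j - N i j)
    have h1 := congrFun (congrFun (h (diagR u u)) i) j
    apply qIncl_injective (A := A)
    rw [map_mul, map_sub, map_zero, sub_mul, sub_eq_zero]
    rw [foldRHom_diagR, CStarMatrix.mul_apply, CStarMatrix.mul_apply] at h1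
    fin_cases j <;> simpa using h1
  exact CStarMatrix.ext key

end AlgR

open DoubleCentralizer

/-! ### Homomorphisms `qA → R` from self-adjoint multipliers -/

theorem one_sub_smul_add_smul_zero {M : Type*} [CStarAlgebra M] (x y : selfAdjoint M) :
    (1 - ((0 : unitInterval) : ℝ)) • x + ((0 : unitInterval) : ℝ) • y = x := by simp

theorem one_sub_smul_add_smul_one {M : Type*} [CStarAlgebra M] (x y : selfAdjoint M) :
    (1 - ((1 : unitInterval) : ℝ)) • x + ((1 : unitInterval) : ℝ) • y = y := by simp

theorem lift_comp_iota {A X : Type*} [NonUnitalCStarAlgebra A] [NonUnitalCStarAlgebra X]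
    (f g : A →⋆ₙₐ[ℂ] X) : (FreeProd.lift f g).comp (iota A) = f :=
  NonUnitalStarAlgHom.ext (lift_iota f g)

theorem lift_comp_iotaBar {A X : Type*} [NonUnitalCStarAlgebra A] [NonUnitalCStarAlgebra X]
    (f g : A →⋆ₙₐ[ℂ] X) : (FreeProd.lift f g).comp (iotaBar A) = g :=
  NonUnitalStarAlgHom.ext (lift_iotaBar f g)

/-- For `F = exp((πi/2) S)` one has `F x F* - x = (F x - x F) F*`, and `F` commutes with `x` modulo
`E` because `S` does. -/
theorem inner_adExp_sub {E : Type*} [NonUnitalCStarAlgebra E]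
    {S : selfAdjoint (DoubleCentralizer ℂ E)} {x : DoubleCentralizer ℂ E}
    (h : IsInner ((S : DoubleCentralizer ℂ E) * x - x * (S : DoubleCentralizer ℂ E))) :
    IsInner (adExp S x - x) := by
  set F : DoubleCentralizer ℂ E := (selfAdjoint.expUnitary ((Real.pi / 2) • S) :
    DoubleCentralizer ℂ E) with hF
  have hFu : F * star F = 1 := (selfAdjoint.expUnitary ((Real.pi / 2) • S)).2.2
  have hc : IsInner (F * x - x * F) := by
    rw [hF, selfAdjoint.expUnitary_coe]
    refine inner_commutator_exp ?_
    have : (Complex.I • (((Real.pi / 2) • S : selfAdjoint (DoubleCentralizer ℂ E)) :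
        DoubleCentralizer ℂ E)) = (Complex.I * (Real.pi / 2 : ℝ)) •
          (S : DoubleCentralizer ℂ E) := by rw [mul_smul]; rfl
    rw [this, smul_mul_assoc, mul_smul_comm, ← smul_sub]
    exact h.smul _
  have : adExp S x - x = (F * x - x * F) * star F := by
    rw [adExp_apply, ← hF, sub_mul, mul_assoc x, hFu, mul_one]
  rw [this]
  exact hc.mul_right _

section Lam

variable {A : Type*} [NonUnitalCStarAlgebra A]

/-- The multiplier `S` of `R` lifts `t` times the flip of `M₂(qA)` and commutes with `D` modulo
`R`. -/
structure LiftsMulFlip (S : DoubleCentralizer ℂ (R A)) (t : ℝ) : Prop where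
  fold_fst : ∀ r, foldRHom A (S.fst r) = (t : ℂ) • (flip2 (Q A)).L (foldRHom A r)
  comm : ∀ x, IsInner (S * dMap A x - dMap A x * S)

theorem LiftsMulFlip.of_liftsFlip {S : DoubleCentralizer ℂ (R A)} (h : LiftsFlip S)
    (h' : CommutesModJ S) : LiftsMulFlip S 1 where
  fold_fst r := by
    rw [Complex.ofReal_one, one_smul]
    exact CStarMatrix.ext fun i j => (h r i j).1
  comm x := by
    obtain ⟨r, -, hr⟩ := h' x
    exact ⟨r, hr.symm⟩

/-- The conditions are linear in the pair `(S, t)`. Consequently the admissible `S` for `t = 1` form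
a convex set, and the segment from `0` to such an `S` stays admissible. -/
theorem LiftsMulFlip.smul {S : DoubleCentralizer ℂ (R A)} {t : ℝ} (h : LiftsMulFlip S t) (c : ℝ) :
    LiftsMulFlip (c • S) (c * t) where
  fold_fst r := by
    change foldRHom A ((c : ℂ) • S.fst r) = _
    rw [map_smul, h.fold_fst, smul_smul, Complex.ofReal_mul]
  comm x := by
    change IsInner ((c : ℂ) • S * dMap A x - dMap A x * ((c : ℂ) • S))
    rw [smul_mul_assoc, mul_smul_comm, ← smul_sub]
    exact (h.comm x).smul c

theorem LiftsMulFlip.add {S S' : DoubleCentralizer ℂ (R A)} {t t' : ℝ} (h : LiftsMulFlip S t)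
    (h' : LiftsMulFlip S' t') : LiftsMulFlip (S + S') (t + t') where
  fold_fst r := by
    rw [add_fst, add_apply, map_add, h.fold_fst, h'.fold_fst, Complex.ofReal_add, add_smul]
  comm x := by
    have : (S + S') * dMap A x - dMap A x * (S + S') =
      (S * dMap A x - dMap A x * S) + (S' * dMap A x - dMap A x * S') := by noncomm_ring
    rw [this]
    exact (h.comm x).add (h'.comm x)

/-- The homomorphism `QA → M(R)` given by the pair `(h₁, σ h₂)`. -/
def pairHom (S : selfAdjoint (DoubleCentralizer ℂ (R A))) : Q A →⋆ₙₐ[ℂ] DoubleCentralizer ℂ (R A) :=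
  FreeProd.lift (h1 A) ((adExp S).comp (h2 A))

/-- The homomorphism `QA → M₂(QA)` given by the pair `(ε ⊕ ε̄, ε̄ ⊕ ε)` where the second component
is rotated. -/
def rotHom (A : Type*) [NonUnitalCStarAlgebra A] (t : ℝ) :
    Q A →⋆ₙₐ[ℂ] CStarMatrix (Fin 2) (Fin 2) (Q A) :=
  FreeProd.lift (dsum (iota A) (iotaBar A))
    (((flip2 (Q A)).conj t).comp (dsum (iotaBar A) (iota A)))

/-- A full rotation turns `ε̄ ⊕ ε` into `ε ⊕ ε̄`, so both components coincide. -/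
theorem rotHom_one_qIncl (z : q A) : rotHom A 1 (qIncl A z) = 0 := by
  rw [rotHom, flip2_conj_one_dsum, freeProd_lift_self, NonUnitalStarAlgHom.comp_apply, fold_qIncl,
    map_zero]

/-- After `fold` both components are `id ⊕ id`, which every rotation fixes. -/
theorem mat2_fold_rotHom (t : ℝ) (z : q A) : mat2 (fold A) (rotHom A t (qIncl A z)) = 0 := by
  refine mat2_fold_lift_qIncl (fun x => ?_) z
  have h : (mat2 (fold A)).comp (dsum (iota A) (iotaBar A)) =
      (mat2 (fold A)).comp (((flip2 (Q A)).conj t).comp (dsum (iotaBar A) (iota A))) := by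
    rw [mat2_fold_conj, mat2_comp_dsum, mat2_comp_dsum, fold_comp_iota, fold_comp_iotaBar,
      flip2_conj_dsum_self]
  exact DFunLike.congr_fun h x

namespace LiftsMulFlip

variable {S : selfAdjoint (DoubleCentralizer ℂ (R A))} {t : ℝ}
  (hS : LiftsMulFlip (S : DoubleCentralizer ℂ (R A)) t)

/-- Modulo `R` both `h₁` and `h₂` agree with `d`, and `σ d` agrees with `d` by the commutator
condition; hence `h₁` and `σ h₂` agree. -/
theorem inner_pairHom (hS : LiftsMulFlip (S : DoubleCentralizer ℂ (R A)) t) (z : q A) :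
    IsInner (pairHom S (qIncl A z)) := by
  refine inner_apply_qIncl (fun a => ?_) z
  rw [pairHom, lift_iotaBar, lift_iota, NonUnitalStarAlgHom.comp_apply]
  have h1' : IsInner (dMap A a - h1 A a) := inner_diagMult_sub rfl (by simp)
  have h2' : IsInner (h2 A a - dMap A a) := inner_diagMult_sub (by simp) rfl
  have h3 : IsInner (adExp S (h2 A a - dMap A a)) := by
    rw [adExp_apply]; exact (h2'.mul_left _).mul_right _
  have : adExp S (h2 A a) - h1 A a = adExp S (h2 A a - dMap A a) +
      (adExp S (dMap A a) - dMap A a) + (dMap A a - h1 A a) := by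
    rw [map_sub]; abel
  rw [this]
  exact (h3.add (inner_adExp_sub (hS.comm a))).add h1'

/-- The restriction to `qA` of the homomorphism given by the pair `(h₁, σ h₂)`. -/
def lam (hS : LiftsMulFlip (S : DoubleCentralizer ℂ (R A)) t) : q A →⋆ₙₐ[ℂ] R A :=
  factorThrough coeHom coeHom_injective ((pairHom S).comp (qIncl A)) hS.inner_pairHom

theorem coeHom_lam (z : q A) : coeHom (hS.lam z) = pairHom S (qIncl A z) :=
  apply_factorThrough _ _ _ _ z

theorem acts_pairHom (hS : LiftsMulFlip (S : DoubleCentralizer ℂ (R A)) t) (y : Q A) :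
    Acts (foldRHom A) (pairHom S y) (rotHom A t y) := by
  refine Acts.apply_Q (fun a => ?_) (fun a => ?_) y
  · rw [pairHom, rotHom, lift_iota, lift_iota]
    exact acts_foldRHom_diagMult _ _ a
  · rw [pairHom, rotHom, lift_iotaBar, lift_iotaBar]
    exact (acts_foldRHom_diagMult _ _ a).adExp _ hS.fold_fst

/-- Both sides are known to act in the same way on the image of `R`, and both lie in `M₂(qA)`, where
this action is faithful. -/
theorem foldRHom_lam (z : q A) : foldRHom A (hS.lam z) = rotHom A t (qIncl A z) := by
  obtain ⟨M, hM⟩ := mem_range_mat2_qIncl_iff.2 (mat2_fold_rotHom t z)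
  rw [foldRHom_eq, ← hM]
  congr 1
  refine eq_of_mul_foldRHom fun r => ?_
  rw [← foldRHom_eq, hM, ← hS.acts_pairHom, ← hS.coeHom_lam, coeHom_fst_apply, map_mul]

end LiftsMulFlip

theorem continuous_adExp {T : Type*} [TopologicalSpace T] {M : Type*} [CStarAlgebra M]
    {S : T → selfAdjoint M} (hS : Continuous S) (m : M) : Continuous fun t => adExp (S t) m := by
  simp only [adExp_apply]
  have h : Continuous fun t => (selfAdjoint.expUnitary ((Real.pi / 2) • S t) : M) :=
    continuous_subtype_val.comp (selfAdjoint.continuous_expUnitary.comp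
      (continuous_const_smul (Real.pi / 2) |>.comp hS))
  exact (h.mul continuous_const).mul h.star

theorem ptCont_pairHom {T : Type*} [TopologicalSpace T]
    {S : T → selfAdjoint (DoubleCentralizer ℂ (R A))} (hS : Continuous S) :
    PtCont fun t => pairHom (S t) :=
  (ptCont_const _).freeProd_lift fun x => continuous_adExp hS (h2 A x)

theorem ptCont_lam {T : Type*} [TopologicalSpace T]
    {S : T → selfAdjoint (DoubleCentralizer ℂ (R A))} (hS : Continuous S) {τ : T → ℝ}
    (h : ∀ t, LiftsMulFlip (S t : DoubleCentralizer ℂ (R A)) (τ t)) :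
    PtCont fun t => (h t).lam :=
  PtCont.factorThrough _ _ ((ptCont_pairHom hS).comp_right _) _

theorem IsUniversalMap.exists_lam {φ : q A →⋆ₙₐ[ℂ] CStarMatrix (Fin 2) (Fin 2) (q (q A))}
    (hφ : IsUniversalMap φ) : ∃ (S : selfAdjoint (DoubleCentralizer ℂ (R A)))
      (hS : LiftsMulFlip (S : DoubleCentralizer ℂ (R A)) 1),
      ∀ z, mat2 (q2Incl A) (φ z) = inclR A (hS.lam z) := by
  obtain ⟨S, h1, h2, h3⟩ := hφ
  refine ⟨S, .of_liftsFlip h1 h2, fun z => ?_⟩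
  obtain ⟨r, hr, hr'⟩ := h3 z
  rw [← hr, ← inclR_apply]
  congr 1
  apply coeHom_injective
  rw [hr', LiftsMulFlip.coeHom_lam]
  rfl

theorem mat2_q2Incl_injective : Function.Injective (mat2 (q2Incl A)) :=
  mat2_injective (q2Incl_injective A)

theorem LiftsMulFlip.inclR_lam_mem {S : selfAdjoint (DoubleCentralizer ℂ (R A))}
    (hS : LiftsMulFlip (S : DoubleCentralizer ℂ (R A)) 1) (z : q A) :
    ((inclR A).comp hS.lam) z ∈ Set.range (mat2 (q2Incl A)) :=
  (memJ_iff (r := hS.lam z)).2 (by rw [hS.foldRHom_lam, rotHom_one_qIncl])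

theorem exists_isUniversalMap_of {S : selfAdjoint (DoubleCentralizer ℂ (R A))}
    (h : LiftsFlip (S : DoubleCentralizer ℂ (R A)))
    (h' : CommutesModJ (S : DoubleCentralizer ℂ (R A))) :
    ∃ φ : q A →⋆ₙₐ[ℂ] CStarMatrix (Fin 2) (Fin 2) (q (q A)), IsUniversalMap φ := by
  have hS := LiftsMulFlip.of_liftsFlip h h'
  refine ⟨factorThrough _ mat2_q2Incl_injective ((inclR A).comp hS.lam) hS.inclR_lam_mem,
    S, h, h', fun z => ⟨hS.lam z, ?_, hS.coeHom_lam z⟩⟩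
  rw [apply_factorThrough]
  rfl

/-- Along the segment between two admissible multipliers the lifted matrix remains the full flip, so
the maps remain in `J`, and they depend continuously on the parameter. -/
theorem IsUniversalMap.homotopic {φ φ' : q A →⋆ₙₐ[ℂ] CStarMatrix (Fin 2) (Fin 2) (q (q A))}
    (hφ : IsUniversalMap φ) (hφ' : IsUniversalMap φ') : Homotopic φ φ' := by
  obtain ⟨S, hS, h⟩ := hφ.exists_lam
  obtain ⟨S', hS', h'⟩ := hφ'.exists_lam
  let T : unitInterval → selfAdjoint (DoubleCentralizer ℂ (R A)) :=
    fun t => (1 - (t : ℝ)) • S + (t : ℝ) • S'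
  have hT : ∀ t, LiftsMulFlip (T t : DoubleCentralizer ℂ (R A)) 1 := fun t => by
    have := (hS.smul (1 - (t : ℝ))).add (hS'.smul (t : ℝ))
    rw [show (1 - (t : ℝ)) * 1 + t * 1 = 1 by ring] at this
    exact this
  have hTc : Continuous T := by
    have hc : Continuous fun t : unitInterval => (t : ℝ) := continuous_subtype_val
    exact ((continuous_const.sub hc).smul continuous_const).add (hc.smul continuous_const)
  have hl : ∀ (S S' : selfAdjoint (DoubleCentralizer ℂ (R A))) (e : S = S') (h h'),
      LiftsMulFlip.lam (S := S) (t := 1) h = LiftsMulFlip.lam (S := S') (t := 1) h' := by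
    rintro S _ rfl h h'; rfl
  refine .of_family (F := fun t => factorThrough _ mat2_q2Incl_injective
      ((inclR A).comp (hT t).lam) (hT t).inclR_lam_mem)
    (PtCont.factorThrough _ _ ((ptCont_lam hTc hT).comp_left (inclR A)) _) ?_ ?_
  · refine NonUnitalStarAlgHom.ext fun z => mat2_q2Incl_injective ?_
    rw [apply_factorThrough, h, hl (T 0) S (one_sub_smul_add_smul_zero _ _) (hT 0) hS]
    rfl
  · refine NonUnitalStarAlgHom.ext fun z => mat2_q2Incl_injective ?_
    rw [apply_factorThrough, h', hl (T 1) S' (one_sub_smul_add_smul_one _ _) (hT 1) hS']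
    rfl

/-! ### The deformation of a universal map -/

/-- The symmetry of `qA` that exchanges the two copies of `A`. -/
def qSwap (A : Type*) [NonUnitalCStarAlgebra A] : q A →⋆ₙₐ[ℂ] q A :=
  qCod ((FreeProd.lift (iotaBar A) (iota A)).comp (qIncl A)) fun z => by
    have : (fold A).comp (FreeProd.lift (iotaBar A) (iota A)) = fold A :=
      Q_hom_ext (fun a => by simp) fun a => by simp
    have h := DFunLike.congr_fun this (qIncl A z)
    rw [fold_qIncl] at h
    exact h

theorem qIncl_comp_qSwap :
    (qIncl A).comp (qSwap A) = (FreeProd.lift (iotaBar A) (iota A)).comp (qIncl A) := rfl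

theorem adExp_zero {M : Type*} [CStarAlgebra M] (m : M) : adExp (0 : selfAdjoint M) m = m := by
  rw [adExp_apply, smul_zero, selfAdjoint.expUnitary_zero]
  simp

/-- Without rotation the pair is `(h₁, h₂)`, which is `η` on the pair `(ε, ε̄)` and `η̄` on the
exchanged pair `(ε̄, ε)`. The condition `S = 0` is an equation so that the lemma applies to `0 • S`.
-/
theorem LiftsMulFlip.lam_zero {S : selfAdjoint (DoubleCentralizer ℂ (R A))} {t : ℝ}
    (hS : LiftsMulFlip (S : DoubleCentralizer ℂ (R A)) t) (h0 : S = 0) :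
    hS.lam = diagRHom (NonUnitalStarAlgHom.id ℂ (q A)) (qSwap A) := by
  refine NonUnitalStarAlgHom.ext fun z => coeHom_injective (ext_fst fun r => inclR_injective A ?_)
  rw [coeHom_lam, coeHom_fst_apply, map_mul]
  have key : ∀ y, Acts (inclR A) (pairHom S y)
      (dsum (eta A) ((etaBar A).comp (FreeProd.lift (iotaBar A) (iota A))) y) := by
    refine Acts.apply_Q (fun a => ?_) fun a => ?_
    · rw [pairHom, lift_iota, ← NonUnitalStarAlgHom.comp_apply (dsum _ _), dsum_comp,
        NonUnitalStarAlgHom.comp_assoc, lift_comp_iota]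
      exact acts_inclR_diagMult (iota A) (iotaBar A) a
    · rw [pairHom, lift_iotaBar, NonUnitalStarAlgHom.comp_apply, h0, adExp_zero,
        ← NonUnitalStarAlgHom.comp_apply (dsum _ _), dsum_comp, NonUnitalStarAlgHom.comp_assoc,
        lift_comp_iotaBar]
      exact acts_inclR_diagMult (iotaBar A) (iota A) a
  rw [key (qIncl A z) r, ← NonUnitalStarAlgHom.comp_apply (dsum _ _), dsum_comp,
    NonUnitalStarAlgHom.comp_assoc, ← qIncl_comp_qSwap,
    ← NonUnitalStarAlgHom.comp_apply (inclR A), inclR_comp_diagRHom]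
  rfl

/-- The lift to `M₂(Q(qA))` of the homotopy between `π_{qA} φ` and `id ⊕ 0`. -/
theorem IsUniversalMap.exists_deformation
    {φ : q A →⋆ₙₐ[ℂ] CStarMatrix (Fin 2) (Fin 2) (q (q A))} (hφ : IsUniversalMap φ) :
    ∃ lam : unitInterval → q A →⋆ₙₐ[ℂ] R A, PtCont lam ∧
      lam 0 = diagRHom (NonUnitalStarAlgHom.id ℂ (q A)) (qSwap A) ∧
      (toQq A).comp (lam 1) = (mat2 (qIncl (q A))).comp φ := by
  obtain ⟨S, hS, h⟩ := hφ.exists_lam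
  let T : unitInterval → selfAdjoint (DoubleCentralizer ℂ (R A)) := fun t => (t : ℝ) • S
  have hT : ∀ t : unitInterval, LiftsMulFlip (T t : DoubleCentralizer ℂ (R A)) (t * 1) :=
    fun t => hS.smul (t : ℝ)
  have hTc : Continuous T := Continuous.smul continuous_subtype_val continuous_const
  refine ⟨fun t => (hT t).lam, ptCont_lam hTc hT, LiftsMulFlip.lam_zero _ (zero_smul ℝ S), ?_⟩
  have hl : (hT 1).lam = hS.lam := by
    refine NonUnitalStarAlgHom.ext fun z => coeHom_injective ?_
    rw [LiftsMulFlip.coeHom_lam, LiftsMulFlip.coeHom_lam, show T 1 = S from one_smul ℝ S]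
  refine NonUnitalStarAlgHom.ext fun z => mat2_injective (QMap_qIncl_injective A) ?_
  change mat2 (QMap (qIncl A)) (toQq A ((hT 1).lam z)) = _
  rw [hl, mat2_QMap_toQq, ← h, mat2_q2Incl]
  rfl

/-! ### The two homotopies between `φ` and `π` -/

section Deformation

variable {φ : q A →⋆ₙₐ[ℂ] CStarMatrix (Fin 2) (Fin 2) (q (q A))}

theorem evalQ_comp_iota : (evalQ A).comp (iota A) = NonUnitalStarAlgHom.id ℂ A :=
  NonUnitalStarAlgHom.ext fun a => by simp

theorem evalQ_comp_iotaBar : (evalQ A).comp (iotaBar A) = 0 :=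
  NonUnitalStarAlgHom.ext fun a => by simp

theorem mat2_evalQ_toQq_diagRHom :
    (mat2 (evalQ (q A))).comp ((toQq A).comp
      (diagRHom (NonUnitalStarAlgHom.id ℂ (q A)) (qSwap A))) =
      dsum (NonUnitalStarAlgHom.id ℂ (q A)) 0 := by
  rw [toQq_comp_diagRHom, mat2_comp_dsum, ← NonUnitalStarAlgHom.comp_assoc,
    ← NonUnitalStarAlgHom.comp_assoc, evalQ_comp_iota, evalQ_comp_iotaBar, hom_id_comp,
    hom_zero_comp]

theorem mat2_evalQ_comp_of_toQq {f : q A →⋆ₙₐ[ℂ] R A}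
    (h : (toQq A).comp f = (mat2 (qIncl (q A))).comp φ) :
    (mat2 (evalQ (q A))).comp ((toQq A).comp f) = (mat2 (piMap (q A))).comp φ := by
  rw [h, ← NonUnitalStarAlgHom.comp_assoc, ← mat2_comp, ← piMap]

/-- The map `id ⋆ 0` keeps the summand `η` of `λ₀` and kills the summand `η̄ ∘ swap`. -/
theorem IsUniversalMap.homotopic_piMap_comp (hφ : IsUniversalMap φ) :
    Homotopic (dsum (NonUnitalStarAlgHom.id ℂ (q A)) 0) ((mat2 (piMap (q A))).comp φ) := by
  obtain ⟨lam, hl, h0, h1⟩ := hφ.exists_deformation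
  refine .of_family (F := fun t => (mat2 (evalQ (q A))).comp ((toQq A).comp (lam t)))
    ((hl.comp_left _).comp_left _) ?_ (mat2_evalQ_comp_of_toQq h1)
  rw [h0, mat2_evalQ_toQq_diagRHom]

theorem IsUniversalMap.exists_lifted_homotopy (hφ : IsUniversalMap φ) :
    ∃ lam₀ lam₁ : q A →⋆ₙₐ[ℂ] R A, Homotopic lam₀ lam₁ ∧ ∀ z : q A,
      mat2 (evalQ (Q A)) (lam₀ z) = mat2 (qIncl A) (dsum (NonUnitalStarAlgHom.id ℂ (q A)) 0 z) ∧
      mat2 (evalQ (Q A)) (lam₁ z) = mat2 (qIncl A) (mat2 (piMap (q A)) (φ z)) := by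
  obtain ⟨lam, hl, h0, h1⟩ := hφ.exists_deformation
  refine ⟨lam 0, lam 1, .of_family hl rfl rfl, fun z => ⟨?_, ?_⟩⟩
  · rw [← inclR_apply, mat2_evalQ_inclR, h0, ← mat2_evalQ_toQq_diagRHom]
    rfl
  · rw [← inclR_apply, mat2_evalQ_inclR]
    congr 1
    exact DFunLike.congr_fun (mat2_evalQ_comp_of_toQq h1) z

/-- Pair `λ_t` with `ῑ fold λ_t`; both have the same image under `fold`, so the pair maps `q(qA)` to
`M₂(q(qA))`. At `t = 0` the components are `ι ⊕ ῑ swap` and `ῑ ⊕ ῑ swap`, which gives `id ⊕ 0`. At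
`t = 1` the second component vanishes since `λ₁` has values in `J`, and the pair `(φ, 0)` restricts
to `φ π`. -/
theorem IsUniversalMap.homotopic_comp_piMap (hφ : IsUniversalMap φ) :
    Homotopic (dsum (NonUnitalStarAlgHom.id ℂ (q (q A))) 0) (φ.comp (piMap (q A))) := by
  obtain ⟨lam, hl, h0, h1⟩ := hφ.exists_deformation
  have hf : (mat2 (fold (q A))).comp (mat2 (iotaBar (q A))) = NonUnitalStarAlgHom.id ℂ _ := by
    rw [← mat2_comp, fold_comp_iotaBar]; rfl
  let b : unitInterval → q A →⋆ₙₐ[ℂ] CStarMatrix (Fin 2) (Fin 2) (Q (q A)) := fun t =>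
    (mat2 (iotaBar (q A))).comp ((mat2 (fold (q A))).comp ((toQq A).comp (lam t)))
  have hb0 : b 0 = dsum (iotaBar (q A)) ((iotaBar (q A)).comp (qSwap A)) := by
    simp only [b]
    rw [h0, toQq_comp_diagRHom, mat2_comp_dsum, ← NonUnitalStarAlgHom.comp_assoc,
      ← NonUnitalStarAlgHom.comp_assoc, fold_comp_iota, fold_comp_iotaBar, hom_id_comp,
      hom_id_comp, mat2_comp_dsum]
    rfl
  have hb1 : b 1 = 0 := by
    simp only [b]
    rw [h1, ← NonUnitalStarAlgHom.comp_assoc (mat2 (fold (q A))), ← mat2_comp, fold_comp_qIncl]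
    refine NonUnitalStarAlgHom.ext fun z => ?_
    have : mat2 (0 : q (q A) →⋆ₙₐ[ℂ] q A) (φ z) = 0 := rfl
    rw [NonUnitalStarAlgHom.comp_apply, NonUnitalStarAlgHom.comp_apply, this, map_zero]
    rfl
  refine homotopic_of_pairs (a := fun t => (toQq A).comp (lam t)) (b := b) (hl.comp_left _)
    (((hl.comp_left _).comp_left _).comp_left _) (fun t x => ?_) (fun z => ?_) fun z => ?_
  · exact (DFunLike.congr_fun hf (mat2 (fold (q A)) (toQq A (lam t x)))).symm
  · rw [hb0, h0, toQq_comp_diagRHom, freeProd_lift_dsum]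
    have e : (iota (q A)).comp (NonUnitalStarAlgHom.id ℂ (q A)) = iota (q A) := rfl
    rw [e, freeProd_lift_iota_iotaBar, freeProd_lift_self]
    have h' : (mat2 (qIncl (q A))).comp (dsum (NonUnitalStarAlgHom.id ℂ (q (q A))) 0) =
        (dsum (NonUnitalStarAlgHom.id ℂ (Q (q A)))
          (((iotaBar (q A)).comp (qSwap A)).comp (fold (q A)))).comp (qIncl (q A)) := by
      rw [mat2_comp_dsum, dsum_comp, hom_comp_zero, NonUnitalStarAlgHom.comp_assoc _ (fold (q A)),
        fold_comp_qIncl, hom_comp_zero]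
      rfl
    exact DFunLike.congr_fun h' z
  · rw [hb1, freeProd_lift_zero_right, h1]
    rfl

end Deformation

end Lam

/-! ### Quasi-central approximate units -/

/-- The Cauchy-Schwarz inequality for finite families in a C*-algebra. -/
theorem norm_sum_mul_sq_le {N ι : Type*} [NonUnitalCStarAlgebra N] (s : Finset ι) (a b : ι → N) :
    ‖∑ k ∈ s, a k * b k‖ ^ 2 ≤ ‖∑ k ∈ s, a k * star (a k)‖ * ‖∑ k ∈ s, star (b k) * b k‖ := by
  let _ := CStarAlgebra.spectralOrder N
  let _ := CStarAlgebra.spectralOrderedRing N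
  -- In the Hilbert module of families, with inner product `∑ y_k x_k*`, the sum `∑ a_k b_k` is the
  -- inner product of `(b_k*)` and `(a_k)`.
  let x : WithCStarModule N (s → N) := (WithCStarModule.equiv N (s → N)).symm fun k => star (b k)
  let y : WithCStarModule N (s → N) := (WithCStarModule.equiv N (s → N)).symm fun k => a k
  have h := CStarModule.norm_inner_le (A := N) (WithCStarModule N (s → N)) (x := x) (y := y)
  have h1 : inner N x y = ∑ k ∈ s, a k * b k := by
    rw [WithCStarModule.pi_inner, ← Finset.sum_coe_sort s]
    refine Finset.sum_congr rfl fun k _ => ?_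
    change a k * star (star (b k)) = _
    rw [star_star]
  have h2 : ‖x‖ ^ 2 = ‖∑ k ∈ s, star (b k) * b k‖ := by
    rw [WithCStarModule.pi_norm_sq, ← Finset.sum_coe_sort s]
    congr 1
    refine Finset.sum_congr rfl fun k _ => ?_
    change star (b k) * star (star (b k)) = _
    rw [star_star]
  have h3 : ‖y‖ ^ 2 = ‖∑ k ∈ s, a k * star (a k)‖ := by
    rw [WithCStarModule.pi_norm_sq, ← Finset.sum_coe_sort s]
    rfl
  rw [← h1, ← h2, ← h3]
  calc _ ≤ (‖x‖ * ‖y‖) ^ 2 := by gcongr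
    _ = _ := by ring

section ApproxUnit

variable {I : Type*} [NonUnitalCStarAlgebra I] [PartialOrder I] [StarOrderedRing I]

theorem exists_of_eventually_approximateUnit {P : I → Prop}
    (h : ∀ᶠ u in CStarAlgebra.approximateUnit I, P u) : ∃ u, 0 ≤ u ∧ ‖u‖ < 1 ∧ P u := by
  obtain ⟨a, ⟨h0, h1⟩, ha⟩ := (CStarAlgebra.hasBasis_approximateUnit I).eventually_iff.1 h
  exact ⟨a, h0, h1, ha ⟨le_rfl, by simpa using h1.le⟩⟩

theorem eventually_approximateUnit_ge {v : I} (h0 : 0 ≤ v) (h1 : ‖v‖ < 1) :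
    ∀ᶠ u in CStarAlgebra.approximateUnit I, v ≤ u :=
  (CStarAlgebra.hasBasis_approximateUnit I).eventually_iff.2 ⟨v, ⟨h0, h1⟩, fun _ hx => hx.1⟩

theorem exists_seq_of_step {X : Type*} {P : ℕ → X → X → Prop} (x₀ : X)
    (h : ∀ n x, ∃ y, P n x y) : ∃ f : ℕ → X, f 0 = x₀ ∧ ∀ n, P n (f n) (f (n + 1)) := by
  choose g hg using h
  exact ⟨fun n => Nat.rec x₀ g n, rfl, fun n => hg n _⟩

open Filter in
/-- Convex combinations of an approximate unit of an ideal are approximately central. -/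
theorem exists_quasicentral {N : Type*} [NonUnitalCStarAlgebra N] (i : I →⋆ₙₐ[ℂ] N)
    (hi : Function.Injective i) (hid : ∀ (b : N) (x : I), ∃ y, i y = b * i x)
    (X : Finset N) (H : Finset I) {u₀ : I} (h₀ : 0 ≤ u₀) (h₁ : ‖u₀‖ < 1) {ε : ℝ} (hε : 0 < ε) :
    ∃ u, u₀ ≤ u ∧ ‖u‖ < 1 ∧ (∀ x ∈ X, ‖i u * x - x * i u‖ ≤ ε) ∧ ∀ h ∈ H, ‖h - u * h‖ ≤ ε := by
  have hl := CStarAlgebra.increasingApproximateUnit I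
  set l := CStarAlgebra.approximateUnit I
  have hic : Continuous i := hom_continuous i
  have hleft : ∀ z : I, ∀ᶠ u in l, ‖i z - i u * i z‖ ≤ ε / 4 := fun z => by
    have h1 : Tendsto (fun u => ‖i z - i (u * z)‖) l (𝓝 ‖i z - i z‖) :=
      (tendsto_const_nhds.sub ((hic.tendsto z).comp (hl.tendsto_mul_right z))).norm
    rw [sub_self, norm_zero] at h1
    filter_upwards [h1.eventually_le_const (show (0 : ℝ) < ε / 4 by positivity)] with u hu
    rwa [map_mul] at hu
  have hright : ∀ z : I, ∀ᶠ u in l, ‖i z - i z * i u‖ ≤ ε / 4 := fun z => by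
    have h1 : Tendsto (fun u => ‖i z - i (z * u)‖) l (𝓝 ‖i z - i z‖) :=
      (tendsto_const_nhds.sub ((hic.tendsto z).comp (hl.tendsto_mul_left z))).norm
    rw [sub_self, norm_zero] at h1
    filter_upwards [h1.eventually_le_const (show (0 : ℝ) < ε / 4 by positivity)] with u hu
    rwa [map_mul] at hu
  have hid' : ∀ (b : N) (x : I), ∃ y, i y = i x * b := fun b x => by
    obtain ⟨y, hy⟩ := hid (star b) (star x)
    exact ⟨star y, by rw [map_star, hy, map_star, star_mul, star_star, star_star]⟩
  -- Each term of the increasing sequence is almost a unit for the products of the previous term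
  -- with the elements of `X`, from the appropriate side, and for `H`.
  have hstep : ∀ (_ : ℕ) (v : {v : I // 0 ≤ v ∧ ‖v‖ < 1}), ∃ w : {v : I // 0 ≤ v ∧ ‖v‖ < 1},
      v.1 ≤ w.1 ∧ (∀ x ∈ X, ‖x * i v.1 - i w.1 * (x * i v.1)‖ ≤ ε / 4 ∧
        ‖i v.1 * x - i v.1 * x * i w.1‖ ≤ ε / 4) ∧ ∀ h ∈ H, ‖h - w.1 * h‖ ≤ ε / 4 := by
    intro _ v
    have e1 : ∀ᶠ w in l, ∀ x ∈ X, ‖x * i v.1 - i w * (x * i v.1)‖ ≤ ε / 4 ∧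
        ‖i v.1 * x - i v.1 * x * i w‖ ≤ ε / 4 := by
      refine (Finset.eventually_all X).2 fun x _ => ?_
      obtain ⟨y, hy⟩ := hid x v.1
      obtain ⟨y', hy'⟩ := hid' x v.1
      filter_upwards [hleft y, hright y'] with w hw hw'
      rw [← hy, ← hy']
      exact ⟨hw, hw'⟩
    have e2 : ∀ᶠ w in l, ∀ h ∈ H, ‖h - w * h‖ ≤ ε / 4 := by
      refine (Finset.eventually_all H).2 fun h _ => ?_
      filter_upwards [hleft h] with w hw
      rwa [← NonUnitalStarAlgHom.norm_map i hi, map_sub, map_mul]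
    obtain ⟨w, hw0, hw1, hw2, hw3, hw4⟩ := exists_of_eventually_approximateUnit
      ((eventually_approximateUnit_ge v.2.1 v.2.2).and (e1.and e2))
    exact ⟨⟨w, hw0, hw1⟩, hw2, hw3, hw4⟩
  obtain ⟨v, hv0, hv⟩ := exists_seq_of_step ⟨u₀, h₀, h₁⟩ hstep
  have hmono : Monotone fun n => (v n).1 := monotone_nat_of_le_succ fun n => (hv n).1
  obtain ⟨C, hC⟩ : ∃ C : ℝ, ∀ x ∈ X, ‖x‖ ≤ C :=
    ⟨∑ x ∈ X, ‖x‖, fun x hx => Finset.single_le_sum (fun x _ => norm_nonneg x) hx⟩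
  -- The element sought is the average of `n` consecutive terms. This `n` gives `√n |C| ≤ n ε / 4`;
  -- two Cauchy–Schwarz terms of this size leave `ε / 2` for the almost-unit errors.
  obtain ⟨n, hn⟩ := exists_nat_gt ((4 * |C| / ε) ^ 2)
  have hn0 : (0 : ℝ) < n := lt_of_le_of_lt (sq_nonneg _) hn
  have hn0' : n ≠ 0 := by rintro rfl; simp at hn0
  set s := Finset.range n
  have hsum : ∀ z : I, z = ∑ _k ∈ s, ((n : ℝ)⁻¹) • z := fun z => by
    rw [Finset.sum_const, Finset.card_range, ← Nat.cast_smul_eq_nsmul ℝ, smul_smul,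
      mul_inv_cancel₀ hn0.ne', one_smul]
  refine ⟨∑ k ∈ s, ((n : ℝ)⁻¹) • (v (k + 1)).1, ?_, ?_, fun x hx => ?_, fun h hh => ?_⟩
  · rw [hsum u₀]
    refine Finset.sum_le_sum fun k _ => smul_le_smul_of_nonneg_left ?_ (inv_nonneg.2 hn0.le)
    have := hmono (Nat.zero_le (k + 1))
    simpa only [hv0] using this
  · calc ‖∑ k ∈ s, ((n : ℝ)⁻¹) • (v (k + 1)).1‖ ≤ ∑ k ∈ s, ‖((n : ℝ)⁻¹) • (v (k + 1)).1‖ :=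
        norm_sum_le _ _
      _ < ∑ k ∈ s, (n : ℝ)⁻¹ := by
        refine Finset.sum_lt_sum_of_nonempty ⟨0, by simpa [s, Nat.pos_iff_ne_zero] using hn0'⟩
          fun k _ => ?_
        rw [norm_smul, Real.norm_of_nonneg (inv_nonneg.2 hn0.le)]
        exact mul_lt_of_lt_one_right (inv_pos.2 hn0) (v (k + 1)).2.2
      _ = 1 := by simp [s, hn0.ne']
  · let V : ℕ → N := fun k => i (v (k + 1)).1
    let e : ℕ → I := fun k => (v (k + 2)).1 - (v (k + 1)).1
    have he : ∀ k, 0 ≤ e k := fun k => sub_nonneg.2 (hmono (Nat.le_succ (k + 1)))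
    let r : ℕ → I := fun k => CFC.sqrt (e k)
    have hr : ∀ k, r k * r k = e k := fun k => CFC.sqrt_mul_sqrt_self (e k) (he k)
    have hrs : ∀ k, star (r k) = r k := fun k =>
      (IsSelfAdjoint.of_nonneg (CFC.sqrt_nonneg (e k))).star_eq
    have hVn : ∀ k, ‖V k‖ ≤ 1 := fun k =>
      (NonUnitalStarAlgHom.norm_apply_le i _).trans (v (k + 1)).2.2.le
    have hVs : ∀ k, star (V k) = V k := fun k => by
      simp only [V]
      rw [← map_star, (IsSelfAdjoint.of_nonneg (v (k + 1)).2.1).star_eq]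
    have he1 : ∀ k, ‖e k‖ ≤ 1 := fun k =>
      (CStarAlgebra.norm_le_norm_of_nonneg_of_le (he k)
        (sub_le_self _ (v (k + 1)).2.1)).trans (v (k + 2)).2.2.le
    have hesum : ‖∑ k ∈ s, e k‖ ≤ 1 := by
      rw [Finset.sum_range_sub (fun k => (v (k + 1)).1)]
      refine (CStarAlgebra.norm_le_norm_of_nonneg_of_le (sub_nonneg.2 (hmono (by lia)))
        (sub_le_self _ (v _).2.1)).trans (v _).2.2.le
    -- Cauchy–Schwarz with `e_k = r_k²`: one factor is at most `n |C|²`, the other at most `1`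
    -- because `∑ e_k` telescopes. The bound `√n` in place of the trivial `n` is what makes the
    -- averages almost central.
    have hcs : ∀ y : N, ‖y‖ ≤ |C| → ‖∑ k ∈ s, V k * y * i (e k)‖ ≤ √n * |C| := by
      intro y hy
      have h1 := norm_sum_mul_sq_le s (fun k => V k * y * i (r k)) (fun k => i (r k))
      have h2 : ∀ k, V k * y * i (r k) * i (r k) = V k * y * i (e k) := fun k => by
        rw [mul_assoc, ← map_mul, hr]
      have h3 : ∀ k, star (i (r k)) * i (r k) = i (e k) := fun k => by
        rw [← map_star, hrs, ← map_mul, hr]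
      simp only [h2, h3] at h1
      have h4 : ‖∑ k ∈ s, i (e k)‖ ≤ 1 := by
        rw [← map_sum]; exact (NonUnitalStarAlgHom.norm_apply_le i _).trans hesum
      have h5 : ‖∑ k ∈ s, V k * y * i (r k) * star (V k * y * i (r k))‖ ≤ n * |C| ^ 2 := by
        refine (norm_sum_le_of_le s (f := fun k => V k * y * i (r k) * star (V k * y * i (r k)))
          (n := fun _ => |C| ^ 2) fun k _ => ?_).trans (by simp [s])
        have hre : ‖i (r k)‖ ≤ 1 := by
          have h6 : ‖r k‖ * ‖r k‖ ≤ 1 := by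
            rw [← CStarRing.norm_star_mul_self, hrs, hr]; exact he1 k
          refine (NonUnitalStarAlgHom.norm_apply_le i _).trans ?_
          nlinarith [norm_nonneg (r k)]
        rw [CStarRing.norm_self_mul_star, ← sq]
        gcongr
        calc ‖V k * y * i (r k)‖ ≤ ‖V k‖ * ‖y‖ * ‖i (r k)‖ := norm_mul₃_le
          _ ≤ 1 * |C| * 1 := by gcongr; exact hVn k
          _ = |C| := by ring
      have h6 : ‖∑ k ∈ s, V k * y * i (e k)‖ ^ 2 ≤ (√n * |C|) ^ 2 := by
        rw [mul_pow, Real.sq_sqrt hn0.le]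
        refine h1.trans ?_
        calc _ ≤ (n * |C| ^ 2) * 1 := by gcongr
          _ = _ := mul_one _
      exact (sq_le_sq₀ (norm_nonneg _) (by positivity)).1 h6
    have hxC : ‖x‖ ≤ |C| := (hC x hx).trans (le_abs_self C)
    have hA := hcs x hxC
    have hB := hcs (star x) (by rwa [norm_star])
    have hB' : ‖∑ k ∈ s, i (e k) * x * V k‖ ≤ √n * |C| := by
      rw [← norm_star, star_sum]
      refine le_of_eq_of_le ?_ hB
      congr 1
      refine Finset.sum_congr rfl fun k _ => ?_
      rw [star_mul, star_mul, hVs, ← map_star, (IsSelfAdjoint.of_nonneg (he k)).star_eq, mul_assoc]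
    -- Replacing `V_k x` by `V_k x V_{k+1}` and `x V_k` by `V_{k+1} x V_k` costs only the
    -- almost-unit errors, and the difference of the replacements is `V_k x e_k - e_k x V_k` with
    -- `e_k = V_{k+1} - V_k`.
    have hsplit : i (∑ k ∈ s, ((n : ℝ)⁻¹) • (v (k + 1)).1) * x -
        x * i (∑ k ∈ s, ((n : ℝ)⁻¹) • (v (k + 1)).1) =
        (((n : ℝ)⁻¹ : ℝ) : ℂ) • ((∑ k ∈ s, V k * x * i (e k) - ∑ k ∈ s, i (e k) * x * V k) +
          ∑ k ∈ s, ((V k * x - V k * x * V (k + 1)) - (x * V k - V (k + 1) * (x * V k)))) := by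
      rw [← Finset.sum_sub_distrib, ← Finset.sum_add_distrib, ← Finset.smul_sum]
      have : i (((n : ℝ)⁻¹ : ℝ) • ∑ k ∈ s, (v (k + 1)).1) =
          (((n : ℝ)⁻¹ : ℝ) : ℂ) • ∑ k ∈ s, V k := by
        rw [← Complex.coe_smul, map_smul, map_sum]
      rw [this, smul_mul_assoc, mul_smul_comm, ← smul_sub, Finset.sum_mul, Finset.mul_sum,
        ← Finset.sum_sub_distrib]
      congr 1
      refine Finset.sum_congr rfl fun k _ => ?_
      have : i (e k) = V (k + 1) - V k := map_sub i _ _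
      rw [this]
      noncomm_ring
    rw [hsplit, norm_smul, Complex.norm_real, Real.norm_of_nonneg (inv_nonneg.2 hn0.le),
      inv_mul_le_iff₀ hn0]
    have hrest : ‖∑ k ∈ s, ((V k * x - V k * x * V (k + 1)) - (x * V k - V (k + 1) * (x * V k)))‖ ≤
        n * (ε / 2) := by
      refine (norm_sum_le_of_le s (n := fun _ => ε / 2) fun k _ => ?_).trans (by simp [s])
      refine (norm_sub_le _ _).trans ?_
      have := (hv (k + 1)).2.1 x hx
      linarith [this.1, this.2]
    have hsq : √n * |C| ≤ n * (ε / 4) := by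
      have h1 : 4 * |C| / ε ≤ √n := Real.le_sqrt_of_sq_le hn.le
      rw [div_le_iff₀ hε] at h1
      nlinarith [Real.mul_self_sqrt hn0.le, Real.sqrt_nonneg n]
    calc _ ≤ (√n * |C| + √n * |C|) + n * (ε / 2) :=
          (norm_add_le _ _).trans (add_le_add ((norm_sub_le _ _).trans (add_le_add hA hB')) hrest)
      _ ≤ n * ε := by linarith
  · have : h - (∑ k ∈ s, ((n : ℝ)⁻¹) • (v (k + 1)).1) * h =
        ∑ k ∈ s, ((n : ℝ)⁻¹) • (h - (v (k + 1)).1 * h) := by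
      simp only [smul_sub, Finset.sum_sub_distrib, ← hsum, Finset.sum_mul, smul_mul_assoc]
    rw [this]
    refine (norm_sum_le_of_le s (n := fun _ => (n : ℝ)⁻¹ * ε) fun k _ => ?_).trans ?_
    · rw [norm_smul, Real.norm_of_nonneg (inv_nonneg.2 hn0.le)]
      gcongr
      exact ((hv k).2.2 h hh).trans (by linarith)
    · rw [Finset.sum_const, Finset.card_range, nsmul_eq_mul, ← mul_assoc, mul_inv_cancel₀ hn0.ne',
        one_mul]

end ApproxUnit

/-! ### Commutators with square roots -/

open Polynomial in
-- The commutator with `x` is a derivation, so for a contraction `h` the commutator of `hⁿ` has norm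
-- at most `n` times that of `h`. The constant depends only on the polynomial.
theorem exists_norm_commutator_aeval_le (M : Type*) [CStarAlgebra M] (p : ℝ[X]) :
    ∃ K : ℝ, 0 ≤ K ∧ ∀ h x : M, ‖h‖ ≤ 1 →
      ‖aeval h p * x - x * aeval h p‖ ≤ K * ‖h * x - x * h‖ := by
  induction p using Polynomial.induction_on' with
  | add p q hp hq =>
    obtain ⟨K, hK, h1⟩ := hp
    obtain ⟨K', hK', h2⟩ := hq
    refine ⟨K + K', add_nonneg hK hK', fun h x hh => ?_⟩
    have : aeval h (p + q) * x - x * aeval h (p + q) =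
        (aeval h p * x - x * aeval h p) + (aeval h q * x - x * aeval h q) := by
      rw [map_add]; noncomm_ring
    rw [this, add_mul]
    exact (norm_add_le _ _).trans (add_le_add (h1 h x hh) (h2 h x hh))
  | monomial n a =>
    have hpow : ∀ (n : ℕ) (h x : M), ‖h‖ ≤ 1 →
        ‖h ^ n * x - x * h ^ n‖ ≤ n * ‖h * x - x * h‖ := by
      intro n h x hh
      induction n with
      | zero => simp
      | succ n ih =>
        have : h ^ (n + 1) * x - x * h ^ (n + 1) =
            h * (h ^ n * x - x * h ^ n) + (h * x - x * h) * h ^ n := by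
          rw [pow_succ']; noncomm_ring
        rw [this]
        have hp : ‖h ^ n‖ ≤ 1 ∨ n = 0 := by
          rcases n.eq_zero_or_pos with hn | hn
          · exact Or.inr hn
          · exact Or.inl ((norm_pow_le' h hn).trans (pow_le_one₀ (norm_nonneg _) hh))
        have h2 : ‖(h * x - x * h) * h ^ n‖ ≤ ‖h * x - x * h‖ := by
          rcases hp with hp | rfl
          · exact (norm_mul_le _ _).trans (mul_le_of_le_one_right (norm_nonneg _) hp)
          · simp
        have h1 : ‖h * (h ^ n * x - x * h ^ n)‖ ≤ n * ‖h * x - x * h‖ :=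
          (norm_mul_le _ _).trans ((mul_le_of_le_one_left (norm_nonneg _) hh).trans ih)
        refine (norm_add_le _ _).trans ?_
        push_cast
        linarith
    refine ⟨|a| * n, by positivity, fun h x hh => ?_⟩
    rw [aeval_monomial, ← Algebra.smul_def, smul_mul_assoc, mul_smul_comm, ← smul_sub, norm_smul,
      mul_assoc]
    exact mul_le_mul_of_nonneg_left (hpow n h x hh) (abs_nonneg a)

open Polynomial in
/-- If the square of a positive contraction almost commutes with `x`, then so does the positive
contraction. -/
theorem exists_norm_commutator_le_of_sq (M : Type*) [CStarAlgebra M] [PartialOrder M]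
    [StarOrderedRing M] (C : ℝ) {ε : ℝ} (hε : 0 < ε) :
    ∃ δ > 0, ∀ g x : M, 0 ≤ g → ‖g‖ ≤ 1 → ‖x‖ ≤ C →
      ‖g * g * x - x * (g * g)‖ ≤ δ → ‖g * x - x * g‖ ≤ ε := by
  -- With a polynomial `p` close to the square root on `[0, 1]`, the element `g` is close to
  -- `p(g²)`. The error contributes at most `ε / 2` to the commutator, and the choice of `δ` bounds
  -- the commutator with `p(g²)` by `ε / 2`.
  obtain ⟨p, hp⟩ := exists_polynomial_near_of_continuousOn 0 1 Real.sqrt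
    Real.continuous_sqrt.continuousOn (ε / (4 * (|C| + 1))) (by positivity)
  obtain ⟨K, hK, hKp⟩ := exists_norm_commutator_aeval_le M p
  refine ⟨ε / (2 * (K + 1)), by positivity, fun g x hg hg1 hx hgx => ?_⟩
  have hgsa : IsSelfAdjoint g := .of_nonneg hg
  have h1 : ‖g - aeval (g * g) p‖ ≤ ε / (4 * (|C| + 1)) := by
    have e1 : aeval (g * g) p = cfc (fun s : ℝ => (p.comp (X ^ 2)).eval s) g := by
      rw [cfc_polynomial (p.comp (X ^ 2)) g hgsa, aeval_comp]
      simp [sq]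
    have e2 : g = cfc (fun s : ℝ => s) g := (cfc_id' ℝ g hgsa).symm
    rw [e1]
    nth_rw 1 [e2]
    rw [← cfc_sub (fun s : ℝ => s) (fun s : ℝ => (p.comp (X ^ 2)).eval s) g (by fun_prop)
      (Polynomial.continuous _).continuousOn]
    refine norm_cfc_le (by positivity) fun s hs => ?_
    have : Nontrivial M := not_subsingleton_iff_nontrivial.1 fun _ => by
      rw [spectrum.of_subsingleton] at hs; exact hs
    have hs0 : 0 ≤ s := spectrum_nonneg_of_nonneg hg hs
    have hs1 : s ≤ 1 := (le_abs_self s).trans ((spectrum.norm_le_norm_of_mem hs).trans hg1)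
    have := hp (s ^ 2) ⟨sq_nonneg s, pow_le_one₀ hs0 hs1⟩
    rw [Real.sqrt_sq hs0, abs_sub_comm] at this
    simpa using this.le
  have h2 : ‖g * g‖ ≤ 1 := (norm_mul_le _ _).trans (mul_le_one₀ hg1 (norm_nonneg _) hg1)
  have h3 := hKp (g * g) x h2
  have h4 : g * x - x * g = (g - aeval (g * g) p) * x - x * (g - aeval (g * g) p) +
      (aeval (g * g) p * x - x * aeval (g * g) p) := by noncomm_ring
  have hxC : ‖x‖ ≤ |C| + 1 := by linarith [le_abs_self C]
  have h5 : ‖(g - aeval (g * g) p) * x‖ ≤ ε / 4 := by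
    refine (norm_mul_le _ _).trans ?_
    calc _ ≤ ε / (4 * (|C| + 1)) * (|C| + 1) := by gcongr
      _ = ε / 4 := by field_simp
  have h6 : ‖x * (g - aeval (g * g) p)‖ ≤ ε / 4 := by
    refine (norm_mul_le _ _).trans ?_
    calc _ ≤ (|C| + 1) * (ε / (4 * (|C| + 1))) := by gcongr
      _ = ε / 4 := by field_simp
  have h7 : ‖aeval (g * g) p * x - x * aeval (g * g) p‖ ≤ ε / 2 := by
    refine h3.trans ?_
    calc _ ≤ (K + 1) * (ε / (2 * (K + 1))) := by gcongr; linarith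
      _ = ε / 2 := by field_simp
  rw [h4]
  refine (norm_add_le _ _).trans ?_
  linarith [norm_sub_le ((g - aeval (g * g) p) * x) (x * (g - aeval (g * g) p))]

open DoubleCentralizer Filter

/-! ### Strictly convergent series -/

theorem norm_one_le_one (M : Type*) [CStarAlgebra M] : ‖(1 : M)‖ ≤ 1 := by
  rcases subsingleton_or_nontrivial M with h | h
  · rw [Subsingleton.elim (1 : M) 0, norm_zero]; exact zero_le_one
  · exact CStarRing.norm_one.le

theorem cauchySeq_sum_of_norm_Ico_sq_le {X Y : Type*} [NormedAddCommGroup X]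
    [NormedAddCommGroup Y] {f : ℕ → X} {g : ℕ → Y} {C : ℝ} (hC : 0 ≤ C)
    (h : ∀ a b, ‖∑ m ∈ Finset.Ico a b, f m‖ ^ 2 ≤ C * ‖∑ m ∈ Finset.Ico a b, g m‖)
    (hg : CauchySeq fun n => ∑ m ∈ Finset.range n, g m) :
    CauchySeq fun n => ∑ m ∈ Finset.range n, f m := by
  rw [Metric.cauchySeq_iff'] at hg ⊢
  intro ε hε
  obtain ⟨N, hN⟩ := hg (ε ^ 2 / (C + 1)) (by positivity)
  refine ⟨N, fun n hn => ?_⟩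
  have h1 := hN n hn
  rw [dist_eq_norm, ← Finset.sum_Ico_eq_sub _ hn] at h1 ⊢
  have h2 := h N n
  rw [lt_div_iff₀ (by positivity)] at h1
  refine lt_of_pow_lt_pow_left₀ 2 hε.le (h2.trans_lt ?_)
  nlinarith [norm_nonneg (∑ m ∈ Finset.Ico N n, g m)]

/-- If `∑ GₘGₘ` converges strictly, then so does `∑ GₘBₘGₘ` for a bounded sequence `Bₘ`. -/
theorem cauchySeq_sum_conj {M : Type*} [CStarAlgebra M] {G B : ℕ → M} (hG : ∀ m, star (G m) = G m)
    (hG1 : ∀ a b, ‖∑ m ∈ Finset.Ico a b, G m * G m‖ ≤ 1) {K : ℝ} (hB : ∀ m, ‖B m‖ ≤ K) (r : M)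
    (hr : CauchySeq fun n => ∑ m ∈ Finset.range n, G m * G m * r) :
    CauchySeq fun n => ∑ m ∈ Finset.range n, G m * B m * G m * r := by
  let _ := CStarAlgebra.spectralOrder M
  let _ := CStarAlgebra.spectralOrderedRing M
  refine cauchySeq_sum_of_norm_Ico_sq_le (C := K ^ 2 * ‖r‖) (by positivity) (fun a b => ?_) hr
  -- Cauchy–Schwarz for the factors `G_m` and `B_m G_m r`; the square of the second is at most `K²
  -- r* G_m² r`, whose partial sums are controlled by hypothesis.
  have h1 := norm_sum_mul_sq_le (Finset.Ico a b) G (fun m => B m * G m * r)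
  simp only [← mul_assoc, hG] at h1
  have h2 : ∀ m, star (B m * G m * r) * B m * G m * r ≤ K ^ 2 • (star r * (G m * G m * r)) := by
    intro m
    have h3 := CStarAlgebra.star_left_conjugate_le_norm_smul (a := G m * r)
      (b := star (B m) * B m) (IsSelfAdjoint.star_mul_self _)
    have h4 : star (G m * r) * (star (B m) * B m) * (G m * r) =
        star (B m * G m * r) * B m * G m * r := by
      simp only [star_mul, mul_assoc]
    have h5 : star (G m * r) * (G m * r) = star r * (G m * G m * r) := by
      simp only [star_mul, mul_assoc, hG]
    rw [h4] at h3
    refine h3.trans ?_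
    rw [← h5, CStarRing.norm_star_mul_self, ← sq]
    refine smul_le_smul_of_nonneg_right ?_ (star_mul_self_nonneg _)
    gcongr
    exact hB m
  have h6 : ‖∑ m ∈ Finset.Ico a b, star (B m * G m * r) * B m * G m * r‖ ≤
      K ^ 2 * ‖r‖ * ‖∑ m ∈ Finset.Ico a b, G m * G m * r‖ := by
    refine (CStarAlgebra.norm_le_norm_of_nonneg_of_le
      (Finset.sum_nonneg fun m _ => ?_) (Finset.sum_le_sum fun m _ => h2 m)).trans ?_
    · have := star_mul_self_nonneg (B m * G m * r)
      simpa only [mul_assoc] using this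
    · rw [← Finset.smul_sum, ← Finset.mul_sum, norm_smul, Real.norm_of_nonneg (sq_nonneg K),
        mul_assoc]
      gcongr
      exact (norm_mul_le _ _).trans_eq (by rw [norm_star])
  refine h1.trans ?_
  calc _ ≤ 1 * (K ^ 2 * ‖r‖ * ‖∑ m ∈ Finset.Ico a b, G m * G m * r‖) := by
        gcongr
        exact hG1 a b
    _ = _ := one_mul _

/-- A strictly convergent series of self-adjoint elements defines a self-adjoint multiplier. -/
theorem exists_multiplier_of_strict {E : Type*} [NonUnitalCStarAlgebra E] {F : ℕ → E}
    (hF : ∀ m, star (F m) = F m)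
    (hc : ∀ r, CauchySeq fun n => ∑ m ∈ Finset.range n, F m * r) :
    ∃ S : DoubleCentralizer ℂ E, star S = S ∧
      ∀ r, Tendsto (fun n => ∑ m ∈ Finset.range n, F m * r) atTop (𝓝 (S.fst r)) := by
  have hlim : ∀ r, ∃ y, Tendsto (fun n => ∑ m ∈ Finset.range n, F m * r) atTop (𝓝 y) :=
    fun r => cauchySeq_tendsto_of_complete (hc r)
  choose T hT using hlim
  let L : E →L[ℂ] E := continuousLinearMapOfTendsto (l := atTop) (f := T)
    (fun n => ContinuousLinearMap.mul ℂ E (∑ m ∈ Finset.range n, F m))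
    (tendsto_pi_nhds.2 fun r => by
      simpa only [ContinuousLinearMap.mul_apply', Finset.sum_mul] using hT r)
  have hL : ∀ r, L r = T r := fun _ => rfl
  -- For self-adjoint summands the right multiplication is the adjoint of the left one, so its
  -- convergence needs no separate hypothesis.
  let R' : E →L[ℂ] E :=
    ⟨{ toFun := fun r => star (L (star r))
       map_add' := fun x y => by simp
       map_smul' := fun c x => by simp }, by
      exact continuous_star.comp (L.continuous.comp continuous_star)⟩
  have hR : ∀ r, R' r = star (T (star r)) := fun _ => rfl
  have hTr : ∀ x, Tendsto (fun n => ∑ m ∈ Finset.range n, x * F m) atTop (𝓝 (R' x)) := fun x => by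
    have := (continuous_star.tendsto _).comp (hT (star x))
    rw [hR]
    refine this.congr fun n => ?_
    simp [star_sum, hF]
  refine ⟨⟨(L, R'), fun x y => ?_⟩, ?_, hT⟩
  · refine tendsto_nhds_unique ((hTr x).mul_const y) (((hT y).const_mul x).congr fun n => ?_)
    rw [Finset.mul_sum, Finset.sum_mul]
    exact Finset.sum_congr rfl fun m _ => (mul_assoc _ _ _).symm
  · refine ext_fst fun r => ?_
    rw [star_fst]
    change star (R' (star r)) = L r
    rw [hR, hL, star_star, star_star]

/-! ### Ideals of the multiplier algebra -/

section Kernel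

variable {E Y : Type*} [NonUnitalCStarAlgebra E] [NonUnitalCStarAlgebra Y]

/-- The kernel of a *-homomorphism. -/
def kerSub (ψ : E →⋆ₙₐ[ℂ] Y) : NonUnitalStarSubalgebra ℂ E where
  carrier := {x | ψ x = 0}
  zero_mem' := map_zero _
  add_mem' {x y} (hx : ψ x = 0) (hy : ψ y = 0) := show ψ (x + y) = 0 by
    rw [map_add, hx, hy, add_zero]
  smul_mem' c x (hx : ψ x = 0) := show ψ (c • x) = 0 by rw [map_smul, hx, smul_zero]
  mul_mem' {x y} (hx : ψ x = 0) _ := show ψ (x * y) = 0 by rw [map_mul, hx, zero_mul]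
  star_mem' {x} (hx : ψ x = 0) := show ψ (star x) = 0 by rw [map_star, hx, star_zero]

instance kerSub_isClosed (ψ : E →⋆ₙₐ[ℂ] Y) : IsClosed (kerSub ψ : Set E) :=
  isClosed_eq (hom_continuous ψ) continuous_const

/-- Since `(m r)* (m r) = r* (m* m r)`, the kernel of `ψ` is an ideal not only of `E` but of the
multiplier algebra. -/
theorem map_fst_eq_zero {ψ : E →⋆ₙₐ[ℂ] Y} (m : DoubleCentralizer ℂ E) {r : E} (hr : ψ r = 0) :
    ψ (m.fst r) = 0 := by
  rw [← CStarRing.star_mul_self_eq_zero_iff, ← map_star, ← map_mul]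
  have : star (m.fst r) * m.fst r = star r * (star m * m).fst r := by
    apply coeHom_injective
    rw [map_mul, map_star, ← mul_coeHom, star_mul, map_mul, map_star, ← mul_coeHom]
    simp only [mul_assoc]
  rw [this, map_mul, map_star, hr, star_zero, zero_mul]

/-- The embedding of a kernel as an ideal of the multiplier algebra. -/
def kerIncl (ψ : E →⋆ₙₐ[ℂ] Y) : kerSub ψ →⋆ₙₐ[ℂ] DoubleCentralizer ℂ E :=
  coeHom.comp (NonUnitalStarSubalgebraClass.subtype (kerSub ψ))

theorem kerIncl_injective (ψ : E →⋆ₙₐ[ℂ] Y) : Function.Injective (kerIncl ψ) :=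
  coeHom_injective.comp Subtype.val_injective

theorem exists_kerIncl_eq_mul (ψ : E →⋆ₙₐ[ℂ] Y) (m : DoubleCentralizer ℂ E) (w : kerSub ψ) :
    ∃ w', kerIncl ψ w' = m * kerIncl ψ w :=
  ⟨⟨m.fst w, map_fst_eq_zero m w.2⟩, (mul_coeHom m (w : E)).symm⟩

end Kernel

/-! ### Lifting a symmetry to a multiplier that commutes modulo an ideal -/

section Lifting

variable {E Y M : Type*} [NonUnitalCStarAlgebra E] [NonUnitalCStarAlgebra Y] [CStarAlgebra M]

theorem exists_quasicentral_ker (ψ : E →⋆ₙₐ[ℂ] Y) (X : Finset (DoubleCentralizer ℂ E))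
    (H : Finset (kerSub ψ)) {ε : ℝ} (hε : 0 < ε) :
    ∃ w : E, ψ w = 0 ∧ star w = w ∧ ‖w‖ ≤ 1 ∧
      (∀ x ∈ X, ‖coeHom w * x - x * coeHom w‖ ≤ ε) ∧ ∀ h ∈ H, ‖(h : E) - w * h‖ ≤ ε := by
  let _ := CStarAlgebra.spectralOrder (kerSub ψ)
  let _ := CStarAlgebra.spectralOrderedRing (kerSub ψ)
  obtain ⟨w, h0, h1, h2, h3⟩ := exists_quasicentral (kerIncl ψ) (kerIncl_injective ψ)
    (exists_kerIncl_eq_mul ψ) X H (u₀ := 0) le_rfl (by simp) hε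
  exact ⟨w, w.2, congrArg Subtype.val (IsSelfAdjoint.of_nonneg h0).star_eq, h1.le, h2, h3⟩

/-- The commutator with the multiplier `D` in terms of an ambient algebra. -/
theorem norm_commutator_eq {j : E →⋆ₙₐ[ℂ] M} (hj : Function.Injective j)
    {D : DoubleCentralizer ℂ E} {d : M} (hd : ∀ r, j (D.fst r) = d * j r)
    (hd' : ∀ r, j (D.snd r) = j r * d) (r : E) :
    ‖coeHom r * D - D * coeHom r‖ = ‖j r * d - d * j r‖ := by
  rw [coeHom_mul, mul_coeHom, ← map_sub, NonUnitalStarAlgHom.norm_map _ coeHom_injective,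
    ← NonUnitalStarAlgHom.norm_map j hj, map_sub, hd, hd']

variable {j : E →⋆ₙₐ[ℂ] M} {ψ : E →⋆ₙₐ[ℂ] Y} {D : ℕ → DoubleCentralizer ℂ E} {d : ℕ → M}
  {s : M} {G f : ℕ → E}

/-- If `∑ Gₘ s Gₘ` is a strictly convergent series that commutes with `D` modulo multipliers that
multiply `E` to the ideal `ker ψ`, then its summands can be cut down such that the commutators
become elements of `E`. -/
theorem exists_cut_down (hj : Function.Injective j)
    (hd : ∀ k r, j ((D k).fst r) = d k * j r) (hd' : ∀ k r, j ((D k).snd r) = j r * d k)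
    (hs : star s = s) (hs1 : ‖s‖ ≤ 1) (hG : ∀ m, star (G m) = G m)
    (hf : ∀ m, j (f m) = j (G m) * s * j (G m))
    (hGd : ∀ m k, k ≤ m → ‖j (G m) * d k - d k * j (G m)‖ ≤ (1 / 2 : ℝ) ^ m)
    (hJ : ∀ m k, ∃ e, ψ e = 0 ∧ j e = j (G m) * (s * d k - d k * s) * j (G m))
    (hG1 : ∀ a b, ‖∑ m ∈ Finset.Ico a b, G m * G m‖ ≤ 1)
    (hGr : ∀ r, Tendsto (fun n => ∑ m ∈ Finset.range n, G m * G m * r) atTop (𝓝 r)) :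
    ∃ F : ℕ → E, (∀ m, star (F m) = F m) ∧ (∀ m, ψ (F m) = ψ (f m)) ∧
      (∀ r, CauchySeq fun n => ∑ m ∈ Finset.range n, F m * r) ∧
      ∀ k, Summable fun m => (D k).snd (F m) - (D k).fst (F m) := by
  choose e he0 he using hJ
  -- The cut-offs `w_m` lie in the ideal, almost commute with `G_m` and with `D k` for `k ≤ m`, and
  -- are almost units for the errors `e m k`. All tolerances are `2⁻ᵐ`, so that they sum up.
  have hw : ∀ m, ∃ w : E, ψ w = 0 ∧ star w = w ∧ ‖w‖ ≤ 1 ∧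
      ‖w * G m - G m * w‖ ≤ (1 / 2 : ℝ) ^ m ∧
      (∀ k ≤ m, ‖j w * d k - d k * j w‖ ≤ (1 / 2 : ℝ) ^ m) ∧
      ∀ k ≤ m, ‖e m k - w * e m k‖ ≤ (1 / 2 : ℝ) ^ m := fun m => by
    classical
    obtain ⟨w, h1, h2, h3, h4, h5⟩ := exists_quasicentral_ker ψ
      (insert (coeHom (G m)) ((Finset.range (m + 1)).image D))
      ((Finset.range (m + 1)).image fun k => (⟨e m k, he0 m k⟩ : kerSub ψ))
      (show (0 : ℝ) < (1 / 2 : ℝ) ^ m by positivity)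
    refine ⟨w, h1, h2, h3, ?_, fun k hk => ?_, fun k hk => ?_⟩
    · have := h4 _ (Finset.mem_insert_self _ _)
      rwa [← map_mul, ← map_mul, ← map_sub,
        NonUnitalStarAlgHom.norm_map _ coeHom_injective] at this
    · rw [← norm_commutator_eq hj (hd k) (hd' k)]
      exact h4 _ (Finset.mem_insert_of_mem (Finset.mem_image_of_mem D
        (Finset.mem_range.2 (by lia))))
    · exact h5 ⟨e m k, he0 m k⟩ (Finset.mem_image_of_mem
        (fun k => (⟨e m k, he0 m k⟩ : kerSub ψ)) (Finset.mem_range.2 (by lia)))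
  choose w hw0 hws hw1 hwG hwd hwe using hw
  have hjn : ∀ x, ‖j x‖ = ‖x‖ := NonUnitalStarAlgHom.norm_map j hj
  have hjG : ∀ m, ‖j (G m)‖ ≤ 1 := fun m => by
    have h1 := hG1 m (m + 1)
    rw [Nat.Ico_succ_singleton, Finset.sum_singleton] at h1
    have h2 : ‖G m‖ * ‖G m‖ ≤ 1 := by
      rw [← CStarRing.norm_star_mul_self, hG]; exact h1
    rw [hjn]
    nlinarith [norm_nonneg (G m)]
  have hjGs : ∀ m, star (j (G m)) = j (G m) := fun m => by rw [← map_star, hG]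
  have hfs : ∀ m, star (f m) = f m := fun m => hj (by
    rw [map_star, hf, star_mul, star_mul, hs, hjGs, mul_assoc])
  have hp0 : ∀ m : ℕ, (0 : ℝ) < (1 / 2 : ℝ) ^ m := fun m => by positivity
  have hp1 : ∀ m : ℕ, (1 / 2 : ℝ) ^ m ≤ 1 := fun m => pow_le_one₀ (by norm_num) (by norm_num)
  let c : ℕ → M := fun m => 1 - j (w m)
  have hc : ∀ m, c m = 1 - j (w m) := fun _ => rfl
  have hc2 : ∀ m, ‖c m‖ ≤ 2 := fun m => by
    refine (norm_sub_le _ _).trans ?_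
    have := norm_one_le_one M
    have := hw1 m
    rw [hjn]
    linarith
  -- This is `(1 - w) f (1 - w)`, expanded because `E` has no unit. As `w` lies in the kernel of
  -- `ψ`, it does not differ from `f` there.
  let F : ℕ → E := fun m => f m - w m * f m - f m * w m + w m * f m * w m
  have hF : ∀ m, j (F m) = c m * j (f m) * c m := fun m => by
    simp only [F, map_add, map_sub, map_mul, hc]
    noncomm_ring
  have hFf : ∀ m, ‖j (f m)‖ ≤ 1 := fun m => by
    rw [hf]
    calc _ ≤ ‖j (G m)‖ * ‖s‖ * ‖j (G m)‖ := norm_mul₃_le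
      _ ≤ 1 * 1 * 1 := by gcongr <;> exact hjG m
      _ = 1 := by norm_num
  refine ⟨F, fun m => ?_, fun m => ?_, fun r => ?_, fun k => ?_⟩
  · simp only [F, star_add, star_sub, star_mul, hfs, hws, mul_assoc]
    abel
  · simp only [F, map_add, map_sub, map_mul, hw0]
    simp
  -- With `c = 1 - w` one has `c G = G c + κ`, so `c G s G c` equals `G (c s c) G` up to terms of
  -- order `2⁻ᵐ`. The main series converges strictly by `cauchySeq_sum_conj`, applied to `c s c`,
  -- whose norm is at most `4`.
  · let κ : ℕ → M := fun m => j (G m) * j (w m) - j (w m) * j (G m)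
    have hκ : ∀ m, ‖κ m‖ ≤ (1 / 2 : ℝ) ^ m := fun m => by
      simp only [κ]
      rw [← map_mul, ← map_mul, ← map_sub, hjn, norm_sub_rev]
      exact hwG m
    let rest : ℕ → M := fun m =>
      (κ m * s * c m * j (G m) - j (G m) * c m * s * κ m - κ m * s * κ m) * j r
    have hsplit : ∀ m, j (F m * r) =
        j (G m) * (c m * s * c m) * j (G m) * j r + rest m := fun m => by
      simp only [rest, κ, map_mul, hF, hf, hc]
      noncomm_ring
    have hrest : Summable rest := by
      refine Summable.of_norm_bounded (g := fun m => 5 * ‖r‖ * (1 / 2 : ℝ) ^ m)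
        ((summable_geometric_of_lt_one (by norm_num) (by norm_num)).mul_left _) fun m => ?_
      simp only [rest]
      have h1 : ‖κ m * s * c m * j (G m)‖ ≤ 2 * (1 / 2 : ℝ) ^ m := by
        calc _ ≤ ‖κ m‖ * ‖s‖ * ‖c m‖ * ‖j (G m)‖ := by
              refine (norm_mul_le _ _).trans ?_
              gcongr
              exact norm_mul₃_le
          _ ≤ (1 / 2 : ℝ) ^ m * 1 * 2 * 1 := by
              gcongr
              exacts [hκ m, hc2 m, hjG m]
          _ = _ := by ring
      have h2 : ‖j (G m) * c m * s * κ m‖ ≤ 2 * (1 / 2 : ℝ) ^ m := by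
        calc _ ≤ ‖j (G m)‖ * ‖c m‖ * ‖s‖ * ‖κ m‖ := by
              refine (norm_mul_le _ _).trans ?_
              gcongr
              exact norm_mul₃_le
          _ ≤ 1 * 2 * 1 * (1 / 2 : ℝ) ^ m := by
              gcongr
              exacts [hjG m, hc2 m, hκ m]
          _ = _ := by ring
      have h3 : ‖κ m * s * κ m‖ ≤ (1 / 2 : ℝ) ^ m := by
        calc _ ≤ ‖κ m‖ * ‖s‖ * ‖κ m‖ := norm_mul₃_le
          _ ≤ 1 * 1 * (1 / 2 : ℝ) ^ m := by
              gcongr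
              exacts [(hκ m).trans (hp1 m), hκ m]
          _ = _ := by ring
      refine (norm_mul_le _ _).trans ?_
      rw [hjn]
      have h4 : ‖κ m * s * c m * j (G m) - j (G m) * c m * s * κ m - κ m * s * κ m‖ ≤
          5 * (1 / 2 : ℝ) ^ m := by
        refine (norm_sub_le _ _).trans ?_
        linarith [norm_sub_le (κ m * s * c m * j (G m)) (j (G m) * c m * s * κ m)]
      calc _ ≤ 5 * (1 / 2 : ℝ) ^ m * ‖r‖ := by gcongr
        _ = _ := by ring
    have h1 : CauchySeq fun n => ∑ m ∈ Finset.range n,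
        j (G m) * (c m * s * c m) * j (G m) * j r := by
      refine cauchySeq_sum_conj (G := fun m => j (G m)) (B := fun m => c m * s * c m) hjGs
        (fun a b => ?_) (K := 4) (fun m => ?_) (j r) ?_
      · simp only [← map_mul, ← map_sum]
        rw [hjn]
        exact hG1 a b
      · calc _ ≤ ‖c m‖ * ‖s‖ * ‖c m‖ := norm_mul₃_le
          _ ≤ 2 * 1 * 2 := by gcongr <;> exact hc2 m
          _ = 4 := by norm_num
      · simp only [← map_mul, ← map_sum]
        exact (((hom_continuous j).tendsto _).comp (hGr r)).cauchySeq
    have h2 := h1.add hrest.hasSum.tendsto_sum_nat.cauchySeq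
    have h3 : CauchySeq fun n => j (∑ m ∈ Finset.range n, F m * r) := by
      refine (congrArg CauchySeq (funext fun n => ?_)).mp h2
      rw [Pi.add_apply, map_sum, ← Finset.sum_add_distrib]
      exact Finset.sum_congr rfl fun m _ => (hsplit m).symm
    exact (AddMonoidHomClass.isometry_of_norm j hjn).isUniformInducing.cauchy_map_iff.1 h3
  · refine Summable.of_norm_bounded_eventually_nat (g := fun m => 14 * (1 / 2 : ℝ) ^ m)
      ((summable_geometric_of_lt_one (by norm_num) (by norm_num)).mul_left _) ?_
    filter_upwards [eventually_ge_atTop k] with m hm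
    rw [← hjn, map_sub, hd, hd', hF]
    have hcd : ‖c m * d k - d k * c m‖ ≤ (1 / 2 : ℝ) ^ m := by
      rw [show c m * d k - d k * c m = -(j (w m) * d k - d k * j (w m)) by
        simp only [hc]; noncomm_ring, norm_neg]
      exact hwd m k hm
    have hce : ‖c m * j (e m k)‖ ≤ (1 / 2 : ℝ) ^ m := by
      rw [hc, sub_mul, one_mul, ← map_mul, ← map_sub, hjn]
      exact hwe m k hm
    have hGd' := hGd m k hm
    set g := j (G m)
    set z := g * d k - d k * g with hz
    set y := c m * d k - d k * c m with hy
    -- The commutator of `c f c` with `d` has two terms with `[c, d]` and the term `c [f, d] c`. The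
    -- latter splits according to `[G s G, d] = G s [G, d] + G [s, d] G + [G, d] s G`, whose middle
    -- term is `e` and is made small by `c`. The bounds `2 + 2 + 2 + 4 + 4` give the constant `14`.
    have hsplit : c m * j (f m) * c m * d k - d k * (c m * j (f m) * c m) =
        y * j (f m) * c m + c m * j (f m) * y + c m * j (e m k) * c m +
          c m * (g * s * z) * c m + c m * (z * s * g) * c m := by
      rw [he, hf, hz, hy]
      noncomm_ring
    rw [hsplit]
    have h1 : ‖y * j (f m) * c m‖ ≤ 2 * (1 / 2 : ℝ) ^ m := by
      calc _ ≤ ‖y‖ * ‖j (f m)‖ * ‖c m‖ := norm_mul₃_le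
        _ ≤ (1 / 2 : ℝ) ^ m * 1 * 2 := by
            gcongr
            exacts [hFf m, hc2 m]
        _ = _ := by ring
    have h2 : ‖c m * j (f m) * y‖ ≤ 2 * (1 / 2 : ℝ) ^ m := by
      calc _ ≤ ‖c m‖ * ‖j (f m)‖ * ‖y‖ := norm_mul₃_le
        _ ≤ 2 * 1 * (1 / 2 : ℝ) ^ m := by
            gcongr
            exacts [hc2 m, hFf m]
        _ = _ := by ring
    have h3 : ‖c m * j (e m k) * c m‖ ≤ 2 * (1 / 2 : ℝ) ^ m := by
      calc _ ≤ ‖c m * j (e m k)‖ * ‖c m‖ := norm_mul_le _ _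
        _ ≤ (1 / 2 : ℝ) ^ m * 2 := by
            gcongr
            exact hc2 m
        _ = _ := by ring
    have hg1 : ‖g‖ ≤ 1 := hjG m
    have h4 : ‖c m * (g * s * z) * c m‖ ≤ 4 * (1 / 2 : ℝ) ^ m := by
      calc _ ≤ ‖c m‖ * (‖g‖ * ‖s‖ * ‖z‖) * ‖c m‖ := by
            refine norm_mul₃_le.trans ?_
            gcongr
            exact norm_mul₃_le
        _ ≤ 2 * (1 * 1 * (1 / 2 : ℝ) ^ m) * 2 := by
            gcongr
            exacts [hc2 m, hc2 m]
        _ = _ := by ring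
    have h5 : ‖c m * (z * s * g) * c m‖ ≤ 4 * (1 / 2 : ℝ) ^ m := by
      calc _ ≤ ‖c m‖ * (‖z‖ * ‖s‖ * ‖g‖) * ‖c m‖ := by
            refine norm_mul₃_le.trans ?_
            gcongr
            exact norm_mul₃_le
        _ ≤ 2 * ((1 / 2 : ℝ) ^ m * 1 * 1) * 2 := by
            gcongr
            exacts [hc2 m, hc2 m]
        _ = _ := by ring
    refine (norm_add_le _ _).trans ?_
    refine (add_le_add_left (norm_add_le _ _) _).trans ?_
    refine (add_le_add_left (add_le_add_left (norm_add_le _ _) _) _).trans ?_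
    linarith [norm_add_le (y * j (f m) * c m) (c m * j (f m) * y)]

/-- Existence of a self-adjoint multiplier that lifts the limit of the series `∑ ψ(Gₘ s Gₘ)` and
whose commutators with `D` belong to `E`. -/
theorem exists_multiplier_lift (hj : Function.Injective j)
    (hd : ∀ k r, j ((D k).fst r) = d k * j r) (hd' : ∀ k r, j ((D k).snd r) = j r * d k)
    (hs : star s = s) (hs1 : ‖s‖ ≤ 1) (hG : ∀ m, star (G m) = G m)
    (hf : ∀ m, j (f m) = j (G m) * s * j (G m))
    (hGd : ∀ m k, k ≤ m → ‖j (G m) * d k - d k * j (G m)‖ ≤ (1 / 2 : ℝ) ^ m)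
    (hJ : ∀ m k, ∃ e, ψ e = 0 ∧ j e = j (G m) * (s * d k - d k * s) * j (G m))
    (hG1 : ∀ a b, ‖∑ m ∈ Finset.Ico a b, G m * G m‖ ≤ 1)
    (hGr : ∀ r, Tendsto (fun n => ∑ m ∈ Finset.range n, G m * G m * r) atTop (𝓝 r))
    {L : Y →L[ℂ] Y} (hL : ∀ m r, ψ (f m * r) = L (ψ (G m * G m * r))) :
    ∃ S : DoubleCentralizer ℂ E, star S = S ∧ (∀ r, ψ (S.fst r) = L (ψ r)) ∧
      ∀ k, IsInner (S * D k - D k * S) := by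
  obtain ⟨F, hFs, hFψ, hFc, hFd⟩ := exists_cut_down hj hd hd' hs hs1 hG hf hGd hJ hG1 hGr
  obtain ⟨S, hS, hSr⟩ := exists_multiplier_of_strict hFs hFc
  refine ⟨S, hS, fun r => ?_, fun k => ?_⟩
  · have h1 := ((hom_continuous ψ).tendsto _).comp (hSr r)
    have h2 := (L.continuous.tendsto _).comp (((hom_continuous ψ).tendsto _).comp (hGr r))
    refine tendsto_nhds_unique h1 (h2.congr fun n => ?_)
    simp only [Function.comp_apply, map_sum]
    refine Finset.sum_congr rfl fun m _ => ?_
    rw [← hL, map_mul, map_mul, hFψ]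
  -- The commutator of `S` with `D k` is the sum of the commutators of the `F m`, and this series
  -- converges in the norm of `E`.
  · refine ⟨∑' m, ((D k).snd (F m) - (D k).fst (F m)), ext_fst fun r => ?_⟩
    rw [coeHom_fst_apply]
    have h1 := ((hFd k).hasSum.tendsto_sum_nat).mul_const r
    have h2 := (hSr ((D k).fst r)).sub (((D k).fst.continuous.tendsto _).comp (hSr r))
    refine tendsto_nhds_unique h1 (h2.congr fun n => ?_)
    simp only [Function.comp_apply, map_sum]
    rw [← Finset.sum_sub_distrib, Finset.sum_mul]
    refine Finset.sum_congr rfl fun m _ => ?_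
    rw [sub_mul, (D k).central, fst_mul]

end Lifting

open DoubleCentralizer Filter

/-! ### Separability of `QA` and `qA` -/

section Separable

open TopologicalSpace

/-- The elements obtained from a set by at most `n` rounds of algebraic operations. -/
def algStage {Y : Type*} [NonUnitalCStarAlgebra Y] (s : Set Y) : ℕ → Set Y
  | 0 => s
  | n + 1 => algStage s n ∪ ((fun p : Y × Y => p.1 + p.2) '' (algStage s n ×ˢ algStage s n) ∪
      ((fun p : Y × Y => p.1 * p.2) '' (algStage s n ×ˢ algStage s n) ∪
        (fun p : ℂ × Y => p.1 • p.2) '' (Set.univ ×ˢ algStage s n)))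

theorem isSeparable_algStage {Y : Type*} [NonUnitalCStarAlgebra Y] {s : Set Y}
    (hs : IsSeparable s) : ∀ n, IsSeparable (algStage s n)
  | 0 => hs
  | n + 1 =>
    have h := isSeparable_algStage hs n
    h.union (((h.prod h).image continuous_add).union (((h.prod h).image continuous_mul).union
      (((IsSeparable.of_separableSpace Set.univ).prod h).image continuous_smul)))

theorem monotone_algStage {Y : Type*} [NonUnitalCStarAlgebra Y] (s : Set Y) :
    Monotone (algStage s) :=
  monotone_nat_of_le_succ fun _ => Set.subset_union_left

variable (A : Type*) [NonUnitalCStarAlgebra A] [SeparableSpace A]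

/-- The stages generated by the two copies of `A` are separable, and their union is dense by
`Q_induction`. Adjoints are not needed as an operation, since the copies of `A` are already
self-adjoint. -/
instance separableSpace_Q : SeparableSpace (Q A) := by
  set s : Set (Q A) := Set.range (iota A) ∪ Set.range (iotaBar A) with hs
  have hsep : IsSeparable s := (isSeparable_range (hom_continuous (iota A))).union
    (isSeparable_range (hom_continuous (iotaBar A)))
  have h2 : ∀ x ∈ ⋃ n, algStage s n, ∀ y ∈ ⋃ n, algStage s n,
      ∃ n, x ∈ algStage s n ∧ y ∈ algStage s n := fun x hx y hy => by
    obtain ⟨m, hm⟩ := Set.mem_iUnion.1 hx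
    obtain ⟨n, hn⟩ := Set.mem_iUnion.1 hy
    exact ⟨max m n, monotone_algStage s (le_max_left _ _) hm,
      monotone_algStage s (le_max_right _ _) hn⟩
  have h0 : ∀ x ∈ s, x ∈ closure (⋃ n, algStage s n) := fun x hx =>
    subset_closure (Set.mem_iUnion.2 ⟨0, hx⟩)
  rw [← isSeparable_univ_iff]
  refine (IsSeparable.iUnion (isSeparable_algStage hsep)).closure.mono fun y _ => ?_
  refine Q_induction (P := fun y => y ∈ closure (⋃ n, algStage s n)) y isClosed_closure ?_ ?_ ?_ ?_
    ?_ ?_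
  · exact h0 _ (Or.inl ⟨0, map_zero _⟩)
  · refine fun x y hx hy => map_mem_closure₂ continuous_add hx hy fun a ha b hb => ?_
    obtain ⟨n, h1, h2⟩ := h2 a ha b hb
    exact Set.mem_iUnion.2 ⟨n + 1, Or.inr (Or.inl ⟨(a, b), ⟨h1, h2⟩, rfl⟩)⟩
  · refine fun c x hx => map_mem_closure (continuous_const_smul c) hx fun a ha => ?_
    obtain ⟨n, h1⟩ := Set.mem_iUnion.1 ha
    exact Set.mem_iUnion.2 ⟨n + 1, Or.inr (Or.inr (Or.inr ⟨(c, a), ⟨trivial, h1⟩, rfl⟩))⟩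
  · refine fun x y hx hy => map_mem_closure₂ continuous_mul hx hy fun a ha b hb => ?_
    obtain ⟨n, h1, h2⟩ := h2 a ha b hb
    exact Set.mem_iUnion.2 ⟨n + 1, Or.inr (Or.inr (Or.inl ⟨(a, b), ⟨h1, h2⟩, rfl⟩))⟩
  · exact fun a => h0 _ (Or.inl ⟨a, rfl⟩)
  · exact fun a => h0 _ (Or.inr ⟨a, rfl⟩)

/-- For metric spaces separability passes to subspaces by way of second countability. -/
theorem separableSpace_of_injective {X Y : Type*} [NonUnitalCStarAlgebra X]
    [NonUnitalCStarAlgebra Y] [SeparableSpace Y] (f : X →⋆ₙₐ[ℂ] Y) (hf : Function.Injective f) :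
    SeparableSpace X := by
  have := UniformSpace.secondCountable_of_separable Y
  have := (AddMonoidHomClass.isometry_of_norm f
    (NonUnitalStarAlgHom.norm_map f hf)).isEmbedding.isInducing.secondCountableTopology
  infer_instance

instance separableSpace_q : SeparableSpace (q A) :=
  separableSpace_of_injective (qIncl A) qIncl_injective

end Separable

/-! ### Quasicentral partitions -/

section Partition

variable {I N : Type*} [NonUnitalCStarAlgebra I] [NonUnitalCStarAlgebra N]

/-- The estimate for square roots needs a unit; the unitization of `N` supplies it without changing
norms. -/
theorem exists_norm_map_commutator_le [PartialOrder I] [StarOrderedRing I] (i : I →⋆ₙₐ[ℂ] N)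
    (C : ℝ) {ε : ℝ} (hε : 0 < ε) : ∃ δ > 0, ∀ (g : I) (x : N), 0 ≤ g → ‖g‖ ≤ 1 → ‖x‖ ≤ C →
      ‖i (g * g) * x - x * i (g * g)‖ ≤ δ → ‖i g * x - x * i g‖ ≤ ε := by
  let _ := CStarAlgebra.spectralOrder (Unitization ℂ N)
  let _ := CStarAlgebra.spectralOrderedRing (Unitization ℂ N)
  obtain ⟨δ, hδ, h⟩ := exists_norm_commutator_le_of_sq (Unitization ℂ N) C hε
  refine ⟨δ, hδ, fun g x hg hg1 hx hgx => ?_⟩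
  let e : N →⋆ₙₐ[ℂ] Unitization ℂ N := Unitization.inrNonUnitalStarAlgHom ℂ N
  have he : ∀ y, ‖e y‖ = ‖y‖ := fun y => Unitization.norm_inr y
  have h1 : 0 ≤ e (i g) := by
    rw [← CFC.sqrt_mul_sqrt_self g hg]
    nth_rw 1 [← (IsSelfAdjoint.of_nonneg (CFC.sqrt_nonneg g)).star_eq]
    rw [map_mul, map_mul, map_star, map_star]
    exact star_mul_self_nonneg _
  have h2 := h (e (i g)) (e x) h1
    ((he _).trans_le ((NonUnitalStarAlgHom.norm_apply_le i g).trans hg1)) ((he x).trans_le hx)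
    (by simpa only [← map_mul, ← map_sub, he] using hgx)
  simpa only [← map_mul, ← map_sub, he] using h2

/-- A separable ideal has a partition of unity, in the strict sense, into squares of elements
that approximately commute with given multipliers. -/
theorem exists_quasicentral_partition [TopologicalSpace.SeparableSpace I] (i : I →⋆ₙₐ[ℂ] N)
    (hi : Function.Injective i) (hid : ∀ (b : N) (x : I), ∃ y, i y = b * i x) (d : ℕ → N) :
    ∃ g : ℕ → I, (∀ m, star (g m) = g m) ∧
      (∀ m k, k ≤ m → ‖i (g m) * d k - d k * i (g m)‖ ≤ (1 / 2 : ℝ) ^ m) ∧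
      (∀ a b, ‖∑ m ∈ Finset.Ico a b, g m * g m‖ ≤ 1) ∧
      ∀ z, Tendsto (fun n => ∑ m ∈ Finset.range n, g m * g m * z) atTop (𝓝 z) := by
  classical
  let _ := CStarAlgebra.spectralOrder I
  let _ := CStarAlgebra.spectralOrderedRing I
  let z := TopologicalSpace.denseSeq I
  -- The sum of the norms bounds each of the finitely many `d k` with `k ≤ m`.
  have hδ := fun m : ℕ => exists_norm_map_commutator_le i (∑ k ∈ Finset.range (m + 1), ‖d k‖)
    (show (0 : ℝ) < (1 / 2 : ℝ) ^ m by positivity)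
  choose δ hδ0 hδ using hδ
  -- The element `u (n + 1)` enters both `g n ^ 2 = u (n + 1) - u n` and `g (n + 1) ^ 2`, so it has
  -- to respect half of both tolerances, and the indices `k` up to `n + 1`.
  have hstep : ∀ (n : ℕ) (u : {u : I // 0 ≤ u ∧ ‖u‖ < 1}), ∃ v : {u : I // 0 ≤ u ∧ ‖u‖ < 1},
      u.1 ≤ v.1 ∧ (∀ k ≤ n + 1, ‖i v.1 * d k - d k * i v.1‖ ≤ min (δ n) (δ (n + 1)) / 2) ∧
      ∀ k ≤ n, ‖z k - v.1 * z k‖ ≤ (1 / 2 : ℝ) ^ n := fun n u => by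
    have h0 : 0 < min (min (δ n) (δ (n + 1)) / 2) ((1 / 2 : ℝ) ^ n) :=
      lt_min (half_pos (lt_min (hδ0 _) (hδ0 _))) (by positivity)
    obtain ⟨v, h1, h2, h3, h4⟩ := exists_quasicentral i hi hid
      ((Finset.range (n + 2)).image d) ((Finset.range (n + 1)).image z) u.2.1 u.2.2 h0
    exact ⟨⟨v, u.2.1.trans h1, h2⟩, h1,
      fun k hk => (h3 _ (Finset.mem_image_of_mem d (Finset.mem_range.2 (by lia)))).trans
        (min_le_left _ _),
      fun k hk => (h4 _ (Finset.mem_image_of_mem z (Finset.mem_range.2 (by lia)))).trans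
        (min_le_right _ _)⟩
  obtain ⟨u, hu0, hu⟩ := exists_seq_of_step (⟨0, le_rfl, by simp⟩ : {u : I // 0 ≤ u ∧ ‖u‖ < 1})
    hstep
  have hmono : Monotone fun n => (u n).1 := monotone_nat_of_le_succ fun n => (hu n).1
  let g : ℕ → I := fun m => CFC.sqrt ((u (m + 1)).1 - (u m).1)
  have hgg : ∀ m, g m * g m = (u (m + 1)).1 - (u m).1 := fun m =>
    CFC.sqrt_mul_sqrt_self _ (sub_nonneg.2 (hu m).1)
  have hg0 : ∀ m, 0 ≤ g m := fun m => CFC.sqrt_nonneg _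
  have hgs : ∀ m, star (g m) = g m := fun m => (IsSelfAdjoint.of_nonneg (hg0 m)).star_eq
  have hsub : ∀ a b, a ≤ b → ‖(u b).1 - (u a).1‖ ≤ 1 := fun a b h =>
    (CStarAlgebra.norm_le_norm_of_nonneg_of_le (sub_nonneg.2 (hmono h))
      (sub_le_self _ (u a).2.1)).trans (u b).2.2.le
  refine ⟨g, hgs, fun m k hk => ?_, fun a b => ?_, fun y => ?_⟩
  · refine hδ m (g m) (d k) (hg0 m) ?_ ?_ ?_
    · have h1 : ‖g m‖ * ‖g m‖ ≤ 1 := by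
        rw [← CStarRing.norm_star_mul_self, hgs, hgg]
        exact hsub _ _ m.le_succ
      nlinarith [norm_nonneg (g m)]
    · exact Finset.single_le_sum (f := fun k => ‖d k‖) (fun _ _ => norm_nonneg _)
        (Finset.mem_range.2 (by lia))
    · have h1 : ‖i (u (m + 1)).1 * d k - d k * i (u (m + 1)).1‖ ≤ δ m / 2 :=
        ((hu m).2.1 k (by lia)).trans (by gcongr; exact min_le_left _ _)
      have h2 : ‖i (u m).1 * d k - d k * i (u m).1‖ ≤ δ m / 2 := by
        -- The initial element `u 0 = 0` is not produced by the recursion step, but its commutators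
        -- vanish.
        cases m with
        | zero =>
          rw [hu0]
          simpa using (half_pos (hδ0 0)).le
        | succ m => exact ((hu m).2.1 k hk).trans (by gcongr; exact min_le_right _ _)
      rw [hgg, map_sub, show ∀ x y w : N, (x - y) * w - w * (x - y) =
        (x * w - w * x) - (y * w - w * y) by intros; noncomm_ring]
      refine (norm_sub_le _ _).trans ?_
      linarith
  · simp only [hgg]
    rcases le_total a b with h | h
    · rw [Finset.sum_Ico_sub (fun m => (u m).1) h]
      exact hsub a b h
    · rw [Finset.Ico_eq_empty_of_le h]
      simp
  · have hsum : ∀ n, ∑ m ∈ Finset.range n, g m * g m * y = (u n).1 * y := fun n => by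
      rw [← Finset.sum_mul]
      simp only [hgg]
      rw [Finset.sum_range_sub (fun m => (u m).1), hu0, sub_zero]
    simp only [hsum]
    rw [Metric.tendsto_atTop']
    intro ε hε
    obtain ⟨j, hj⟩ := (TopologicalSpace.denseRange_denseSeq I).exists_dist_lt y
      (show 0 < ε / 3 by positivity)
    obtain ⟨n₀, hn₀⟩ := exists_pow_lt_of_lt_one (show 0 < ε / 3 by positivity)
      (show (1 / 2 : ℝ) < 1 by norm_num)
    refine ⟨max j n₀, fun n hn => ?_⟩
    obtain ⟨n, rfl⟩ : ∃ n', n = n' + 1 := ⟨n - 1, by lia⟩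
    have h1 := (hu n).2.2 j (by have := le_max_left j n₀; lia)
    have h2 : (1 / 2 : ℝ) ^ n ≤ (1 / 2 : ℝ) ^ n₀ :=
      pow_le_pow_of_le_one (by norm_num) (by norm_num) (by have := le_max_right j n₀; lia)
    have h3 : ‖(u (n + 1)).1 * (y - z j)‖ ≤ ‖y - z j‖ :=
      (norm_mul_le _ _).trans (mul_le_of_le_one_left (norm_nonneg _) (u (n + 1)).2.2.le)
    rw [dist_eq_norm] at hj ⊢
    have h4 : (u (n + 1)).1 * y - y = (u (n + 1)).1 * (y - z j) - (z j - (u (n + 1)).1 * z j) -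
        (y - z j) := by noncomm_ring
    rw [h4]
    have h5 := norm_sub_le ((u (n + 1)).1 * (y - z j) - (z j - (u (n + 1)).1 * z j)) (y - z j)
    have h6 := norm_sub_le ((u (n + 1)).1 * (y - z j)) (z j - (u (n + 1)).1 * z j)
    change ‖y - z j‖ < ε / 3 at hj
    linarith

end Partition

open DoubleCentralizer Filter

/-! ### Existence of the universal map -/

namespace Symmetry

variable {Y : Type*} [NonUnitalCStarAlgebra Y] (s : Symmetry Y)

/-- The multiplier given by a symmetry. -/
def mult : DoubleCentralizer ℂ Y where
  fst := s.L
  snd := s.R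
  central := s.R_mul

theorem star_mult : star s.mult = s.mult :=
  ext_fst fun r => by
    rw [star_fst]
    change star (s.R (star r)) = s.L r
    rw [s.star_R, star_star]

theorem norm_mult_le : ‖s.mult‖ ≤ 1 := by
  have h : s.mult * s.mult = 1 := ext_fst fun r => s.L_L r
  have h1 : ‖s.mult‖ * ‖s.mult‖ ≤ 1 := by
    rw [← CStarRing.norm_star_mul_self, s.star_mult, h]
    exact norm_one_le_one _
  nlinarith [norm_nonneg s.mult]

theorem mult_mul_coeHom (y : Y) : s.mult * coeHom y = coeHom (s.L y) := mul_coeHom _ _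

end Symmetry

section Approx

variable {N : Type*} [NonUnitalCStarAlgebra N]

theorem isClosed_setOf_tendsto_mul {U : ℕ → N} (hU : ∀ n, ‖U n‖ ≤ 1) :
    IsClosed {x | Tendsto (fun n => U n * x) atTop (𝓝 x)} := by
  refine isClosed_of_closure_subset fun x hx => ?_
  rw [Set.mem_ofPred_eq, Metric.tendsto_atTop]
  intro ε hε
  obtain ⟨y, hy, hxy⟩ := Metric.mem_closure_iff.1 hx (ε / 3) (by positivity)
  obtain ⟨n₀, hn₀⟩ := Metric.tendsto_atTop.1 hy (ε / 3) (by positivity)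
  refine ⟨n₀, fun n hn => ?_⟩
  have h1 := hn₀ n hn
  rw [dist_eq_norm] at hxy h1 ⊢
  have h3 : ‖U n * (x - y)‖ ≤ ‖x - y‖ :=
    (norm_mul_le _ _).trans (mul_le_of_le_one_left (norm_nonneg _) (hU n))
  have h4 : U n * x - x = U n * (x - y) + (U n * y - y) - (x - y) := by noncomm_ring
  rw [h4]
  have h5 := norm_sub_le (U n * (x - y) + (U n * y - y)) (x - y)
  have h6 := norm_add_le (U n * (x - y)) (U n * y - y)
  linarith

/-- The elements for which a sequence is an approximate left unit, together with their adjoints. -/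
def approxSubalgebra (U : ℕ → N) : NonUnitalStarSubalgebra ℂ N where
  carrier := {x | Tendsto (fun n => U n * x) atTop (𝓝 x) ∧
    Tendsto (fun n => U n * star x) atTop (𝓝 (star x))}
  add_mem' := fun {x y} hx hy => by
    simp only [Set.mem_ofPred_eq, mul_add, star_add]
    exact ⟨hx.1.add hy.1, hx.2.add hy.2⟩
  zero_mem' := by simp
  mul_mem' := fun {x y} hx hy => by
    simp only [Set.mem_ofPred_eq, star_mul, ← mul_assoc]
    exact ⟨hx.1.mul_const y, hy.2.mul_const (star x)⟩
  smul_mem' := fun c x hx => by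
    simp only [Set.mem_ofPred_eq, mul_smul_comm, star_smul]
    exact ⟨hx.1.const_smul c, hx.2.const_smul (star c)⟩
  star_mem' := fun {x} hx => by
    simp only [Set.mem_ofPred_eq, star_star]
    exact ⟨hx.2, hx.1⟩

theorem isClosed_approxSubalgebra {U : ℕ → N} (hU : ∀ n, ‖U n‖ ≤ 1) :
    IsClosed (approxSubalgebra U : Set N) :=
  (isClosed_setOf_tendsto_mul hU).inter ((isClosed_setOf_tendsto_mul hU).preimage continuous_star)

end Approx

/-! ### Flip and partition of unity for the algebra `R` -/

section Concrete

variable {X Y : Type*} [NonUnitalCStarAlgebra X] [NonUnitalCStarAlgebra Y]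

theorem continuous_matUnit (i j : Fin 2) : Continuous fun y : Y => matUnit i j y := by
  refine continuous_mat_iff.2 fun k l => ?_
  by_cases h : i = k ∧ j = l
  · simpa [matUnit, Matrix.single, h] using continuous_id'
  · simpa [matUnit, Matrix.single, h] using continuous_const

theorem dsum_mul_matUnit_zero (f g : X →⋆ₙₐ[ℂ] Y) (x : X) (j : Fin 2) (y : Y) :
    dsum f g x * matUnit 0 j y = matUnit 0 j (f x * y) := by
  refine mat_ext ?_ ?_ ?_ ?_ <;> fin_cases j <;>
    simp [dsum, matUnit, CStarMatrix.mul_apply, Matrix.single]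

theorem dsum_mul_matUnit_one (f g : X →⋆ₙₐ[ℂ] Y) (x : X) (j : Fin 2) (y : Y) :
    dsum f g x * matUnit 1 j y = matUnit 1 j (g x * y) := by
  refine mat_ext ?_ ?_ ?_ ?_ <;> fin_cases j <;>
    simp [dsum, matUnit, CStarMatrix.mul_apply, Matrix.single]

theorem star_matUnit (i j : Fin 2) (y : Y) : star (matUnit i j y) = matUnit j i (star y) := by
  refine mat_ext ?_ ?_ ?_ ?_ <;> fin_cases i <;> fin_cases j <;>
    simp [matUnit, CStarMatrix.star_apply, Matrix.single]

theorem diag_mul_flip2_diag (a b a' b' : Y) :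
    (CStarMatrix.ofMatrix !![a, 0; 0, b] : CStarMatrix (Fin 2) (Fin 2) Y) *
      (flip2 Y).L (CStarMatrix.ofMatrix !![a', 0; 0, b']) =
      matUnit 0 1 (a * b') + matUnit 1 0 (b * a') := by
  refine mat_ext ?_ ?_ ?_ ?_ <;>
    simp [matUnit, CStarMatrix.mul_apply, Matrix.single, flip2_L_apply]

theorem mat2_flip2_L (f : X →⋆ₙₐ[ℂ] Y) (M : CStarMatrix (Fin 2) (Fin 2) X) :
    mat2 f ((flip2 X).L M) = (flip2 Y).L (mat2 f M) := rfl

theorem flip2_diag_self (a : Y) :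
    (flip2 Y).R (CStarMatrix.ofMatrix !![a, 0; 0, a]) =
      (flip2 Y).L (CStarMatrix.ofMatrix !![a, 0; 0, a]) := by
  refine mat_ext ?_ ?_ ?_ ?_ <;> simp [flip2_L_apply, flip2_R_apply]

theorem flip2_dsum_self (f : X →⋆ₙₐ[ℂ] Y) (x : X) (M : CStarMatrix (Fin 2) (Fin 2) Y) :
    (flip2 Y).L (dsum f f x * M) = dsum f f x * (flip2 Y).L M := by
  rw [(flip2 Y).L_mul, ← (flip2 Y).R_mul]
  exact congrArg (· * M) (flip2_diag_self (f x)).symm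

theorem diag_mul_diag (a b a' b' : Y) :
    (CStarMatrix.ofMatrix !![a, 0; 0, b] : CStarMatrix (Fin 2) (Fin 2) Y) *
      CStarMatrix.ofMatrix !![a', 0; 0, b'] = CStarMatrix.ofMatrix !![a * a', 0; 0, b * b'] := by
  refine mat_ext ?_ ?_ ?_ ?_ <;> simp [CStarMatrix.mul_apply]

variable {A : Type*} [NonUnitalCStarAlgebra A]

theorem exists_offDiag (a b a' b' : q A) : ∃ f : R A,
    inclR A f = inclR A (diagR a b) * (flip2 (Q (Q A))).L (inclR A (diagR a' b')) ∧
    foldRHom A f = matUnit 0 1 (qIncl A a * qIncl A b') + matUnit 1 0 (qIncl A b * qIncl A a') := by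
  have h : matUnit 0 1 (eta A (qIncl A a) * etaBar A (qIncl A b')) +
      matUnit 1 0 (etaBar A (qIncl A b) * eta A (qIncl A a')) ∈ R A :=
    add_mem (mem_R_of_RGen (Or.inr (Or.inl ⟨a, b', rfl⟩)))
      (mem_R_of_RGen (Or.inr (Or.inr (Or.inl ⟨b, a', rfl⟩))))
  have h1 : inclR A ⟨_, h⟩ =
      inclR A (diagR a b) * (flip2 (Q (Q A))).L (inclR A (diagR a' b')) := by
    rw [inclR_apply, inclR_diagR, inclR_diagR, diag_mul_flip2_diag]
  refine ⟨⟨_, h⟩, h1, ?_⟩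
  rw [foldRHom, NonUnitalStarAlgHom.comp_apply, h1, map_mul, mat2_flip2_L,
    ← NonUnitalStarAlgHom.comp_apply, ← NonUnitalStarAlgHom.comp_apply, ← foldRHom,
    foldRHom_diagR, foldRHom_diagR, diag_mul_flip2_diag]

theorem exists_qIncl_eq_mul_right (y : Q A) (z : q A) : ∃ w, qIncl A w = qIncl A z * y := by
  obtain ⟨w, hw⟩ := exists_qIncl_eq_mul A (star y) (star z)
  exact ⟨star w, by rw [map_star, hw, star_mul, star_star, map_star, star_star]⟩

/-- Every generator of `R` begins on the left with an element of `η(qA)` or `η̄(qA)` in the matching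
row, where `u n` acts as an approximate unit; the same holds for adjoints. -/
theorem tendsto_diagRHom_mul {u : ℕ → q A} (hu : ∀ n, ‖u n‖ ≤ 1)
    (h : ∀ z, Tendsto (fun n => u n * z) atTop (𝓝 z)) (r : R A) :
    Tendsto (fun n => diagRHom (NonUnitalStarAlgHom.id ℂ (q A)) (NonUnitalStarAlgHom.id ℂ (q A))
      (u n) * r) atTop (𝓝 r) := by
  set δ := diagRHom (NonUnitalStarAlgHom.id ℂ (q A)) (NonUnitalStarAlgHom.id ℂ (q A))
  set F := (eta A).comp ((qIncl A).comp (NonUnitalStarAlgHom.id ℂ (q A)))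
  set G := (etaBar A).comp ((qIncl A).comp (NonUnitalStarAlgHom.id ℂ (q A)))
  have hδ : ∀ z, inclR A (δ z) = dsum F G z := DFunLike.congr_fun (inclR_comp_diagRHom _ _)
  have hF : ∀ (z : q A) (j : Fin 2) (y : Q (Q A)), Tendsto
      (fun n => dsum F G (u n) * matUnit 0 j (F z * y)) atTop (𝓝 (matUnit 0 j (F z * y))) :=
    fun z j y => by
      refine (((continuous_matUnit 0 j).tendsto _).comp ((((hom_continuous F).tendsto z).comp
        (h z)).mul_const y)).congr fun n => ?_
      rw [dsum_mul_matUnit_zero, ← mul_assoc, ← map_mul]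
      rfl
  have hG : ∀ (z : q A) (j : Fin 2) (y : Q (Q A)), Tendsto
      (fun n => dsum F G (u n) * matUnit 1 j (G z * y)) atTop (𝓝 (matUnit 1 j (G z * y))) :=
    fun z j y => by
      refine (((continuous_matUnit 1 j).tendsto _).comp ((((hom_continuous G).tendsto z).comp
        (h z)).mul_const y)).congr fun n => ?_
      rw [dsum_mul_matUnit_one, ← mul_assoc, ← map_mul]
      rfl
  have hF' : ∀ (z : q A), Tendsto
      (fun n => dsum F G (u n) * matUnit 0 0 (F z)) atTop (𝓝 (matUnit 0 0 (F z))) :=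
    fun z => by
      refine (((continuous_matUnit 0 0).tendsto _).comp (((hom_continuous F).tendsto z).comp
        (h z))).congr fun n => ?_
      rw [dsum_mul_matUnit_zero, ← map_mul]
      rfl
  have hG' : ∀ (z : q A), Tendsto
      (fun n => dsum F G (u n) * matUnit 1 1 (G z)) atTop (𝓝 (matUnit 1 1 (G z))) :=
    fun z => by
      refine (((continuous_matUnit 1 1).tendsto _).comp (((hom_continuous G).tendsto z).comp
        (h z))).congr fun n => ?_
      rw [dsum_mul_matUnit_one, ← map_mul]
      rfl
  have hFe : ∀ z, eta A (qIncl A z) = F z := fun _ => rfl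
  have hGe : ∀ z, etaBar A (qIncl A z) = G z := fun _ => rfl
  have key : R A ≤ approxSubalgebra fun n => dsum F G (u n) := by
    refine R_le (isClosed_approxSubalgebra fun n =>
      (NonUnitalStarAlgHom.norm_apply_le _ _).trans (hu n)) ?_
    rintro m (⟨z, rfl⟩ | ⟨z, w, rfl⟩ | ⟨z, w, rfl⟩ | ⟨z, rfl⟩) <;> simp only [hFe, hGe]
    · exact ⟨hF' z, by rw [star_matUnit, ← map_star]; exact hF' _⟩
    · exact ⟨hF z 1 _, by
        rw [star_matUnit, star_mul, ← map_star, ← map_star]; exact hG _ 0 _⟩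
    · exact ⟨hG z 0 _, by
        rw [star_matUnit, star_mul, ← map_star, ← map_star]; exact hF _ 1 _⟩
    · exact ⟨hG' z, by rw [star_matUnit, ← map_star]; exact hG' _⟩
  have hr := (key r.2).1
  rw [tendsto_subtype_rng]
  exact hr.congr fun n => congrArg (· * inclR A r) (hδ (u n)).symm

/-- Both matrices are images of elements of `QA` under the single homomorphism `η ⊕ η̄`, so
quasicentrality in `QA` carries over to `R`. -/
theorem norm_commutator_diagRHom_le (z : q A) (x : A) :
    ‖inclR A (diagRHom (NonUnitalStarAlgHom.id ℂ (q A)) (NonUnitalStarAlgHom.id ℂ (q A)) z) *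
        diagMap A (iota A) (iota A) x - diagMap A (iota A) (iota A) x *
        inclR A (diagRHom (NonUnitalStarAlgHom.id ℂ (q A)) (NonUnitalStarAlgHom.id ℂ (q A)) z)‖ ≤
      ‖qIncl A z * iota A x - iota A x * qIncl A z‖ := by
  have h1 : inclR A (diagRHom (NonUnitalStarAlgHom.id ℂ (q A)) (NonUnitalStarAlgHom.id ℂ (q A)) z) =
      dsum (eta A) (etaBar A) (qIncl A z) := by
    rw [diagRHom_apply, inclR_diagR]; rfl
  have h2 : diagMap A (iota A) (iota A) x = dsum (eta A) (etaBar A) (iota A x) := rfl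
  rw [h1, h2, ← map_mul, ← map_mul, ← map_sub]
  exact NonUnitalStarAlgHom.norm_apply_le _ _

theorem diagMap_mul_inclR_diagR {x : A} {z w : q A} (h : qIncl A w = iota A x * qIncl A z) :
    diagMap A (iota A) (iota A) x * inclR A (diagR z z) = inclR A (diagR w w) := by
  rw [inclR_diagR, inclR_diagR, h, map_mul, map_mul, ← diag_mul_diag]
  rfl

theorem inclR_diagR_mul_diagMap {x : A} {z w : q A} (h : qIncl A w = qIncl A z * iota A x) :
    inclR A (diagR z z) * diagMap A (iota A) (iota A) x = inclR A (diagR w w) := by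
  rw [inclR_diagR, inclR_diagR, h, map_mul, map_mul, ← diag_mul_diag]
  rfl

open TopologicalSpace in
-- This is `exists_multiplier_lift` for the flip of `M₂(Q²A)` and `G_m = η(g_m) ⊕ η̄(g_m)`, with
-- `g_m` a quasicentral partition of unity of `qA`. The unital algebra around `R` is the multiplier
-- algebra of `M₂(Q²A)`, which contains the flip.
theorem exists_flip_multiplier [SeparableSpace A] (x : ℕ → A) :
    ∃ S : DoubleCentralizer ℂ (R A), star S = S ∧
      (∀ r, foldRHom A (S.fst r) = (flip2 (Q A)).L (foldRHom A r)) ∧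
      ∀ k, IsInner (S * dMap A (x k) - dMap A (x k) * S) := by
  obtain ⟨g, hgs, hgd, hg1, hgt⟩ := exists_quasicentral_partition (qIncl A) qIncl_injective
    (exists_qIncl_eq_mul A) (fun k => iota A (x k))
  set δ := diagRHom (NonUnitalStarAlgHom.id ℂ (q A)) (NonUnitalStarAlgHom.id ℂ (q A)) with hδ
  have hδa : ∀ z, δ z = diagR z z := diagRHom_apply _ _
  choose f hf hf' using fun m => exists_offDiag (g m) (g m) (g m) (g m)
  let N := CStarMatrix (Fin 2) (Fin 2) (Q (Q A))
  let c : N →⋆ₙₐ[ℂ] DoubleCentralizer ℂ N := coeHom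
  have hc : ∀ y, (flip2 (Q (Q A))).mult * c y = c ((flip2 (Q (Q A))).L y) :=
    (flip2 (Q (Q A))).mult_mul_coeHom
  have hcn : ∀ y, ‖c y‖ ≤ ‖y‖ := NonUnitalStarAlgHom.norm_apply_le c
  refine exists_multiplier_lift (j := c.comp (inclR A)) (ψ := foldRHom A)
    (D := fun k => dMap A (x k)) (d := fun k => c (diagMap A (iota A) (iota A) (x k)))
    (s := (flip2 (Q (Q A))).mult) (G := fun m => δ (g m)) (f := f)
    (coeHom_injective.comp (inclR_injective A)) ?_ ?_ (Symmetry.star_mult _)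
    (Symmetry.norm_mult_le _) ?_ ?_ ?_ ?_ ?_ ?_ ?_
  · exact fun k r => (congrArg c (diagMult_fst_coe _ _ _ _)).trans (map_mul c _ _)
  · exact fun k r => map_mul c (inclR A r) (diagMap A (iota A) (iota A) (x k))
  · exact fun m => by rw [← map_star, hgs]
  · intro m
    simp only [NonUnitalStarAlgHom.comp_apply]
    rw [mul_assoc, hc, ← map_mul, hδa, hf]
  · intro m k hk
    simp only [NonUnitalStarAlgHom.comp_apply]
    rw [← map_mul, ← map_mul, ← map_sub]
    exact (hcn _).trans ((norm_commutator_diagRHom_le _ _).trans (hgd m k hk))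
  -- Write `G [s, d] G = G s (d G) - (G d) s G`, where `d G` and `G d` are again diagonal elements
  -- of `R`. The two off-diagonal products differ in `Q²A`, but after folding both have the entries
  -- `g ε(x) g` and cancel.
  · intro m k
    obtain ⟨y, hy⟩ := exists_qIncl_eq_mul A (iota A (x k)) (g m)
    obtain ⟨w, hw⟩ := exists_qIncl_eq_mul_right (iota A (x k)) (g m)
    obtain ⟨e₁, h1, h1'⟩ := exists_offDiag (g m) (g m) y y
    obtain ⟨e₂, h2, h2'⟩ := exists_offDiag w w (g m) (g m)
    refine ⟨e₁ - e₂, ?_, ?_⟩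
    · rw [map_sub, h1', h2', hy, hw, ← mul_assoc, sub_self]
    · simp only [NonUnitalStarAlgHom.comp_apply]
      rw [map_sub, map_sub, h1, h2, hδa, ← diagMap_mul_inclR_diagR hy,
        ← inclR_diagR_mul_diagMap hw, map_mul c, map_mul c, map_mul c, ← hc, ← hc, map_mul c]
      noncomm_ring
  · intro a b
    simp only [← map_mul, ← map_sum]
    exact (NonUnitalStarAlgHom.norm_apply_le _ _).trans (hg1 a b)
  · intro r
    refine (tendsto_diagRHom_mul (u := fun n => ∑ m ∈ Finset.range n, g m * g m) (fun n => ?_)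
      (fun z => ?_) r).congr fun n => ?_
    · rw [Finset.range_eq_Ico]; exact hg1 0 n
    · simp only [Finset.sum_mul]; exact hgt z
    · rw [← hδ, map_sum, Finset.sum_mul]
      simp only [map_mul]
  -- After folding, `G` becomes `diag(g, g)` and commutes with the flip, so `G s G` becomes `s G²`.
  · intro m r
    rw [map_mul, hf', map_mul (foldRHom A), map_mul (foldRHom A), hδa, foldRHom_diagR, mul_assoc,
      (flip2 (Q A)).L_mul, ← mul_assoc, ← flip2_diag_self, (flip2 (Q A)).R_mul, diag_mul_flip2_diag]

theorem liftsFlip_of_fst {S : DoubleCentralizer ℂ (R A)} (hs : star S = S)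
    (h : ∀ r, foldRHom A (S.fst r) = (flip2 (Q A)).L (foldRHom A r)) : LiftsFlip S := by
  have h' : ∀ r, foldRHom A (S.snd r) = (flip2 (Q A)).R (foldRHom A r) := fun r => by
    rw [← hs, star_snd, map_star, h, map_star, (flip2 (Q A)).star_L, star_star]
  refine fun r i j => ⟨?_, ?_⟩
  · rw [← foldRHom_apply, h, flip2_L_apply, foldRHom_apply]
  · rw [← foldRHom_apply, h', flip2_R_apply, foldRHom_apply]

/-- In `M₂(QA)` the multiplier `d(x)` acts as `diag(εx, εx)`, which commutes with the flip. So a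
commutator that lies in `R` lies in `J` automatically. -/
theorem foldRHom_eq_zero_of_commutator {S : DoubleCentralizer ℂ (R A)}
    (h : ∀ r, foldRHom A (S.fst r) = (flip2 (Q A)).L (foldRHom A r)) {x : A} {e : R A}
    (he : coeHom e = S * dMap A x - dMap A x * S) : foldRHom A e = 0 := by
  rw [foldRHom_eq, eq_of_mul_foldRHom (M := mat2 (fold (q A)) (toQq A e)) (N := 0) fun r => ?_,
    map_zero]
  rw [← foldRHom_eq, map_zero, zero_mul, ← map_mul, ← coeHom_fst_apply, he, sub_fst, sub_apply,
    map_sub]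
  change foldRHom A (S.fst ((dMap A x).fst r)) - foldRHom A ((dMap A x).fst (S.fst r)) = 0
  rw [h, dMap, acts_foldRHom_diagMult, acts_foldRHom_diagMult, h, flip2_dsum_self, sub_self]

variable (A) in
/-- A separable C*-algebra has a universal map. -/
theorem exists_isUniversalMap [TopologicalSpace.SeparableSpace A] :
    ∃ φ : q A →⋆ₙₐ[ℂ] CStarMatrix (Fin 2) (Fin 2) (q (q A)), IsUniversalMap φ := by
  obtain ⟨S, hs, h, hk⟩ := exists_flip_multiplier (TopologicalSpace.denseSeq A)
  refine exists_isUniversalMap_of (S := ⟨S, hs⟩) (liftsFlip_of_fst hs h) fun x => ?_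
  -- The multiplier was built for a dense sequence, and the `x` whose commutator with `S` lies in
  -- `R` form a closed set.
  have hx : IsInner (S * dMap A x - dMap A x * S) := by
    have hcl : IsClosed {x | IsInner (S * dMap A x - dMap A x * S)} :=
      isClosed_inner.preimage ((continuous_const.mul (hom_continuous (dMap A))).sub
        ((hom_continuous (dMap A)).mul continuous_const))
    exact (TopologicalSpace.denseRange_denseSeq A).induction_on x hcl hk
  obtain ⟨e, he⟩ := hx
  exact ⟨e, memJ_iff.2 (foldRHom_eq_zero_of_commutator h he), he.symm⟩

end Concrete

/-! ### The main theorem -/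

theorem proposition3p5 {A B C D : Type*} [NonUnitalCStarAlgebra A] [NonUnitalCStarAlgebra B]
    [NonUnitalCStarAlgebra C] [NonUnitalCStarAlgebra D] [TopologicalSpace.SeparableSpace A] :
    -- the universal map exists and is unique up to homotopy
    (∃ φ : q A →⋆ₙₐ[ℂ] CStarMatrix (Fin 2) (Fin 2) (q (q A)), IsUniversalMap φ) ∧
    (∀ φ φ' : q A →⋆ₙₐ[ℂ] CStarMatrix (Fin 2) (Fin 2) (q (q A)),
      IsUniversalMap φ → IsUniversalMap φ' → Homotopic φ φ') ∧
    ∀ φ : q A →⋆ₙₐ[ℂ] CStarMatrix (Fin 2) (Fin 2) (q (q A)), IsUniversalMap φ →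
      -- it is a stable homotopy equivalence with homotopy inverse `π_{qA}`
      Homotopic (dsum (NonUnitalStarAlgHom.id ℂ (q (q A))) 0) (φ.comp (piMap (q A))) ∧
      Homotopic (dsum (NonUnitalStarAlgHom.id ℂ (q A)) 0) ((mat2 (piMap (q A))).comp φ) ∧
      (∃ lam₀ lam₁ : q A →⋆ₙₐ[ℂ] R A, Homotopic lam₀ lam₁ ∧ ∀ z : q A,
        mat2 (evalQ (Q A)) (lam₀ z) = mat2 (qIncl A) (dsum (NonUnitalStarAlgHom.id ℂ (q A)) 0 z) ∧
        mat2 (evalQ (Q A)) (lam₁ z) = mat2 (qIncl A) (mat2 (piMap (q A)) (φ z))) ∧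
      -- the additive bijection and its inverse
      (∃ Φ : HomotopyClasses (KTensor (q A)) (KTensor (q B)) ≃ KK A B,
        (∀ α : KTensor (q A) →⋆ₙₐ[ℂ] KTensor (q B),
          Φ (homotopyClass α) = homotopyClass (barMap α)) ∧
        (∀ β : q A →⋆ₙₐ[ℂ] KTensor B,
          Φ.symm (homotopyClass β) = homotopyClass (primeMap φ β)) ∧
        ∀ α α' : KTensor (q A) →⋆ₙₐ[ℂ] KTensor (q B),
          Φ (homotopyClass (addHom α α')) = homotopyClass (addHom (barMap α) (barMap α'))) ∧
      -- the product is well defined on `KK`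
      (∃ P : KK A B → KK B C → KK A C,
        ∀ (α : q A →⋆ₙₐ[ℂ] KTensor B) (β : q B →⋆ₙₐ[ℂ] KTensor C),
          P (homotopyClass α) (homotopyClass β) = homotopyClass (sharp φ β α)) ∧
      -- composition is turned into the product
      (∀ (α : KTensor (q A) →⋆ₙₐ[ℂ] KTensor (q B)) (β : KTensor (q B) →⋆ₙₐ[ℂ] KTensor (q C)),
        homotopyClass (barMap (β.comp α)) = homotopyClass (sharp φ (barMap β) (barMap α))) ∧
      -- the product is associative
      (TopologicalSpace.SeparableSpace B →
        ∀ φB : q B →⋆ₙₐ[ℂ] CStarMatrix (Fin 2) (Fin 2) (q (q B)), IsUniversalMap φB →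
          ∀ (α : q A →⋆ₙₐ[ℂ] KTensor B) (β : q B →⋆ₙₐ[ℂ] KTensor C) (γ : q C →⋆ₙₐ[ℂ] KTensor D),
            homotopyClass (sharp φ (sharp φB γ β) α) =
              homotopyClass (sharp φ γ (sharp φ β α))) := by
  refine ⟨exists_isUniversalMap A, fun φ φ' h h' => h.homotopic h', fun φ hφ =>
    ⟨hφ.homotopic_comp_piMap, hφ.homotopic_piMap_comp, hφ.exists_lifted_homotopy,
      exists_classes_equiv hφ.homotopic_piMap_comp, exists_product φ, fun α β =>
        homotopyClass_eq_iff.2 (barMap_comp_homotopic hφ.homotopic_piMap_comp α β),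
      fun _ φB hφB α β γ => homotopyClass_eq_iff.2
        (sharp_assoc_homotopic hφ.homotopic_piMap_comp hφB.homotopic_piMap_comp α β γ)⟩⟩
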